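/- **Cells.** A $4$-prepolygraph $Q$ consists of sets $Q_0,\dots,Q_4$ of generators; every $(i+1)$-generator has a source and a target, which are parallel $i$-cells of the free precategory $Q^*$. A $1$-cell is a path of $1$-generators. A $2$-cell is a vertical composite of finitely many whiskers $l *_0\alpha *_0 r$ ($\alpha\in Q_2$, $l,r\in Q_1^*$); this decomposition is unique and the number of whiskers is the length $|\phi|$ of the $2$-cell $\phi$. A *rewriting step* is a $3$-cell $\lambda *_1(l *_0 A *_0 r)*_1\rho$ with $A\in Q_3$, $l,r\in Q_1^*$, $\lambda,\rho\in Q_2^*$, and a $3$-cell is a composite of finitely many rewriting steps. (Precategories have no interchange law.) **Gray presentations.** A *Gray presentation* is a $4$-prepolygraph $Q$ that contains the following distinguished generators. (i) For all $0$-composable $\alpha,g,\beta$, with $\alpha\colon f\Rightarrow f'$ and $\beta\colon h\Rightarrow h'$ in $Q_2$ and $g\in Q_1^*$, an *interchange generator* $$X_{\alpha,g,\beta}\colon(\alpha *_0 g *_0 h)*_1(f' *_0 g *_0\beta)\Rrightarrow(f *_0 g *_0\beta)*_1(\alpha *_0 g *_0 h')\quad\text{in } Q_3.$$ For $0$-composable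 $2$-cells $\phi,\psi$ one writes $X_{\phi,\psi}$ for the composite of interchange generators in context that moves the last whisker of $\phi$ past all whiskers of $\psi$, one after the other, then the last but one whisker of $\phi$, and so on. (ii) For all $A\colon\phi\Rrightarrow\phi'$ and $B\colon\psi\Rrightarrow\psi'$ in $Q_3$, $e,h,e',h'\in Q_1^*$ and $\chi\in Q_2^*$ such that the composites make sense, an *independence generator* in $Q_4$ from $$((e *_0 A *_0 h)*_1\chi *_1(e' *_0\psi *_0 h'))*_2((e *_0\phi' *_0 h)*_1\chi *_1(e' *_0 B *_0 h'))$$ to $$((e *_0\phi *_0 h)*_1\chi *_1(e' *_0 B *_0 h'))*_2((e *_0 A *_0 h)*_1\chi *_1(e' *_0\psi' *_0 h')).$$ (iii) For $0$-composable $A,g,\beta$ with $A\colon\phi\Rrightarrow\phi'\colon f\Rightarrow f'$ in $Q_3$, $g\in Q_1^*$, $\beta\colon h\Rightarrow h'$ in $Q_2$, an *interchange naturality generator* in $Q_4$ from $((A *_0 g *_0 h)*_1(f' *_0 g *_0\beta))*_2 X_{\phi',g *_0\beta}$ to $X_{\phi,g *_0\beta}*_2((f *_0 g *_0\beta)*_1(A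 *_0 g *_0 h'))$; and for $0$-composable $\alpha,g,B$ with $\alpha\colon f\Rightarrow f'$ in $Q_2$, $B\colon\psi\Rrightarrow\psi'\colon h\Rightarrow h'$ in $Q_3$, one from $((\alpha *_0 g *_0 h)*_1(f' *_0 g *_0 B))*_2 X_{\alpha *_0 g,\psi'}$ to $X_{\alpha *_0 g,\psi}*_2((f *_0 g *_0 B)*_1(\alpha *_0 g *_0 h'))$. The $3$-generators other than the interchange generators are called *operational*. **Critical branchings.** A *local branching* is a pair $(S_1,S_2)$ of rewriting steps with the same source. It is - *trivial* if $S_1=S_2$; - *minimal* if, whenever $S_i=\lambda *_1(l *_0 S_i' *_0 r)*_1\rho$ for $i=1,2$ with a local branching $(S_1',S_2')$ and cells $l,r\in Q_1^*$, $\lambda,\rho\in Q_2^*$, all of $l,r,\lambda,\rho$ are identities; - *independent* if $S_1=(l_1 *_0 A_1 *_0 r_1)*_1\chi *_1(l_2 *_0\phi_2 *_0 r_2)$ and $S_2=(l_1 *_0\phi_1 *_0 r_1)*_1\chi *_1(l_2 *_0 A_2 *_0 r_2)$ for some $A_i\colon\phi_i\Rrightarrow\phi_i'$ in $Q_3$,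 $l_i,r_i\in Q_1^*$, $\chi\in Q_2^*$; - *natural* if, for some $A\colon\phi\Rrightarrow\phi'\colon f\Rightarrow f'$ in $Q_3$, $g\in Q_1^*$ and a $2$-cell $\psi\colon h\Rightarrow h'$, with $\phi$ and $\psi$ of positive length, $S_1=(A *_0 g *_0 h)*_1(f' *_0 g *_0\psi)$ and $S_2$ applies to its source $(\phi *_0 g *_0 h)*_1(f' *_0 g *_0\psi)$ the interchange generator that exchanges the last whisker of $\phi$ and the first whisker of $\psi$; or if the mirror condition holds: for some $2$-cell $\phi\colon f\Rightarrow f'$, $g\in Q_1^*$ and $B\colon\psi\Rrightarrow\psi'\colon h\Rightarrow h'$ in $Q_3$, with $\phi$ and $\psi$ of positive length, $S_1=(\phi *_0 g *_0 h)*_1(f' *_0 g *_0 B)$ and $S_2$ is as before; - *critical* if it is minimal and neither $(S_1,S_2)$ nor $(S_2,S_1)$ is trivial, independent or natural. **Theorem.** Let $Q$ be a Gray presentation such that $Q_2$ is finite, $Q$ has only finitely many operational $3$-generators (for instance because $Q_3$ is finite), and the source of every $3$-generator has positive length. Then $Q$ has only finitely many critical branchings. Moreover they can be computed, uniformly in $Q$: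 there is a partial recursive function $F$ with the following property. Let $Q$ be a Gray presentation in which the source of every $3$-generator has positive length, with its $0$-, $1$-, $2$-generators and operational $3$-generators named by natural numbers (distinct generators of the same kind having distinct names), and let $c$ be a pair of finite lists: the list of all $2$-generators and the list of all operational $3$-generators, each with its name, source and target, where $1$- and $2$-cells are written through the names of their generators and a $1$-generator is written together with the names of its source and target. Then $F(c)$ is defined and is a finite list whose members are exactly the codes of the critical branchings of $Q$; here a rewriting step is coded by its unique decomposition $(\lambda,l,A,r,\rho)$, and an interchange generator $A=X_{\alpha,g,\beta}$ by the code of $(\alpha,g,\beta)$. -/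

import Mathlib

universe u

namespace GrayRewriting

/-! ### Paths

A finite sequence of edges is stored as its list of edges, together with its starting vertex. -/

/-- `IsPath s t x w`: the list of edges `w` is a path starting at `x`, where `s` and `t` give the
source and the target of an edge. -/
def IsPath {V E : Type*} (s t : E → V) : V → List E → Prop
  | _, [] => True
  | x, a :: w => s a = x ∧ IsPath s t (t a) w

/-- The vertex at which the path `w` starting at `x` ends. -/
def pathEnd {V E : Type*} (t : E → V) : V → List E → V
  | x, [] => x
  | _, a :: w => pathEnd t (t a) w

/-! ### Dimension one -/

/-- A `1`-prepolygraph: `0`-generators and `1`-generators `a : src0 a ⟶ tgt0 a`. -/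
structure Prepoly1 where
  G0 : Type u
  G1 : Type u
  src0 : G1 → G0
  tgt0 : G1 → G0

/-- Underlying data of a `1`-cell. The `1`-cells of the free precategory, that is the paths of
`1`-generators, are the `f : P.Cell1` that satisfy `f.IsCell`. -/
@[ext] structure Prepoly1.Cell1 (P : Prepoly1.{u}) where
  dom : P.G0
  word : List P.G1

namespace Prepoly1.Cell1

variable {P : Prepoly1.{u}}

def IsCell (f : P.Cell1) : Prop := IsPath P.src0 P.tgt0 f.dom f.word

def cod (f : P.Cell1) : P.G0 := pathEnd P.tgt0 f.dom f.word

/-- The identity of a `0`-cell. -/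
def one (x : P.G0) : P.Cell1 := ⟨x, []⟩

/-- Composition of `1`-cells (meaningful when `f.cod = g.dom`). -/
def comp (f g : P.Cell1) : P.Cell1 := ⟨f.dom, f.word ++ g.word⟩

end Prepoly1.Cell1

infixl:75 " ⬝₀ " => Prepoly1.Cell1.comp

/-! ### Dimension two -/

/-- A `2`-prepolygraph: a `1`-prepolygraph with `2`-generators between parallel `1`-cells. -/
structure Prepoly2 extends Prepoly1.{u} where
  G2 : Type u
  src1 : G2 → toPrepoly1.Cell1
  tgt1 : G2 → toPrepoly1.Cell1
  isCell_src1 : ∀ α, (src1 α).IsCell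
  isCell_tgt1 : ∀ α, (tgt1 α).IsCell
  dom_tgt1 : ∀ α, (tgt1 α).dom = (src1 α).dom
  cod_tgt1 : ∀ α, (tgt1 α).cod = (src1 α).cod

/-- Underlying data of a `2`-dimensional whisker `left ∘₀ gen ∘₀ right`. -/
@[ext] structure Prepoly2.Whisker (P : Prepoly2.{u}) where
  left : P.Cell1
  gen : P.G2
  right : P.Cell1

namespace Prepoly2.Whisker

variable {P : Prepoly2.{u}}

def IsCell (w : P.Whisker) : Prop :=
  w.left.IsCell ∧ w.right.IsCell ∧
    w.left.cod = (P.src1 w.gen).dom ∧ (P.src1 w.gen).cod = w.right.dom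

def src (w : P.Whisker) : P.Cell1 := w.left ⬝₀ P.src1 w.gen ⬝₀ w.right

def tgt (w : P.Whisker) : P.Cell1 := w.left ⬝₀ P.tgt1 w.gen ⬝₀ w.right

def lwhisk (f : P.Cell1) (w : P.Whisker) : P.Whisker := ⟨f ⬝₀ w.left, w.gen, w.right⟩

def rwhisk (w : P.Whisker) (f : P.Cell1) : P.Whisker := ⟨w.left, w.gen, w.right ⬝₀ f⟩

end Prepoly2.Whisker

/-- Underlying data of a `2`-cell: its source and the vertically composed whiskers. Every `2`-cell
of the free precategory is in a unique way a composite of `2`-dimensional whiskers, so that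
the `2`-cells are the `φ : P.Cell2` that satisfy `φ.IsCell`. -/
@[ext] structure Prepoly2.Cell2 (P : Prepoly2.{u}) where
  dom : P.Cell1
  steps : List P.Whisker

namespace Prepoly2.Cell2

variable {P : Prepoly2.{u}}

def IsCell (φ : P.Cell2) : Prop :=
  φ.dom.IsCell ∧ (∀ w ∈ φ.steps, w.IsCell) ∧ IsPath Whisker.src Whisker.tgt φ.dom φ.steps

def cod (φ : P.Cell2) : P.Cell1 := pathEnd Whisker.tgt φ.dom φ.steps

/-- The length of a `2`-cell: the number of its whiskers. -/
def length (φ : P.Cell2) : ℕ := φ.steps.length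

/-- The identity of a `1`-cell. -/
def one (f : P.Cell1) : P.Cell2 := ⟨f, []⟩

/-- A `2`-generator as a `2`-cell. -/
def ofGen (α : P.G2) : P.Cell2 :=
  ⟨P.src1 α, [⟨Prepoly1.Cell1.one (P.src1 α).dom, α, Prepoly1.Cell1.one (P.src1 α).cod⟩]⟩

/-- Vertical composition (meaningful when `φ.cod = ψ.dom`). -/
def comp (φ ψ : P.Cell2) : P.Cell2 := ⟨φ.dom, φ.steps ++ ψ.steps⟩

/-- The composite of a `1`-cell and a `2`-cell (meaningful when `f.cod = φ.dom.dom`). -/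
def lwhisk (f : P.Cell1) (φ : P.Cell2) : P.Cell2 :=
  ⟨f ⬝₀ φ.dom, φ.steps.map (fun w => Whisker.lwhisk f w)⟩

/-- The composite of a `2`-cell and a `1`-cell (meaningful when `φ.dom.cod = f.dom`). -/
def rwhisk (φ : P.Cell2) (f : P.Cell1) : P.Cell2 :=
  ⟨φ.dom ⬝₀ f, φ.steps.map (fun w => Whisker.rwhisk w f)⟩

end Prepoly2.Cell2

infixl:70 " ⬝₁ " => Prepoly2.Cell2.comp
infixr:78 " ◁₂ " => Prepoly2.Cell2.lwhisk
infixl:77 " ▷₂ " => Prepoly2.Cell2.rwhisk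

/-- Triples `α, g, β` of two `2`-generators and a `1`-cell that are `0`-composable. -/
structure Prepoly2.InterchangeIndex (P : Prepoly2.{u}) where
  fst : P.G2
  mid : P.Cell1
  snd : P.G2
  isCell_mid : mid.IsCell
  fst_mid : (P.src1 fst).cod = mid.dom
  mid_snd : mid.cod = (P.src1 snd).dom

namespace Prepoly2.InterchangeIndex

variable {P : Prepoly2.{u}}

/-- The source `(α ∘₀ g ∘₀ h) ∘₁ (f' ∘₀ g ∘₀ β)`, where `α : f ⟹ f'` and `β : h ⟹ h'`. -/
def source (x : P.InterchangeIndex) : P.Cell2 :=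
  (Cell2.ofGen x.fst ▷₂ (x.mid ⬝₀ P.src1 x.snd)) ⬝₁
    ((P.tgt1 x.fst ⬝₀ x.mid) ◁₂ Cell2.ofGen x.snd)

/-- The target `(f ∘₀ g ∘₀ β) ∘₁ (α ∘₀ g ∘₀ h')`, where `α : f ⟹ f'` and `β : h ⟹ h'`. -/
def target (x : P.InterchangeIndex) : P.Cell2 :=
  ((P.src1 x.fst ⬝₀ x.mid) ◁₂ Cell2.ofGen x.snd) ⬝₁
    (Cell2.ofGen x.fst ▷₂ (x.mid ⬝₀ P.tgt1 x.snd))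

end Prepoly2.InterchangeIndex

/-! ### Shuffles of two `2`-cells -/

/-- The two kinds of letters of a shuffle. A shuffle of the words `l₁ … l_k` and `r₁ … r_k'` keeps
the order of the letters of each kind, so their indices need not be recorded. -/
inductive Letter where
  | l : Letter
  | r : Letter
  deriving DecidableEq

namespace Prepoly2

variable {P : Prepoly2.{u}}

/-- The whiskers obtained by reading the word, where the letter `l` consumes the next whisker of the
list `as` of whiskers of the left-hand `2`-cell, and `r` the next one of the list `bs`
for the right-hand one; `f` and `g` are the current `1`-cells on the left and on the right. -/
def interleave : List Letter → P.Cell1 → List P.Whisker → P.Cell1 → List P.Whisker →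
    List P.Whisker
  | .l :: u, _, a :: as, g, bs => a.rwhisk g :: interleave u a.tgt as g bs
  | .r :: u, f, as, _, b :: bs => b.lwhisk f :: interleave u f as b.tgt bs
  | _, _, _, _, _ => []

/-- The `1`-cell that is reached after the first `i` whiskers of `φ`. -/
def Cell2.boundary (φ : P.Cell2) (i : ℕ) : P.Cell1 :=
  pathEnd Whisker.tgt φ.dom (φ.steps.take i)

/-- The `2`-cell `[u]` of a word `u`, read after `i` letters `l` and `j` letters `r`. -/
def Cell2.interp (φ ψ : P.Cell2) (i j : ℕ) (u : List Letter) : P.Cell2 :=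
  ⟨φ.boundary i ⬝₀ ψ.boundary j,
    interleave u (φ.boundary i) (φ.steps.drop i) (ψ.boundary j) (ψ.steps.drop j)⟩

end Prepoly2

/-! ### Dimension three -/

/-- A `3`-prepolygraph: a `2`-prepolygraph with `3`-generators between parallel `2`-cells. -/
structure Prepoly3 extends Prepoly2.{u} where
  G3 : Type u
  src2 : G3 → toPrepoly2.Cell2
  tgt2 : G3 → toPrepoly2.Cell2
  isCell_src2 : ∀ A, (src2 A).IsCell
  isCell_tgt2 : ∀ A, (tgt2 A).IsCell
  dom_tgt2 : ∀ A, (tgt2 A).dom = (src2 A).dom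
  cod_tgt2 : ∀ A, (tgt2 A).cod = (src2 A).cod

/-- Underlying data of a rewriting step `lam ∘₁ (left ∘₀ gen ∘₀ right) ∘₁ rho`. The rewriting steps,
that is the `3`-dimensional whiskers, are the `S : P.Step` that satisfy `S.IsCell`; this
decomposition of a rewriting step is unique. -/
@[ext] structure Prepoly3.Step (P : Prepoly3.{u}) where
  lam : P.Cell2
  left : P.Cell1
  gen : P.G3
  right : P.Cell1
  rho : P.Cell2

namespace Prepoly3.Step

variable {P : Prepoly3.{u}}

def IsCell (S : P.Step) : Prop :=
  S.lam.IsCell ∧ S.left.IsCell ∧ S.right.IsCell ∧ S.rho.IsCell ∧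
    S.left.cod = (P.src2 S.gen).dom.dom ∧ (P.src2 S.gen).dom.cod = S.right.dom ∧
    S.lam.cod = S.left ⬝₀ (P.src2 S.gen).dom ⬝₀ S.right ∧
    S.left ⬝₀ (P.src2 S.gen).cod ⬝₀ S.right = S.rho.dom

def src (S : P.Step) : P.Cell2 := S.lam ⬝₁ (S.left ◁₂ P.src2 S.gen ▷₂ S.right) ⬝₁ S.rho

def tgt (S : P.Step) : P.Cell2 := S.lam ⬝₁ (S.left ◁₂ P.tgt2 S.gen ▷₂ S.right) ⬝₁ S.rho

/-- A `3`-generator as a rewriting step. -/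
def ofGen (A : P.G3) : P.Step :=
  ⟨Prepoly2.Cell2.one (P.src2 A).dom, Prepoly1.Cell1.one (P.src2 A).dom.dom, A,
    Prepoly1.Cell1.one (P.src2 A).dom.cod, Prepoly2.Cell2.one (P.src2 A).cod⟩

/-- The composite of a `1`-cell and a step (meaningful when `f.cod = S.src.dom.dom`). -/
def lwhisk (f : P.Cell1) (S : P.Step) : P.Step :=
  ⟨f ◁₂ S.lam, f ⬝₀ S.left, S.gen, S.right, f ◁₂ S.rho⟩

/-- The composite of a step and a `1`-cell (meaningful when `S.src.dom.cod = f.dom`). -/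
def rwhisk (S : P.Step) (f : P.Cell1) : P.Step :=
  ⟨S.lam ▷₂ f, S.left, S.gen, S.right ⬝₀ f, S.rho ▷₂ f⟩

/-- The composite of a `2`-cell and a step (meaningful when `φ.cod = S.src.dom`). -/
def pre (φ : P.Cell2) (S : P.Step) : P.Step := ⟨φ ⬝₁ S.lam, S.left, S.gen, S.right, S.rho⟩

/-- The composite of a step and a `2`-cell (meaningful when `S.src.cod = φ.dom`). -/
def post (S : P.Step) (φ : P.Cell2) : P.Step := ⟨S.lam, S.left, S.gen, S.right, S.rho ⬝₁ φ⟩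

end Prepoly3.Step

infixr:78 " ◁₃ " => Prepoly3.Step.lwhisk
infixl:77 " ▷₃ " => Prepoly3.Step.rwhisk
infixr:70 " ◂₃ " => Prepoly3.Step.pre
infixl:69 " ▸₃ " => Prepoly3.Step.post

/-- Underlying data of a `3`-cell (a rewriting path): its source and the composed rewriting steps.
The `3`-cells of the free precategory are the `F : P.Cell3` that satisfy `F.IsCell`. -/
@[ext] structure Prepoly3.Cell3 (P : Prepoly3.{u}) where
  dom : P.Cell2
  steps : List P.Step

namespace Prepoly3.Cell3

variable {P : Prepoly3.{u}}

def IsCell (F : P.Cell3) : Prop :=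
  F.dom.IsCell ∧ (∀ S ∈ F.steps, S.IsCell) ∧ IsPath Step.src Step.tgt F.dom F.steps

def cod (F : P.Cell3) : P.Cell2 := pathEnd Step.tgt F.dom F.steps

/-- A rewriting step as a `3`-cell. -/
def ofStep (S : P.Step) : P.Cell3 := ⟨S.src, [S]⟩

/-- Composition of `3`-cells along `2`-cells (meaningful when `F.cod = G.dom`). -/
def comp (F G : P.Cell3) : P.Cell3 := ⟨F.dom, F.steps ++ G.steps⟩

end Prepoly3.Cell3

infixl:65 " ⬝₂ " => Prepoly3.Cell3.comp

/-- `IsTransition X φ ψ u v S`: the step `S` is `[w_{u,v}]_{φ,ψ}`, which applies in context the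
interchange generator exchanging the letters of the factor `l r` of the word `u l r v`. -/
def Prepoly3.IsTransition {P : Prepoly3.{u}} (X : P.InterchangeIndex → P.G3) (φ ψ : P.Cell2)
    (u v : List Letter) (S : P.Step) : Prop :=
  ∃ (a b : P.Whisker) (x : P.InterchangeIndex),
    φ.steps[u.count .l]? = some a ∧ ψ.steps[u.count .r]? = some b ∧
    x.fst = a.gen ∧ x.mid = a.right ⬝₀ b.left ∧ x.snd = b.gen ∧
    S = ⟨φ.interp ψ 0 0 u, a.left, X x, b.right,
      φ.interp ψ (u.count .l + 1) (u.count .r + 1) v⟩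

/-- The pairs `(u, v)` of the standard path `w_{u₁,v₁}, …, w_{u_kk',v_kk'}` from
`l₁ … l_k r₁ … r_k'` to `r₁ … r_k' l₁ … l_k`: the last letter `l` is moved to the right of all
the letters `r`, one after the other, then the last but one letter `l`, and so on. -/
def stdPath (k k' : ℕ) : List (List Letter × List Letter) :=
  (List.range k).reverse.flatMap fun p => (List.range k').map fun q =>
    (List.replicate p .l ++ List.replicate q .r,
      List.replicate (k' - 1 - q) .r ++ List.replicate (k - 1 - p) .l)

/-- `IsInterchangeCell X φ ψ F`: the `3`-cell `F` is the interchange cell `X_{φ,ψ}`, the composite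
of the transitions along the standard path. -/
def Prepoly3.IsInterchangeCell {P : Prepoly3.{u}} (X : P.InterchangeIndex → P.G3)
    (φ ψ : P.Cell2) (F : P.Cell3) : Prop :=
  F.dom = φ.interp ψ 0 0 (List.replicate φ.length .l ++ List.replicate ψ.length .r) ∧
    List.Forall₂ (fun uv S => P.IsTransition X φ ψ uv.1 uv.2 S)
      (stdPath φ.length ψ.length) F.steps

/-! ### Dimension four and Gray presentations -/

/-- A `4`-prepolygraph: a `3`-prepolygraph with `4`-generators between parallel `3`-cells. -/
structure Prepoly4 extends Prepoly3.{u} where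
  G4 : Type u
  src3 : G4 → toPrepoly3.Cell3
  tgt3 : G4 → toPrepoly3.Cell3
  isCell_src3 : ∀ G, (src3 G).IsCell
  isCell_tgt3 : ∀ G, (tgt3 G).IsCell
  dom_tgt3 : ∀ G, (tgt3 G).dom = (src3 G).dom
  cod_tgt3 : ∀ G, (tgt3 G).cod = (src3 G).cod

open Prepoly3 Prepoly2.Cell2 in
/-- A Gray presentation: a `4`-prepolygraph that contains interchange generators, independence
generators and interchange naturality generators (of two kinds). -/
structure GrayPresentation extends Prepoly4.{u} where
  /-- The interchange generators. -/
  X : toPrepoly2.InterchangeIndex → G3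
  src2_X : ∀ x, src2 (X x) = x.source
  tgt2_X : ∀ x, tgt2 (X x) = x.target
  /-- The independence generators. -/
  independence : ∀ (A B : G3) (e h e' h' : toPrepoly1.Cell1) (χ : toPrepoly2.Cell2),
    e.IsCell → h.IsCell → e'.IsCell → h'.IsCell → χ.IsCell →
    e.cod = (src2 A).dom.dom → (src2 A).dom.cod = h.dom →
    e'.cod = (src2 B).dom.dom → (src2 B).dom.cod = h'.dom →
    χ.dom = e ⬝₀ (src2 A).cod ⬝₀ h → χ.cod = e' ⬝₀ (src2 B).dom ⬝₀ h' →
    ∃ G : G4,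
      src3 G =
        Cell3.ofStep ((e ◁₃ Step.ofGen A ▷₃ h) ▸₃ (χ ⬝₁ (e' ◁₂ src2 B ▷₂ h'))) ⬝₂
        Cell3.ofStep (((e ◁₂ tgt2 A ▷₂ h) ⬝₁ χ) ◂₃ (e' ◁₃ Step.ofGen B ▷₃ h')) ∧
      tgt3 G =
        Cell3.ofStep (((e ◁₂ src2 A ▷₂ h) ⬝₁ χ) ◂₃ (e' ◁₃ Step.ofGen B ▷₃ h')) ⬝₂
        Cell3.ofStep ((e ◁₃ Step.ofGen A ▷₃ h) ▸₃ (χ ⬝₁ (e' ◁₂ tgt2 B ▷₂ h')))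
  /-- The interchange naturality generators for `0`-composable `A, g, β`. -/
  naturality_left : ∀ (A : G3) (g : toPrepoly1.Cell1) (β : G2), g.IsCell →
    (src2 A).dom.cod = g.dom → g.cod = (src1 β).dom →
    ∃ (G : G4) (F F' : toPrepoly3.Cell3),
      IsInterchangeCell X (src2 A) (g ◁₂ ofGen β) F ∧
      IsInterchangeCell X (tgt2 A) (g ◁₂ ofGen β) F' ∧
      src3 G =
        Cell3.ofStep ((Step.ofGen A ▷₃ (g ⬝₀ src1 β)) ▸₃
          (((src2 A).cod ⬝₀ g) ◁₂ ofGen β)) ⬝₂ F' ∧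
      tgt3 G =
        F ⬝₂ Cell3.ofStep ((((src2 A).dom ⬝₀ g) ◁₂ ofGen β) ◂₃
          (Step.ofGen A ▷₃ (g ⬝₀ tgt1 β)))
  /-- The interchange naturality generators for `0`-composable `α, g, B`. -/
  naturality_right : ∀ (α : G2) (g : toPrepoly1.Cell1) (B : G3), g.IsCell →
    (src1 α).cod = g.dom → g.cod = (src2 B).dom.dom →
    ∃ (G : G4) (F F' : toPrepoly3.Cell3),
      IsInterchangeCell X (ofGen α ▷₂ g) (src2 B) F ∧
      IsInterchangeCell X (ofGen α ▷₂ g) (tgt2 B) F' ∧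
      src3 G =
        Cell3.ofStep ((ofGen α ▷₂ (g ⬝₀ (src2 B).dom)) ◂₃
          ((tgt1 α ⬝₀ g) ◁₃ Step.ofGen B)) ⬝₂ F' ∧
      tgt3 G =
        F ⬝₂ Cell3.ofStep (((src1 α ⬝₀ g) ◁₃ Step.ofGen B) ▸₃
          (ofGen α ▷₂ (g ⬝₀ (src2 B).cod)))

/-! ### Branchings -/

namespace Prepoly3

variable (P : Prepoly3.{u})

/-- A local branching: two rewriting steps with the same source. -/
def IsLocalBranching (S₁ S₂ : P.Step) : Prop := S₁.IsCell ∧ S₂.IsCell ∧ S₁.src = S₂.src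

/-- A minimal local branching: one that does not arise from another local branching by
composition with cells that are not all identities. -/
def IsMinimal (S₁ S₂ : P.Step) : Prop :=
  ∀ (S₁' S₂' : P.Step) (l r : P.Cell1) (lam rho : P.Cell2), P.IsLocalBranching S₁' S₂' →
    l.IsCell → r.IsCell → lam.IsCell → rho.IsCell →
    l.cod = S₁'.src.dom.dom → S₁'.src.dom.cod = r.dom →
    lam.cod = l ⬝₀ S₁'.src.dom ⬝₀ r → l ⬝₀ S₁'.src.cod ⬝₀ r = rho.dom →
    S₁ = lam ◂₃ (l ◁₃ S₁' ▷₃ r) ▸₃ rho → S₂ = lam ◂₃ (l ◁₃ S₂' ▷₃ r) ▸₃ rho →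
    l.word = [] ∧ r.word = [] ∧ lam.steps = [] ∧ rho.steps = []

/-- An independent branching: the two steps apply `3`-generators one above the other. -/
def IsIndependent (S₁ S₂ : P.Step) : Prop :=
  ∃ (A₁ A₂ : P.G3) (l₁ r₁ l₂ r₂ : P.Cell1) (χ : P.Cell2),
    l₁.IsCell ∧ r₁.IsCell ∧ l₂.IsCell ∧ r₂.IsCell ∧ χ.IsCell ∧
    l₁.cod = (P.src2 A₁).dom.dom ∧ (P.src2 A₁).dom.cod = r₁.dom ∧
    l₂.cod = (P.src2 A₂).dom.dom ∧ (P.src2 A₂).dom.cod = r₂.dom ∧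
    χ.dom = l₁ ⬝₀ (P.src2 A₁).cod ⬝₀ r₁ ∧ χ.cod = l₂ ⬝₀ (P.src2 A₂).dom ⬝₀ r₂ ∧
    S₁ = (l₁ ◁₃ Step.ofGen A₁ ▷₃ r₁) ▸₃ (χ ⬝₁ (l₂ ◁₂ P.src2 A₂ ▷₂ r₂)) ∧
    S₂ = ((l₁ ◁₂ P.src2 A₁ ▷₂ r₁) ⬝₁ χ) ◂₃ (l₂ ◁₃ Step.ofGen A₂ ▷₃ r₂)

end Prepoly3

namespace GrayPresentation

variable (Q : GrayPresentation.{u})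

/-- Interchange generators; the other `3`-generators are called operational. -/
def IsInterchange (A : Q.G3) : Prop := ∃ x, Q.X x = A

def IsOperational (A : Q.G3) : Prop := ¬ Q.IsInterchange A

open Prepoly3

/-- A natural branching, of the first kind (a `3`-generator `A` to the left of a `2`-cell `ψ`)
or of the second kind (a `3`-generator `B` to the right of a `2`-cell `φ`). -/
def IsNatural (S₁ S₂ : Q.Step) : Prop :=
  (∃ (A : Q.G3) (g : Q.Cell1) (ψ : Q.Cell2), g.IsCell ∧ ψ.IsCell ∧
    (Q.src2 A).dom.cod = g.dom ∧ g.cod = ψ.dom.dom ∧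
    S₁ = (Step.ofGen A ▷₃ (g ⬝₀ ψ.dom)) ▸₃ (((Q.src2 A).cod ⬝₀ g) ◁₂ ψ) ∧
    IsTransition Q.X (Q.src2 A) (g ◁₂ ψ) (List.replicate ((Q.src2 A).length - 1) .l)
      (List.replicate (ψ.length - 1) .r) S₂) ∨
  (∃ (φ : Q.Cell2) (g : Q.Cell1) (B : Q.G3), φ.IsCell ∧ g.IsCell ∧
    φ.dom.cod = g.dom ∧ g.cod = (Q.src2 B).dom.dom ∧
    S₁ = (φ ▷₂ (g ⬝₀ (Q.src2 B).dom)) ◂₃ ((φ.cod ⬝₀ g) ◁₃ Step.ofGen B) ∧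
    IsTransition Q.X (φ ▷₂ g) (Q.src2 B) (List.replicate (φ.length - 1) .l)
      (List.replicate ((Q.src2 B).length - 1) .r) S₂)

/-- A critical branching: a minimal local branching such that neither it nor its symmetric
branching is trivial, independent or natural. -/
def IsCritical (S₁ S₂ : Q.Step) : Prop :=
  Q.IsLocalBranching S₁ S₂ ∧ Q.IsMinimal S₁ S₂ ∧ S₁ ≠ S₂ ∧
    ¬ Q.IsIndependent S₁ S₂ ∧ ¬ Q.IsIndependent S₂ S₁ ∧
    ¬ Q.IsNatural S₁ S₂ ∧ ¬ Q.IsNatural S₂ S₁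

end GrayPresentation

/-! ### Encodings by natural numbers -/

/-- Codes of `1`-cells: the source, and for each `1`-generator its source, name and target. -/
abbrev Code1 := ℕ × List (ℕ × ℕ × ℕ)

/-- Codes of `2`-cells: the source, and the list of the whiskers. -/
abbrev Code2 := Code1 × List (Code1 × ℕ × Code1)

/-- Codes of `3`-generators: the name of an operational generator, or a triple `α, g, β`. -/
abbrev CodeG3 := ℕ ⊕ (ℕ × Code1 × ℕ)

/-- Codes of rewriting steps. -/
abbrev CodeStep := Code2 × Code1 × CodeG3 × Code1 × Code2

instance : Primcodable CodeStep := Primcodable.prod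

/-- Finite descriptions of Gray presentations: the lists of the `2`-generators and of the operational
`3`-generators, each with its name, its source and its target. -/
abbrev CodePresentation := List (ℕ × Code1 × Code1) × List (ℕ × Code2 × Code2)

/-- Names of the generators of a Gray presentation: natural numbers, distinct for distinct
`0`-generators, `1`-generators, `2`-generators and operational `3`-generators. -/
structure Naming (Q : GrayPresentation.{u}) where
  n0 : Q.G0 → ℕ
  n1 : Q.G1 → ℕ
  n2 : Q.G2 → ℕ
  n3 : Q.G3 → ℕ
  inj0 : Function.Injective n0
  inj1 : Function.Injective n1
  inj2 : Function.Injective n2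
  inj3 : Set.InjOn n3 {A | Q.IsOperational A}

namespace Naming

variable {Q : GrayPresentation.{u}} (e : Naming Q)

def code1 (f : Q.Cell1) : Code1 :=
  (e.n0 f.dom, f.word.map fun a => (e.n0 (Q.src0 a), e.n1 a, e.n0 (Q.tgt0 a)))

def code2 (φ : Q.Cell2) : Code2 :=
  (e.code1 φ.dom, φ.steps.map fun w => (e.code1 w.left, e.n2 w.gen, e.code1 w.right))

/-- `e.CodesG3 A c`: the code of the `3`-generator `A` is `c`. -/
def CodesG3 (A : Q.G3) (c : CodeG3) : Prop :=
  (Q.IsOperational A ∧ c = .inl (e.n3 A)) ∨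
    ∃ x, Q.X x = A ∧ c = .inr (e.n2 x.fst, e.code1 x.mid, e.n2 x.snd)

/-- `e.CodesStep S c`: the code of the rewriting step `S` is `c`. -/
def CodesStep (S : Q.Step) (c : CodeStep) : Prop :=
  ∃ d, e.CodesG3 S.gen d ∧
    c = (e.code2 S.lam, e.code1 S.left, d, e.code1 S.right, e.code2 S.rho)

/-- `e.Describes c`: the lists in `c` are lists of all the `2`-generators and of all the operational
`3`-generators of the presentation, with their sources and targets. -/
def Describes (c : CodePresentation) : Prop :=
  (∀ x, x ∈ c.1 ↔ ∃ α, x = (e.n2 α, e.code1 (Q.src1 α), e.code1 (Q.tgt1 α))) ∧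
  (∀ x, x ∈ c.2 ↔
    ∃ A, Q.IsOperational A ∧ x = (e.n3 A, e.code2 (Q.src2 A), e.code2 (Q.tgt2 A)))

end Naming

end GrayRewriting

namespace GrayRewriting

/-! ### Paths -/

section Paths

variable {V E V' E' : Type*} {s t : E → V} {s' t' : E' → V'}

/-! The `3`-generator of a rewriting step occupies an interval of consecutive whiskers of the
source. For a local branching, minimality together with non-independence becomes a condition on
these data (`isTight_iff`): the two intervals overlap, and on each of the four sides (`lam`, `rho`,
`left`, `right`) one of the two contexts is empty. Vertically this holds because a first or last
whisker common to both contexts can be stripped off. Horizontally, overlapping intervals that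
jointly cover the source share a whisker. If both left contexts were nonempty, this whisker would
show that they begin with the same `1`-generator. Every whisker of the source would then begin with
it, and it could be stripped off too.

For tight branchings naturality is numerical as well. Exactly one whisker of an interchange
generator `X_{α,g,β}` meets the other generator, at its last or first whisker, and the `1`-cell of
that whisker facing the gap is no longer than `g` (`isNatural_of_below`, `isNatural_of_above`,
`IsNatural.below_or_above`). This gives `isCritical_iff`.

The only unbounded data are the horizontal contexts and the middle path `g`. For two operational
generators, comparing a shared whisker, with one context empty on each side, makes both contexts
segments of paths in the sources of the generators. For an operational and an interchange generator,
either both whiskers of the latter are shared, and then `g` is a segment of a left context, or one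
is shared, and non-naturality forces `g` to be shorter than the path next to it, hence a segment of
it. Two interchange generators overlap either naturally or completely, and then the steps are equal.
So all contexts and middle paths are segments of finitely many given paths
(`IsCritical.isKnownStep`).

What remains is a finite search over pairs of generators in such contexts and splittings of their
sources, filtered by equalities of words and comparisons of lengths (`Labels.mem_criticalList`). The
search is written for labels in arbitrary types. Labelling each generator by itself gives
finiteness; over `ℕ` the search is primitive recursive. -/

theorem pathEnd_append (x : V) (a b : List E) :
    pathEnd t x (a ++ b) = pathEnd t (pathEnd t x a) b := by
  induction a generalizing x with
  | nil => rfl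
  | cons e a ih => exact ih _

theorem isPath_append (x : V) (a b : List E) :
    IsPath s t x (a ++ b) ↔ IsPath s t x a ∧ IsPath s t (pathEnd t x a) b := by
  induction a generalizing x with
  | nil => simp [IsPath, pathEnd]
  | cons e a ih => simp [IsPath, pathEnd, ih, and_assoc]

theorem pathEnd_eq_of_ne_nil {a : List E} (h : a ≠ []) (x y : V) :
    pathEnd t x a = pathEnd t y a := by
  cases a with
  | nil => exact absurd rfl h
  | cons e a => rfl

theorem pathEnd_map {g : E → E'} {k : V → V'} (h : ∀ e, t' (g e) = k (t e)) (x : V) (a : List E) :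
    pathEnd t' (k x) (a.map g) = k (pathEnd t x a) := by
  induction a generalizing x with
  | nil => rfl
  | cons e a ih => simpa [pathEnd, h] using ih _

theorem isPath_map {g : E → E'} {k : V → V'} (hs : ∀ e, s' (g e) = k (s e))
    (ht : ∀ e, t' (g e) = k (t e)) {x : V} {a : List E} (h : IsPath s t x a) :
    IsPath s' t' (k x) (a.map g) := by
  induction a generalizing x with
  | nil => trivial
  | cons e a ih => exact ⟨by rw [hs, h.1], by simpa [ht] using ih h.2⟩

/-- A path in the image of an injective relabelling comes from a path. -/
theorem isPath_of_map {g : E → E'} {k : V → V'} {p : V → Prop}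
    (hk : ∀ x y, p x → p y → k x = k y → x = y)
    (hs : ∀ e, s' (g e) = k (s e)) (ht : ∀ e, t' (g e) = k (t e)) {x : V} {a : List E}
    (hx : p x) (ha : ∀ e ∈ a, p (s e) ∧ p (t e)) (h : IsPath s' t' (k x) (a.map g)) :
    IsPath s t x a := by
  induction a generalizing x with
  | nil => trivial
  | cons e a ih =>
    have he := ha e (by simp)
    refine ⟨hk _ _ he.1 hx ?_, ih he.2 (fun e' he' => ha e' (by simp [he'])) ?_⟩
    · rw [← hs]; exact h.1
    · rw [← ht]; exact h.2

end Paths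

/-! ### One-dimensional cells -/

namespace Prepoly1.Cell1

variable {P : Prepoly1.{u}}

@[simp] theorem dom_comp (f g : P.Cell1) : (f ⬝₀ g).dom = f.dom := rfl
@[simp] theorem word_comp (f g : P.Cell1) : (f ⬝₀ g).word = f.word ++ g.word := rfl
@[simp] theorem dom_one (x : P.G0) : (one x : P.Cell1).dom = x := rfl
@[simp] theorem word_one (x : P.G0) : (one x : P.Cell1).word = [] := rfl

theorem isCell_one (x : P.G0) : (one x : P.Cell1).IsCell := trivial

theorem comp_assoc (f g h : P.Cell1) : f ⬝₀ g ⬝₀ h = f ⬝₀ (g ⬝₀ h) := by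
  ext1 <;> simp

@[simp] theorem comp_one (f : P.Cell1) (x : P.G0) : f ⬝₀ one x = f := by
  ext1 <;> simp

theorem one_comp {f : P.Cell1} {x : P.G0} (h : f.dom = x) : one x ⬝₀ f = f := by
  ext1 <;> simp [h]

theorem eq_one {f : P.Cell1} (h : f.word = []) : f = one f.cod := by
  ext1
  · simp [cod, h, pathEnd]
  · simp [h]

theorem cod_comp {f g : P.Cell1} (h : f.cod = g.dom) : (f ⬝₀ g).cod = g.cod := by
  unfold cod at *
  simp only [word_comp, dom_comp, pathEnd_append, h]

theorem isCell_comp {f g : P.Cell1} (h : f.cod = g.dom) :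
    (f ⬝₀ g).IsCell ↔ f.IsCell ∧ g.IsCell := by
  unfold cod at h
  unfold IsCell
  simp only [word_comp, dom_comp, isPath_append, h]

theorem IsCell.of_comp {f g : P.Cell1} (h : (f ⬝₀ g).IsCell) : f.IsCell :=
  ((isPath_append _ _ _).1 h).1

/-- A composite records the start of its first factor only, so the start of `g` is lost and has to
be supplied. This asymmetry between left and right recurs in all later cancellations. -/
theorem comp_left_cancel {f g g' : P.Cell1} (hd : g.dom = g'.dom) (h : f ⬝₀ g = f ⬝₀ g') :
    g = g' := by
  ext1
  · exact hd
  · simpa using congrArg word h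

theorem comp_right_cancel {f f' g : P.Cell1} (h : f ⬝₀ g = f' ⬝₀ g) : f = f' := by
  ext1
  · simpa using congrArg dom h
  · simpa using congrArg word h

end Prepoly1.Cell1

/-! ### Two-dimensional cells -/

namespace Prepoly2

open Prepoly1 (Cell1)
open Prepoly1.Cell1

variable {P : Prepoly2.{u}}

namespace Whisker

@[simp] theorem lwhisk_left (f : P.Cell1) (w : P.Whisker) : (w.lwhisk f).left = f ⬝₀ w.left := rfl
@[simp] theorem lwhisk_gen (f : P.Cell1) (w : P.Whisker) : (w.lwhisk f).gen = w.gen := rfl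
@[simp] theorem lwhisk_right (f : P.Cell1) (w : P.Whisker) : (w.lwhisk f).right = w.right := rfl
@[simp] theorem rwhisk_left (f : P.Cell1) (w : P.Whisker) : (w.rwhisk f).left = w.left := rfl
@[simp] theorem rwhisk_gen (f : P.Cell1) (w : P.Whisker) : (w.rwhisk f).gen = w.gen := rfl
@[simp] theorem rwhisk_right (f : P.Cell1) (w : P.Whisker) :
    (w.rwhisk f).right = w.right ⬝₀ f := rfl

theorem src_lwhisk (f : P.Cell1) (w : P.Whisker) : (w.lwhisk f).src = f ⬝₀ w.src := by
  simp [src, comp_assoc]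
theorem tgt_lwhisk (f : P.Cell1) (w : P.Whisker) : (w.lwhisk f).tgt = f ⬝₀ w.tgt := by
  simp [tgt, comp_assoc]
theorem src_rwhisk (f : P.Cell1) (w : P.Whisker) : (w.rwhisk f).src = w.src ⬝₀ f := by
  simp [src, comp_assoc]
theorem tgt_rwhisk (f : P.Cell1) (w : P.Whisker) : (w.rwhisk f).tgt = w.tgt ⬝₀ f := by
  simp [tgt, comp_assoc]

variable {w : P.Whisker}

theorem IsCell.cod_left_comp (h : w.IsCell) :
    (w.left ⬝₀ P.src1 w.gen).cod = w.right.dom := by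
  rw [cod_comp h.2.2.1, h.2.2.2]

theorem IsCell.cod_left_comp_tgt (h : w.IsCell) :
    (w.left ⬝₀ P.tgt1 w.gen).cod = w.right.dom := by
  rw [cod_comp (by rw [h.2.2.1, P.dom_tgt1]), P.cod_tgt1, h.2.2.2]

theorem IsCell.cod_src (h : w.IsCell) : w.src.cod = w.right.cod :=
  cod_comp h.cod_left_comp

theorem IsCell.cod_tgt (h : w.IsCell) : w.tgt.cod = w.right.cod :=
  cod_comp h.cod_left_comp_tgt

theorem IsCell.isCell_src (h : w.IsCell) : w.src.IsCell :=
  (isCell_comp h.cod_left_comp).2 ⟨(isCell_comp h.2.2.1).2 ⟨h.1, P.isCell_src1 _⟩, h.2.1⟩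

theorem IsCell.isCell_tgt (h : w.IsCell) : w.tgt.IsCell :=
  (isCell_comp h.cod_left_comp_tgt).2
    ⟨(isCell_comp (by rw [h.2.2.1, P.dom_tgt1])).2 ⟨h.1, P.isCell_tgt1 _⟩, h.2.1⟩

theorem IsCell.lwhisk (h : w.IsCell) {f : P.Cell1} (hf : f.IsCell) (hc : f.cod = w.left.dom) :
    (w.lwhisk f).IsCell :=
  ⟨(isCell_comp hc).2 ⟨hf, h.1⟩, h.2.1, by simp [cod_comp hc, h.2.2.1], h.2.2.2⟩

theorem IsCell.rwhisk (h : w.IsCell) {f : P.Cell1} (hf : f.IsCell) (hc : w.right.cod = f.dom) :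
    (w.rwhisk f).IsCell :=
  ⟨h.1, (isCell_comp hc).2 ⟨h.2.1, hf⟩, h.2.2.1, h.2.2.2⟩

theorem IsCell.of_lwhisk {f : P.Cell1} (h : (w.lwhisk f).IsCell) (hc : f.cod = w.left.dom) :
    w.IsCell :=
  ⟨((isCell_comp hc).1 h.1).2, h.2.1, by rw [← cod_comp hc]; exact h.2.2.1, h.2.2.2⟩

theorem IsCell.of_rwhisk {f : P.Cell1} (h : (w.rwhisk f).IsCell) : w.IsCell :=
  ⟨h.1, h.2.1.of_comp, h.2.2.1, h.2.2.2⟩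

end Whisker

namespace Cell2

@[simp] theorem dom_one (f : P.Cell1) : (one f).dom = f := rfl
@[simp] theorem steps_one (f : P.Cell1) : (one f).steps = [] := rfl

@[simp] theorem dom_comp (φ ψ : P.Cell2) : (φ ⬝₁ ψ).dom = φ.dom := rfl
@[simp] theorem steps_comp (φ ψ : P.Cell2) : (φ ⬝₁ ψ).steps = φ.steps ++ ψ.steps := rfl
@[simp] theorem dom_lwhisk (f : P.Cell1) (φ : P.Cell2) : (f ◁₂ φ).dom = f ⬝₀ φ.dom := rfl
@[simp] theorem dom_rwhisk (f : P.Cell1) (φ : P.Cell2) : (φ ▷₂ f).dom = φ.dom ⬝₀ f := rfl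
@[simp] theorem steps_lwhisk (f : P.Cell1) (φ : P.Cell2) :
    (f ◁₂ φ).steps = φ.steps.map (Whisker.lwhisk f) := rfl
@[simp] theorem steps_rwhisk (f : P.Cell1) (φ : P.Cell2) :
    (φ ▷₂ f).steps = φ.steps.map (fun w => Whisker.rwhisk w f) := rfl

theorem isCell_one {f : P.Cell1} (h : f.IsCell) : (one f).IsCell :=
  ⟨h, by simp, trivial⟩

theorem cod_comp {φ ψ : P.Cell2} (h : φ.cod = ψ.dom) : (φ ⬝₁ ψ).cod = ψ.cod := by
  unfold cod at *
  simp only [steps_comp, dom_comp, pathEnd_append, h]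

theorem isCell_comp {φ ψ : P.Cell2} (h : φ.cod = ψ.dom) :
    (φ ⬝₁ ψ).IsCell ↔ φ.IsCell ∧ (∀ w ∈ ψ.steps, w.IsCell) ∧
      IsPath Whisker.src Whisker.tgt ψ.dom ψ.steps := by
  unfold cod at h
  unfold IsCell
  simp only [steps_comp, dom_comp, isPath_append, h, List.mem_append, or_imp, forall_and]
  tauto

theorem IsCell.comp {φ ψ : P.Cell2} (h : φ.IsCell) (h' : ψ.IsCell) (hc : φ.cod = ψ.dom) :
    (φ ⬝₁ ψ).IsCell := (isCell_comp hc).2 ⟨h, h'.2⟩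

theorem cod_lwhisk (f : P.Cell1) (φ : P.Cell2) : (f ◁₂ φ).cod = f ⬝₀ φ.cod :=
  pathEnd_map (k := fun x => f ⬝₀ x) (Whisker.tgt_lwhisk f) _ _

theorem cod_rwhisk (f : P.Cell1) (φ : P.Cell2) : (φ ▷₂ f).cod = φ.cod ⬝₀ f :=
  pathEnd_map (k := fun x => x ⬝₀ f) (Whisker.tgt_rwhisk f) _ _

/-- All boundaries of a path of whiskers that starts at `x` are parallel to `x`. -/
theorem parallel_of_isPath {x : P.Cell1} {l : List P.Whisker} (hw : ∀ w ∈ l, w.IsCell)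
    (h : IsPath Whisker.src Whisker.tgt x l) :
    (pathEnd Whisker.tgt x l).dom = x.dom ∧ (pathEnd Whisker.tgt x l).cod = x.cod ∧
      ∀ w ∈ l, w.left.dom = x.dom ∧ w.right.cod = x.cod := by
  induction l generalizing x with
  | nil => simp [pathEnd]
  | cons w l ih =>
    obtain ⟨rfl, h⟩ := h
    have hwc := hw w (by simp)
    obtain ⟨h1, h2, h3⟩ := ih (fun w' hw' => hw w' (by simp [hw'])) h
    rw [hwc.cod_tgt] at h2 h3
    refine ⟨h1, by rw [hwc.cod_src]; exact h2, ?_⟩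
    intro w' hw'
    rcases List.mem_cons.1 hw' with rfl | hw'
    · exact ⟨rfl, hwc.cod_src.symm⟩
    · rw [hwc.cod_src]; exact h3 w' hw'

variable {φ : P.Cell2}

theorem IsCell.dom_cod (h : φ.IsCell) : φ.cod.dom = φ.dom.dom :=
  (parallel_of_isPath h.2.1 h.2.2).1

theorem IsCell.cod_cod (h : φ.IsCell) : φ.cod.cod = φ.dom.cod :=
  (parallel_of_isPath h.2.1 h.2.2).2.1

theorem IsCell.dom_left (h : φ.IsCell) {w : P.Whisker} (hw : w ∈ φ.steps) :
    w.left.dom = φ.dom.dom := ((parallel_of_isPath h.2.1 h.2.2).2.2 w hw).1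

theorem IsCell.cod_right (h : φ.IsCell) {w : P.Whisker} (hw : w ∈ φ.steps) :
    w.right.cod = φ.dom.cod := ((parallel_of_isPath h.2.1 h.2.2).2.2 w hw).2

theorem isCell_pathEnd {x : P.Cell1} {l : List P.Whisker} (hx : x.IsCell)
    (hw : ∀ w ∈ l, w.IsCell) : (pathEnd Whisker.tgt x l).IsCell := by
  induction l generalizing x with
  | nil => exact hx
  | cons w l ih =>
    exact ih (hw w (by simp)).isCell_tgt (fun w' hw' => hw w' (by simp [hw']))

theorem IsCell.isCell_cod (h : φ.IsCell) : φ.cod.IsCell := isCell_pathEnd h.1 h.2.1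

theorem IsCell.lwhisk (h : φ.IsCell) {f : P.Cell1} (hf : f.IsCell) (hc : f.cod = φ.dom.dom) :
    (f ◁₂ φ).IsCell := by
  refine ⟨(Prepoly1.Cell1.isCell_comp hc).2 ⟨hf, h.1⟩, ?_, ?_⟩
  · simp only [steps_lwhisk, List.mem_map, forall_exists_index, and_imp]
    rintro _ w hw rfl
    exact (h.2.1 w hw).lwhisk hf (by rw [hc, h.dom_left hw])
  · exact isPath_map (k := fun x => f ⬝₀ x) (Whisker.src_lwhisk f) (Whisker.tgt_lwhisk f) h.2.2

theorem IsCell.rwhisk (h : φ.IsCell) {f : P.Cell1} (hf : f.IsCell) (hc : φ.dom.cod = f.dom) :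
    (φ ▷₂ f).IsCell := by
  refine ⟨(Prepoly1.Cell1.isCell_comp hc).2 ⟨h.1, hf⟩, ?_, ?_⟩
  · simp only [steps_rwhisk, List.mem_map, forall_exists_index, and_imp]
    rintro _ w hw rfl
    exact (h.2.1 w hw).rwhisk hf (by rw [← hc, h.cod_right hw])
  · exact isPath_map (k := fun x => x ⬝₀ f) (Whisker.src_rwhisk f) (Whisker.tgt_rwhisk f) h.2.2

/-- Whiskering on the left is injective only among cells that start at `f.cod`; `hc` and `hw`
restore the starting vertices that `f ◁₂ φ` forgets. -/
theorem IsCell.of_lwhisk {f : P.Cell1} (h : (f ◁₂ φ).IsCell) (hc : f.cod = φ.dom.dom)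
    (hw : ∀ w ∈ φ.steps, f.cod = w.left.dom) : φ.IsCell := by
  refine ⟨((Prepoly1.Cell1.isCell_comp hc).1 h.1).2, fun w hw' => ?_, ?_⟩
  · exact (h.2.1 (w.lwhisk f) (by simpa using ⟨w, hw', rfl⟩)).of_lwhisk (hw w hw')
  · refine isPath_of_map (k := fun x => f ⬝₀ x) (p := fun x => x.dom = f.cod) ?_
      (Whisker.src_lwhisk f) (Whisker.tgt_lwhisk f) hc.symm (fun w hw' => ?_) h.2.2
    · exact fun x y hx hy hxy => comp_left_cancel (hx.trans hy.symm) hxy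
    · exact ⟨(hw w hw').symm, (hw w hw').symm⟩

theorem IsCell.of_rwhisk {f : P.Cell1} (h : (φ ▷₂ f).IsCell) : φ.IsCell := by
  refine ⟨h.1.of_comp, fun w hw' => ?_, ?_⟩
  · exact (h.2.1 (w.rwhisk f) (by simpa using ⟨w, hw', rfl⟩)).of_rwhisk
  · exact isPath_of_map (k := fun x => x ⬝₀ f) (p := fun _ => True)
      (fun x y _ _ hxy => comp_right_cancel hxy)
      (Whisker.src_rwhisk f) (Whisker.tgt_rwhisk f) trivial (fun _ _ => ⟨trivial, trivial⟩) h.2.2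

theorem IsCell.one_lwhisk (h : φ.IsCell) {x : P.G0} (hx : φ.dom.dom = x) :
    Cell1.one x ◁₂ φ = φ := by
  ext1
  · exact one_comp hx
  · conv_rhs => rw [← List.map_id φ.steps]
    refine List.map_congr_left fun w hw => ?_
    ext1
    · exact one_comp ((h.dom_left hw).trans hx)
    · rfl
    · rfl

theorem rwhisk_one (φ : P.Cell2) (x : P.G0) : φ ▷₂ Cell1.one x = φ := by
  ext1
  · simp
  · conv_rhs => rw [← List.map_id φ.steps]
    refine List.map_congr_left fun w _ => ?_
    ext1
    · rfl
    · rfl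
    · simp

theorem one_comp {f : P.Cell1} (h : φ.dom = f) : one f ⬝₁ φ = φ := by
  ext1 <;> simp [h]

theorem comp_one (φ : P.Cell2) (f : P.Cell1) : φ ⬝₁ one f = φ := by
  ext1 <;> simp

end Cell2

end Prepoly2

end GrayRewriting

namespace GrayRewriting

/-! ### Cancelling a whiskering by a `1`-generator -/

namespace Prepoly1.Cell1

variable {P : Prepoly1.{u}}

/-- A `1`-generator as a `1`-cell. -/
def ofEdge (a : P.G1) : P.Cell1 := ⟨P.src0 a, [a]⟩

theorem isCell_ofEdge (a : P.G1) : (ofEdge a).IsCell := ⟨rfl, trivial⟩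

def StartsWith (a : P.G1) (f : P.Cell1) : Prop := ∃ t, f.word = a :: t

def EndsWith (a : P.G1) (f : P.Cell1) : Prop := ∃ t, f.word = t ++ [a]

theorem StartsWith.comp {a : P.G1} {f : P.Cell1} (h : StartsWith a f) (g : P.Cell1) :
    StartsWith a (f ⬝₀ g) := by
  obtain ⟨t, h⟩ := h
  exact ⟨t ++ g.word, by simp [h]⟩

theorem EndsWith.comp {a : P.G1} {f : P.Cell1} (h : EndsWith a f) (g : P.Cell1) :
    EndsWith a (g ⬝₀ f) := by
  obtain ⟨t, h⟩ := h
  exact ⟨g.word ++ t, by simp [h]⟩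

theorem StartsWith.exists_eq {a : P.G1} {f : P.Cell1} (h : StartsWith a f) (hf : f.IsCell) :
    ∃ f' : P.Cell1, f = ofEdge a ⬝₀ f' ∧ f'.dom = P.tgt0 a := by
  obtain ⟨t, h⟩ := h
  refine ⟨⟨P.tgt0 a, t⟩, ?_, rfl⟩
  unfold IsCell at hf
  rw [h] at hf
  ext1
  · exact hf.1.symm
  · exact h

theorem EndsWith.exists_eq {a : P.G1} {f : P.Cell1} (h : EndsWith a f) (hf : f.IsCell) :
    ∃ f' : P.Cell1, f = f' ⬝₀ ofEdge a ∧ f'.cod = P.src0 a := by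
  obtain ⟨t, h⟩ := h
  refine ⟨⟨f.dom, t⟩, ?_, ?_⟩
  · ext1
    · rfl
    · exact h
  · unfold IsCell at hf
    rw [h, isPath_append] at hf
    exact hf.2.1.symm

end Prepoly1.Cell1

namespace Prepoly2.Cell2

open Prepoly1 (Cell1)
open Prepoly1.Cell1

variable {P : Prepoly2.{u}} {φ ψ : P.Cell2}

/-- All left contexts of a `2`-cell start at the same vertex, so `hd` supplies the starts that
cancellation needs, whisker by whisker. -/
theorem lwhisk_cancel {f : P.Cell1} (hφ : φ.IsCell) (hψ : ψ.IsCell)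
    (hd : φ.dom.dom = ψ.dom.dom) (h : f ◁₂ φ = f ◁₂ ψ) : φ = ψ := by
  ext1
  · exact comp_left_cancel hd (congrArg dom h)
  · have h' := congrArg steps h
    simp only [steps_lwhisk] at h'
    refine List.ext_getElem? fun i => ?_
    have hi := congrArg (fun l => l[i]?) h'
    simp only [List.getElem?_map] at hi
    rcases hx : φ.steps[i]? with _ | x <;> rcases hy : ψ.steps[i]? with _ | y
    · rfl
    · simp [hx, hy] at hi
    · simp [hx, hy] at hi
    · simp only [hx, hy, Option.map_some, Option.some.injEq] at hi ⊢
      have e1 := congrArg Whisker.left hi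
      have e2 := congrArg Whisker.gen hi
      have e3 := congrArg Whisker.right hi
      simp only [Whisker.lwhisk_left, Whisker.lwhisk_gen, Whisker.lwhisk_right] at e1 e2 e3
      ext1
      · refine comp_left_cancel ?_ e1
        rw [hφ.dom_left (List.mem_of_getElem? hx), hψ.dom_left (List.mem_of_getElem? hy), hd]
      · exact e2
      · exact e3

theorem rwhisk_cancel {f : P.Cell1} (h : φ ▷₂ f = ψ ▷₂ f) : φ = ψ := by
  ext1
  · exact comp_right_cancel (congrArg dom h)
  · have h' := congrArg steps h
    simp only [steps_rwhisk] at h'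
    refine List.map_injective_iff.2 (fun x y hxy => ?_) h'
    ext1
    · have e := congrArg Whisker.left hxy
      exact e
    · have e := congrArg Whisker.gen hxy
      exact e
    · exact comp_right_cancel (congrArg Whisker.right hxy)

/-- If `φ` has whiskers, its domain is the source of the first one; otherwise domain and codomain
coincide. The second case serves the empty `lam` and `rho` of a step, whose boundary is known only
through the generator. -/
theorem IsCell.startsWith_dom (h : φ.IsCell) {a : P.G1}
    (hw : ∀ w ∈ φ.steps, StartsWith a w.left) (hc : StartsWith a φ.cod) :
    StartsWith a φ.dom := by
  obtain ⟨d, l⟩ := φ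
  cases l with
  | nil => exact hc
  | cons w l =>
    obtain rfl : w.src = d := h.2.2.1
    exact ((hw w (by simp)).comp _).comp _

theorem IsCell.endsWith_dom (h : φ.IsCell) {a : P.G1}
    (hw : ∀ w ∈ φ.steps, EndsWith a w.right) (hc : EndsWith a φ.cod) :
    EndsWith a φ.dom := by
  obtain ⟨d, l⟩ := φ
  cases l with
  | nil => exact hc
  | cons w l =>
    obtain rfl : w.src = d := h.2.2.1
    exact (hw w (by simp)).comp _

/-- The letter `a` is removed from the domain and from every whisker, and each remainder is made to
start at `P.tgt0 a`; this is what lets the cell conditions descend. -/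
theorem IsCell.exists_lwhisk (h : φ.IsCell) {a : P.G1}
    (hw : ∀ w ∈ φ.steps, StartsWith a w.left) (hd : StartsWith a φ.dom) :
    ∃ φ' : P.Cell2, φ'.IsCell ∧ φ = ofEdge a ◁₂ φ' ∧ φ'.dom.dom = P.tgt0 a := by
  obtain ⟨d', hd1, hd2⟩ := hd.exists_eq h.1
  have H : ∃ l : List P.Whisker, φ.steps = l.map (Whisker.lwhisk (ofEdge a)) ∧
      ∀ w ∈ l, w.left.dom = P.tgt0 a := by
    have hwc := h.2.1
    generalize φ.steps = s at hw hwc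
    induction s with
    | nil => exact ⟨[], rfl, by simp⟩
    | cons w s ih =>
      obtain ⟨l, e, hl⟩ := ih (fun w hw' => hw w (by simp [hw'])) (fun w hw' => hwc w (by simp [hw']))
      obtain ⟨f', hf1, hf2⟩ := (hw w (by simp)).exists_eq (hwc w (by simp)).1
      refine ⟨⟨f', w.gen, w.right⟩ :: l, ?_, ?_⟩
      · rw [List.map_cons, ← e]
        congr 1
        ext1
        · exact hf1
        · rfl
        · rfl
      · intro w' hw'
        rcases List.mem_cons.1 hw' with rfl | hw'
        · exact hf2
        · exact hl _ hw'
  obtain ⟨l, hl, hl'⟩ := H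
  have e : φ = ofEdge a ◁₂ (⟨d', l⟩ : P.Cell2) := by
    ext1
    · exact hd1
    · exact hl
  refine ⟨⟨d', l⟩, ?_, e, hd2⟩
  rw [e] at h
  exact h.of_lwhisk hd2.symm (fun w hw => (hl' w hw).symm)

theorem IsCell.exists_rwhisk (h : φ.IsCell) {a : P.G1}
    (hw : ∀ w ∈ φ.steps, EndsWith a w.right) (hd : EndsWith a φ.dom) :
    ∃ φ' : P.Cell2, φ'.IsCell ∧ φ = φ' ▷₂ ofEdge a ∧ φ'.dom.cod = P.src0 a := by
  obtain ⟨d', hd1, hd2⟩ := hd.exists_eq h.1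
  have H : ∃ l : List P.Whisker, φ.steps = l.map (fun w => Whisker.rwhisk w (ofEdge a)) := by
    have hwc := h.2.1
    generalize φ.steps = s at hw hwc
    induction s with
    | nil => exact ⟨[], rfl⟩
    | cons w s ih =>
      obtain ⟨l, e⟩ := ih (fun w hw' => hw w (by simp [hw'])) (fun w hw' => hwc w (by simp [hw']))
      obtain ⟨f', hf1, hf2⟩ := (hw w (by simp)).exists_eq (hwc w (by simp)).2.1
      refine ⟨⟨w.left, w.gen, f'⟩ :: l, ?_⟩
      rw [List.map_cons, ← e]
      congr 1
      ext1
      · rfl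
      · rfl
      · exact hf1
  obtain ⟨l, hl⟩ := H
  have e : φ = (⟨d', l⟩ : P.Cell2) ▷₂ ofEdge a := by
    ext1
    · exact hd1
    · exact hl
  refine ⟨⟨d', l⟩, ?_, e, hd2⟩
  rw [e] at h
  exact h.of_rwhisk

end Prepoly2.Cell2

/-! ### Rewriting steps -/

namespace Prepoly3

open Prepoly1 (Cell1)
open Prepoly2 (Cell2 Whisker)
open Prepoly1.Cell1

variable {P : Prepoly3.{u}}

namespace Step

/-- The whiskered source of the `3`-generator of a step. -/
def core (S : P.Step) : P.Cell2 := S.left ◁₂ P.src2 S.gen ▷₂ S.right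

theorem dom_core (S : P.Step) : S.core.dom = S.left ⬝₀ (P.src2 S.gen).dom ⬝₀ S.right := rfl

theorem steps_core (S : P.Step) : S.core.steps =
    (P.src2 S.gen).steps.map (fun w => (w.lwhisk S.left).rwhisk S.right) := by
  simp [core, Function.comp_def]

theorem length_steps_core (S : P.Step) : S.core.steps.length = (P.src2 S.gen).length := by
  simp [steps_core, Cell2.length]

theorem cod_core (S : P.Step) : S.core.cod = S.left ⬝₀ (P.src2 S.gen).cod ⬝₀ S.right := by
  simp [core, Cell2.cod_lwhisk, Cell2.cod_rwhisk]

theorem src_eq (S : P.Step) : S.src = S.lam ⬝₁ S.core ⬝₁ S.rho := rfl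

@[simp] theorem dom_src (S : P.Step) : S.src.dom = S.lam.dom := rfl

variable {S : P.Step}

theorem IsCell.cod_lam (h : S.IsCell) : S.lam.cod = S.core.dom := h.2.2.2.2.2.2.1

theorem IsCell.dom_rho (h : S.IsCell) : S.core.cod = S.rho.dom := by
  rw [cod_core]; exact h.2.2.2.2.2.2.2

theorem IsCell.cod_left (h : S.IsCell) : S.left.cod = (P.src2 S.gen).dom.dom := h.2.2.2.2.1

theorem IsCell.dom_right (h : S.IsCell) : (P.src2 S.gen).dom.cod = S.right.dom := h.2.2.2.2.2.1

theorem isCell_core (hl : S.left.IsCell) (hr : S.right.IsCell)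
    (h : S.left.cod = (P.src2 S.gen).dom.dom) (h' : (P.src2 S.gen).dom.cod = S.right.dom) :
    S.core.IsCell := by
  refine ((P.isCell_src2 _).lwhisk hl h).rwhisk hr ?_
  rw [Cell2.dom_lwhisk, cod_comp h, h']

theorem IsCell.isCell_core (h : S.IsCell) : S.core.IsCell :=
  Step.isCell_core h.2.1 h.2.2.1 h.cod_left h.dom_right

theorem IsCell.cod_src (h : S.IsCell) : S.src.cod = S.rho.cod := by
  rw [src_eq, Cell2.cod_comp]
  rw [Cell2.cod_comp h.cod_lam, h.dom_rho]

theorem IsCell.isCell_src (h : S.IsCell) : S.src.IsCell := by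
  refine (h.1.comp h.isCell_core h.cod_lam).comp h.2.2.2.1 ?_
  rw [Cell2.cod_comp h.cod_lam, h.dom_rho]

theorem IsCell.dom_dom_rho (h : S.IsCell) : S.rho.dom.dom = S.lam.dom.dom := by
  rw [← h.dom_rho, h.isCell_core.dom_cod, ← h.cod_lam, h.1.dom_cod]

theorem IsCell.dom_left (h : S.IsCell) : S.left.dom = S.lam.dom.dom := by
  rw [← h.1.dom_cod, h.cod_lam]; rfl

theorem IsCell.one_lwhisk (h : S.IsCell) {x : P.G0} (hx : S.lam.dom.dom = x) :
    Cell1.one x ◁₃ S = S := by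
  ext1
  · exact h.1.one_lwhisk hx
  · exact one_comp (h.dom_left.trans hx)
  · rfl
  · rfl
  · exact h.2.2.2.1.one_lwhisk (h.dom_dom_rho.trans hx)

theorem rwhisk_one (S : P.Step) (x : P.G0) : S ▷₃ Cell1.one x = S := by
  ext1
  · exact Cell2.rwhisk_one _ _
  · rfl
  · rfl
  · exact comp_one _ _
  · exact Cell2.rwhisk_one _ _

theorem whisk_ofGen {A : P.G3} {l r : P.Cell1} (hr : (P.src2 A).dom.cod = r.dom) :
    l ◁₃ ofGen A ▷₃ r = ⟨Cell2.one (l ⬝₀ (P.src2 A).dom ⬝₀ r), l, A, r,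
      Cell2.one (l ⬝₀ (P.src2 A).cod ⬝₀ r)⟩ := by
  ext1
  · rfl
  · exact comp_one _ _
  · rfl
  · exact one_comp hr.symm
  · rfl

theorem rwhisk_ofGen {A : P.G3} {r : P.Cell1} (hr : (P.src2 A).dom.cod = r.dom) :
    ofGen A ▷₃ r = ⟨Cell2.one ((P.src2 A).dom ⬝₀ r), Cell1.one (P.src2 A).dom.dom, A, r,
      Cell2.one ((P.src2 A).cod ⬝₀ r)⟩ := by
  ext1
  · rfl
  · rfl
  · rfl
  · exact one_comp hr.symm
  · rfl

theorem lwhisk_ofGen {A : P.G3} {l : P.Cell1} :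
    l ◁₃ ofGen A = ⟨Cell2.one (l ⬝₀ (P.src2 A).dom), l, A, Cell1.one (P.src2 A).dom.cod,
      Cell2.one (l ⬝₀ (P.src2 A).cod)⟩ := by
  ext1
  · rfl
  · exact comp_one _ _
  · rfl
  · rfl
  · rfl

theorem src_lwhisk (f : P.Cell1) (S : P.Step) : (f ◁₃ S).src = f ◁₂ S.src := by
  ext1
  · rfl
  · simp [src, lwhisk, Function.comp_def, Whisker.lwhisk, Whisker.rwhisk, comp_assoc]

theorem src_rwhisk (f : P.Cell1) (S : P.Step) : (S ▷₃ f).src = S.src ▷₂ f := by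
  ext1
  · rfl
  · simp [src, rwhisk, Function.comp_def, Whisker.lwhisk, Whisker.rwhisk, comp_assoc]

/-- A step all of whose whiskers start with the `1`-generator `a` is whiskered by `a`. -/
theorem IsCell.exists_lwhisk (h : S.IsCell) {a : P.G1} (hl : StartsWith a S.left)
    (hlam : ∀ w ∈ S.lam.steps, StartsWith a w.left)
    (hrho : ∀ w ∈ S.rho.steps, StartsWith a w.left) :
    ∃ S' : P.Step, S'.IsCell ∧ S = ofEdge a ◁₃ S' ∧ S'.src.dom.dom = P.tgt0 a := by
  obtain ⟨lam, left, A, right, rho⟩ := S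
  have hl' := hl
  obtain ⟨lam', c1, rfl, d1⟩ := h.1.exists_lwhisk hlam (h.1.startsWith_dom hlam (by
    rw [h.cod_lam]; exact (hl.comp _).comp _))
  obtain ⟨rho', c2, rfl, d2⟩ := h.2.2.2.1.exists_lwhisk hrho (by
    rw [← h.dom_rho, cod_core]; exact (hl.comp _).comp _)
  obtain ⟨left', rfl, d3⟩ := hl'.exists_eq h.2.1
  have d3' : (ofEdge a).cod = left'.dom := d3.symm
  refine ⟨⟨lam', left', A, right, rho'⟩,
    ⟨c1, ((isCell_comp d3').1 h.2.1).2, h.2.2.1, c2, ?_, h.dom_right, ?_, ?_⟩, rfl, d1⟩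
  · rw [← cod_comp d3']; exact h.cod_left
  · refine comp_left_cancel (f := ofEdge a) ?_ ?_
    · rw [c1.dom_cod, d1]; exact d3.symm
    · have := h.cod_lam
      simpa only [Cell2.cod_lwhisk, dom_core, comp_assoc] using this
  · refine comp_left_cancel (f := ofEdge a) ?_ ?_
    · rw [d2]; exact d3
    · have := h.dom_rho
      simpa only [cod_core, Cell2.dom_lwhisk, comp_assoc] using this

/-- A step all of whose whiskers end with the `1`-generator `a` is whiskered by `a`. -/
theorem IsCell.exists_rwhisk (h : S.IsCell) {a : P.G1} (hr : EndsWith a S.right)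
    (hlam : ∀ w ∈ S.lam.steps, EndsWith a w.right)
    (hrho : ∀ w ∈ S.rho.steps, EndsWith a w.right) :
    ∃ S' : P.Step, S'.IsCell ∧ S = S' ▷₃ ofEdge a ∧ S'.src.dom.cod = P.src0 a := by
  obtain ⟨lam, left, A, right, rho⟩ := S
  have hr' := hr
  obtain ⟨lam', c1, rfl, d1⟩ := h.1.exists_rwhisk hlam (h.1.endsWith_dom hlam (by
    rw [h.cod_lam]; exact hr.comp _))
  obtain ⟨rho', c2, rfl, d2⟩ := h.2.2.2.1.exists_rwhisk hrho (by
    rw [← h.dom_rho, cod_core]; exact hr.comp _)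
  obtain ⟨right', rfl, d3⟩ := hr'.exists_eq h.2.2.1
  refine ⟨⟨lam', left, A, right', rho'⟩,
    ⟨c1, h.2.1, h.2.2.1.of_comp, c2, h.cod_left, h.dom_right, ?_, ?_⟩, rfl, d1⟩
  · refine comp_right_cancel (g := ofEdge a) ?_
    have := h.cod_lam
    simpa only [Cell2.cod_rwhisk, dom_core, comp_assoc] using this
  · refine comp_right_cancel (g := ofEdge a) ?_
    have := h.dom_rho
    simpa only [cod_core, Cell2.dom_rwhisk, comp_assoc] using this

end Step

end Prepoly3

end GrayRewriting

namespace GrayRewriting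

/-! ### Tight local branchings -/

/-- Two overlapping factors that together cover a list contain all its members. -/
theorem mem_or_mem_of_cover {α : Type*} {a₁ c₁ b₁ a₂ c₂ b₂ : List α}
    (h : a₁ ++ c₁ ++ b₁ = a₂ ++ c₂ ++ b₂) (ha : a₁ = [] ∨ a₂ = []) (hb : b₁ = [] ∨ b₂ = [])
    (h₁ : a₁.length < a₂.length + c₂.length) (h₂ : a₂.length < a₁.length + c₁.length)
    {x : α} (hx : x ∈ a₁ ++ c₁ ++ b₁) : x ∈ c₁ ∨ x ∈ c₂ := by
  obtain ⟨i, hi⟩ := List.mem_iff_getElem?.1 hx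
  have hi' := hi
  rw [h] at hi'
  have hlen := congrArg List.length h
  simp only [List.length_append] at hlen
  have hlt : i < (a₁ ++ c₁ ++ b₁).length := (List.getElem?_eq_some_iff.1 hi).1
  simp only [List.length_append] at hlt
  have ha' : a₁.length = 0 ∨ a₂.length = 0 := by simpa using ha
  have hb' : b₁.length = 0 ∨ b₂.length = 0 := by simpa using hb
  by_cases hc : a₁.length ≤ i ∧ i < a₁.length + c₁.length
  · left
    rw [List.append_assoc, List.getElem?_append_right hc.1, List.getElem?_append_left (by omega)] at hi
    exact List.mem_of_getElem? hi
  · right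
    rw [List.append_assoc, List.getElem?_append_right (by omega),
      List.getElem?_append_left (by omega)] at hi'
    exact List.mem_of_getElem? hi'

/-- Both entries sit at the same position of the common list, counted from the start of either
factorization. -/
theorem eq_of_overlap {α : Type*} {a₁ c₁ b₁ a₂ c₂ b₂ : List α}
    (h : a₁ ++ c₁ ++ b₁ = a₂ ++ c₂ ++ b₂) {p q : ℕ} (hpq : a₁.length + p = a₂.length + q)
    {x y : α} (hx : c₁[p]? = some x) (hy : c₂[q]? = some y) : x = y := by
  have hp := (List.getElem?_eq_some_iff.1 hx).1
  have hq := (List.getElem?_eq_some_iff.1 hy).1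
  have h' := congrArg (fun l => l[a₁.length + p]?) h
  simp only [List.append_assoc] at h'
  rw [List.getElem?_append_right (by omega), List.getElem?_append_left (by omega),
    List.getElem?_append_right (by omega), List.getElem?_append_left (by omega),
    Nat.add_sub_cancel_left, hpq, Nat.add_sub_cancel_left, hx, hy] at h'
  exact Option.some.inj h'

namespace Prepoly3

open Prepoly1 (Cell1)
open Prepoly2 (Cell2 Whisker)
open Prepoly1.Cell1

variable {P : Prepoly3.{u}} {S₁ S₂ : P.Step}

/-- Local branchings whose two generators overlap and that have no common context. -/
structure IsTight (S₁ S₂ : P.Step) : Prop where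
  branching : P.IsLocalBranching S₁ S₂
  lam : S₁.lam.steps = [] ∨ S₂.lam.steps = []
  rho : S₁.rho.steps = [] ∨ S₂.rho.steps = []
  left : S₁.left.word = [] ∨ S₂.left.word = []
  right : S₁.right.word = [] ∨ S₂.right.word = []
  lt : S₁.lam.length < S₂.lam.length + (P.src2 S₂.gen).length
  lt' : S₂.lam.length < S₁.lam.length + (P.src2 S₁.gen).length

theorem IsLocalBranching.symm (h : P.IsLocalBranching S₁ S₂) : P.IsLocalBranching S₂ S₁ :=
  ⟨h.2.1, h.1, h.2.2.symm⟩

theorem IsTight.symm (h : IsTight S₁ S₂) : IsTight S₂ S₁ :=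
  ⟨h.branching.symm, h.lam.symm, h.rho.symm, h.left.symm, h.right.symm, h.lt', h.lt⟩

theorem IsLocalBranching.steps_eq (h : P.IsLocalBranching S₁ S₂) :
    S₁.lam.steps ++ S₁.core.steps ++ S₁.rho.steps =
      S₂.lam.steps ++ S₂.core.steps ++ S₂.rho.steps := congrArg Cell2.steps h.2.2

theorem IsLocalBranching.dom_lam (h : P.IsLocalBranching S₁ S₂) : S₁.lam.dom = S₂.lam.dom := by
  have e := congrArg Cell2.dom h.2.2
  exact e

/-- At a common position of the two generators, their whiskers agree in context. -/
theorem IsLocalBranching.whisker_eq (h : P.IsLocalBranching S₁ S₂) {p q : ℕ}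
    (hpq : S₁.lam.length + p = S₂.lam.length + q) {w v : P.Whisker}
    (hw : (P.src2 S₁.gen).steps[p]? = some w) (hv : (P.src2 S₂.gen).steps[q]? = some v) :
    S₁.left ⬝₀ w.left = S₂.left ⬝₀ v.left ∧ w.gen = v.gen ∧
      w.right ⬝₀ S₁.right = v.right ⬝₀ S₂.right := by
  have e := eq_of_overlap h.steps_eq hpq
    (x := (w.lwhisk S₁.left).rwhisk S₁.right) (y := (v.lwhisk S₂.left).rwhisk S₂.right)
    (by simp [Step.steps_core, hw]) (by simp [Step.steps_core, hv])
  have e₁ := congrArg Whisker.left e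
  have e₂ := congrArg Whisker.gen e
  have e₃ := congrArg Whisker.right e
  exact ⟨e₁, e₂, e₃⟩

theorem IsLocalBranching.exists_overlap (h : P.IsLocalBranching S₁ S₂)
    (hpos : ∀ A : P.G3, 0 < (P.src2 A).length)
    (hlt : S₁.lam.length < S₂.lam.length + (P.src2 S₂.gen).length)
    (hlt' : S₂.lam.length < S₁.lam.length + (P.src2 S₁.gen).length) :
    ∃ w ∈ (P.src2 S₁.gen).steps, ∃ v ∈ (P.src2 S₂.gen).steps,
      S₁.left ⬝₀ w.left = S₂.left ⬝₀ v.left ∧ w.gen = v.gen ∧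
      w.right ⬝₀ S₁.right = v.right ⬝₀ S₂.right := by
  have h₁ := hpos S₁.gen
  have h₂ := hpos S₂.gen
  -- Two overlapping intervals share the later of their two starting positions, whence the maximum.
  have hp : max S₁.lam.length S₂.lam.length - S₁.lam.length < (P.src2 S₁.gen).steps.length := by
    unfold Cell2.length at *; omega
  have hq : max S₁.lam.length S₂.lam.length - S₂.lam.length < (P.src2 S₂.gen).steps.length := by
    unfold Cell2.length at *; omega
  exact ⟨_, List.getElem_mem hp, _, List.getElem_mem hq,
    h.whisker_eq (by omega) (List.getElem?_eq_getElem hp) (List.getElem?_eq_getElem hq)⟩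

/-- Minimality for vertical contexts. -/
theorem IsMinimal.vertical (h : P.IsMinimal S₁ S₂) {S₁' S₂' : P.Step} {lam rho : P.Cell2}
    (hb : P.IsLocalBranching S₁' S₂') (hl : lam.IsCell) (hr : rho.IsCell)
    (hl' : lam.cod = S₁'.lam.dom) (hr' : S₁'.rho.cod = rho.dom)
    (h₁ : S₁ = lam ◂₃ S₁' ▸₃ rho) (h₂ : S₂ = lam ◂₃ S₂' ▸₃ rho) :
    lam.steps = [] ∧ rho.steps = [] := by
  have d := hb.dom_lam
  have H := h S₁' S₂' (Cell1.one S₁'.lam.dom.dom) (Cell1.one S₁'.lam.dom.cod) lam rho hb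
    trivial trivial hl hr rfl rfl ?_ ?_ ?_ ?_
  · exact H.2.2
  · rw [comp_one, one_comp (by rfl)]; exact hl'
  · rw [comp_one, one_comp, hb.1.cod_src]
    · exact hr'
    · rw [hb.1.isCell_src.dom_cod]; rfl
  · rw [Step.rwhisk_one, hb.1.one_lwhisk rfl]; exact h₁
  · rw [Step.rwhisk_one, hb.2.1.one_lwhisk (by rw [d])]; exact h₂

/-- If both are nonempty, each begins with the first whisker of the common source; this whisker is
then a vertical context of both steps. -/
theorem IsMinimal.lam_eq_nil (h : P.IsMinimal S₁ S₂) (hb : P.IsLocalBranching S₁ S₂) :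
    S₁.lam.steps = [] ∨ S₂.lam.steps = [] := by
  by_contra! hne
  obtain ⟨⟨⟨d₁, lam₁⟩, l₁, A₁, r₁, rho₁⟩, ⟨⟨d₂, lam₂⟩, l₂, A₂, r₂, rho₂⟩⟩ := S₁, S₂
  obtain ⟨w, lam₁, rfl⟩ := List.exists_cons_of_ne_nil hne.1
  obtain ⟨w', lam₂, rfl⟩ := List.exists_cons_of_ne_nil hne.2
  obtain rfl : d₁ = d₂ := hb.dom_lam
  have hs := hb.steps_eq
  simp only [List.cons_append, List.cons.injEq] at hs
  obtain ⟨rfl, hs⟩ := hs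
  have hd : w.src = d₁ := hb.1.1.2.2.1
  have key : ∀ {lam : List P.Whisker} {l A r rho},
      Step.IsCell (⟨⟨d₁, w :: lam⟩, l, A, r, rho⟩ : P.Step) →
      Step.IsCell (⟨⟨w.tgt, lam⟩, l, A, r, rho⟩ : P.Step) := by
    intro lam l A r rho h
    exact ⟨⟨(h.1.2.1 w (by simp)).isCell_tgt, fun v hv => h.1.2.1 v (by simp [hv]), h.1.2.2.2⟩,
      h.2.1, h.2.2.1, h.2.2.2.1, h.2.2.2.2.1, h.2.2.2.2.2.1, h.2.2.2.2.2.2.1, h.2.2.2.2.2.2.2⟩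
  have := (h.vertical (S₁' := ⟨⟨w.tgt, lam₁⟩, l₁, A₁, r₁, rho₁⟩)
    (S₂' := ⟨⟨w.tgt, lam₂⟩, l₂, A₂, r₂, rho₂⟩) (lam := ⟨d₁, [w]⟩) (rho := Cell2.one rho₁.cod)
    ⟨key hb.1, key hb.2.1, ?_⟩ ⟨hb.1.1.1, ?_, hd, trivial⟩
    (Cell2.isCell_one hb.1.2.2.2.1.isCell_cod) rfl rfl ?_ ?_).1
  · simp at this
  · ext1
    · rfl
    · exact hs
  · simpa using hb.1.1.2.1 w (by simp)
  · ext1 <;> first | rfl | exact (Cell2.comp_one _ _).symm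
  · ext1 <;> first | rfl | exact (Cell2.comp_one _ _).symm

/-- The same argument with the last whisker of the common source. -/
theorem IsMinimal.rho_eq_nil (h : P.IsMinimal S₁ S₂) (hb : P.IsLocalBranching S₁ S₂) :
    S₁.rho.steps = [] ∨ S₂.rho.steps = [] := by
  by_contra! hne
  obtain ⟨⟨lam₁, l₁, A₁, r₁, ⟨d₁, rho₁⟩⟩, ⟨lam₂, l₂, A₂, r₂, ⟨d₂, rho₂⟩⟩⟩ := S₁, S₂
  obtain ⟨rho₁, w, rfl⟩ := (List.eq_nil_or_concat' rho₁).resolve_left hne.1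
  obtain ⟨rho₂, w', rfl⟩ := (List.eq_nil_or_concat' rho₂).resolve_left hne.2
  have hs := hb.steps_eq
  simp only [← List.append_assoc] at hs
  obtain ⟨hs, hw⟩ := List.append_inj' hs rfl
  obtain rfl : w = w' := by simpa using hw
  have key : ∀ {rho : List P.Whisker} {lam l A r d},
      Step.IsCell (⟨lam, l, A, r, ⟨d, rho ++ [w]⟩⟩ : P.Step) →
      Step.IsCell (⟨lam, l, A, r, ⟨d, rho⟩⟩ : P.Step) ∧
        pathEnd Whisker.tgt d rho = w.src := by
    intro rho lam l A r d h
    have h' := h.2.2.2.1.2.2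
    rw [isPath_append] at h'
    exact ⟨⟨h.1, h.2.1, h.2.2.1,
      ⟨h.2.2.2.1.1, fun v hv => h.2.2.2.1.2.1 v (by simp [hv]), h'.1⟩,
      h.2.2.2.2.1, h.2.2.2.2.2.1, h.2.2.2.2.2.2.1, h.2.2.2.2.2.2.2⟩, h'.2.1.symm⟩
  have hwc : w.IsCell := hb.1.2.2.2.1.2.1 w (by simp)
  have := (h.vertical (S₁' := ⟨lam₁, l₁, A₁, r₁, ⟨d₁, rho₁⟩⟩)
    (S₂' := ⟨lam₂, l₂, A₂, r₂, ⟨d₂, rho₂⟩⟩) (lam := Cell2.one lam₁.dom) (rho := ⟨w.src, [w]⟩)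
    ⟨(key hb.1).1, (key hb.2.1).1, ?_⟩ (Cell2.isCell_one hb.1.1.1)
    ⟨hwc.isCell_src, by simpa using hwc, rfl, trivial⟩ rfl (key hb.1).2 ?_ ?_).2
  · simp at this
  · ext1
    · exact hb.dom_lam
    · exact hs
  · ext1 <;> first | rfl
  · ext1 <;> first | rfl | exact (Cell2.one_comp hb.dom_lam.symm).symm

/-- Minimality for horizontal contexts. -/
theorem IsMinimal.horizontal (h : P.IsMinimal S₁ S₂) {S₁' S₂' : P.Step} {l r : P.Cell1}
    (hb : P.IsLocalBranching S₁' S₂') (hl : l.IsCell) (hr : r.IsCell)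
    (hl' : l.cod = S₁'.src.dom.dom) (hr' : S₁'.src.dom.cod = r.dom)
    (h₁ : S₁ = l ◁₃ S₁' ▷₃ r) (h₂ : S₂ = l ◁₃ S₂' ▷₃ r) :
    l.word = [] ∧ r.word = [] := by
  have hc : (l ⬝₀ S₁'.src.dom ⬝₀ r).IsCell := by
    refine (isCell_comp ?_).2 ⟨(isCell_comp hl').2 ⟨hl, hb.1.isCell_src.1⟩, hr⟩
    rw [cod_comp hl', hr']
  have hl'' : l.cod = S₁'.src.cod.dom := by rw [hb.1.isCell_src.dom_cod, hl']
  have hc' : (l ⬝₀ S₁'.src.cod ⬝₀ r).IsCell := by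
    refine (isCell_comp ?_).2 ⟨(isCell_comp hl'').2 ⟨hl, hb.1.isCell_src.isCell_cod⟩, hr⟩
    rw [cod_comp hl'', hb.1.isCell_src.cod_cod, hr']
  have H := h S₁' S₂' l r (Cell2.one (l ⬝₀ S₁'.src.dom ⬝₀ r))
    (Cell2.one (l ⬝₀ S₁'.src.cod ⬝₀ r)) hb hl hr (Cell2.isCell_one hc) (Cell2.isCell_one hc')
    hl' hr' rfl rfl ?_ ?_
  · exact ⟨H.1, H.2.1⟩
  · rw [h₁]
    ext1 <;> first | rfl | exact (Cell2.comp_one _ _).symm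
  · rw [h₂, hb.2.2]
    ext1 <;> first | rfl | exact (Cell2.comp_one _ _).symm

/-- A whisker shared by the two generators begins with the first letter of either left context, so
these letters agree. The letter then begins every whisker of the source and can be split off both
steps. -/
theorem IsMinimal.left_eq_nil (h : P.IsMinimal S₁ S₂) (hb : P.IsLocalBranching S₁ S₂)
    (hpos : ∀ A : P.G3, 0 < (P.src2 A).length)
    (hlt : S₁.lam.length < S₂.lam.length + (P.src2 S₂.gen).length)
    (hlt' : S₂.lam.length < S₁.lam.length + (P.src2 S₁.gen).length) :
    S₁.left.word = [] ∨ S₂.left.word = [] := by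
  by_contra! hne
  obtain ⟨a, t₁, e₁⟩ := List.exists_cons_of_ne_nil hne.1
  obtain ⟨b, t₂, e₂⟩ := List.exists_cons_of_ne_nil hne.2
  obtain ⟨w, -, v, -, hwv, -⟩ := hb.exists_overlap hpos hlt hlt'
  have e := congrArg word hwv
  simp only [word_comp, e₁, e₂, List.cons_append, List.cons.injEq] at e
  obtain ⟨rfl, -⟩ := e
  have s₁ : StartsWith a S₁.left := ⟨_, e₁⟩
  have s₂ : StartsWith a S₂.left := ⟨_, e₂⟩
  -- As one `lam` and one `rho` are empty and the intervals overlap, each whisker of the source lies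
  -- in one of the two generators.
  have H : ∀ w ∈ S₁.lam.steps ++ S₁.core.steps ++ S₁.rho.steps, StartsWith a w.left := by
    intro w hw
    rcases mem_or_mem_of_cover hb.steps_eq (h.lam_eq_nil hb) (h.rho_eq_nil hb)
      (by rw [Step.length_steps_core]; exact hlt) (by rw [Step.length_steps_core]; exact hlt') hw
      with hw | hw
    · rw [Step.steps_core] at hw
      obtain ⟨w, -, rfl⟩ := List.mem_map.1 hw
      exact s₁.comp _
    · rw [Step.steps_core] at hw
      obtain ⟨w, -, rfl⟩ := List.mem_map.1 hw
      exact s₂.comp _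
  obtain ⟨S₁', c₁, f₁, d₁⟩ := hb.1.exists_lwhisk s₁ (fun w hw => H w (by simp [hw]))
    (fun w hw => H w (by simp [hw]))
  rw [hb.steps_eq] at H
  obtain ⟨S₂', c₂, f₂, d₂⟩ := hb.2.1.exists_lwhisk s₂ (fun w hw => H w (by simp [hw]))
    (fun w hw => H w (by simp [hw]))
  have hb' : P.IsLocalBranching S₁' S₂' := by
    refine ⟨c₁, c₂, Cell2.lwhisk_cancel (f := ofEdge a) c₁.isCell_src c₂.isCell_src
      (d₁.trans d₂.symm) ?_⟩
    rw [← Step.src_lwhisk, ← Step.src_lwhisk, ← f₁, ← f₂, hb.2.2]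
  have := (h.horizontal hb' (isCell_ofEdge a) (isCell_one S₁'.src.dom.cod) d₁.symm rfl
    (by rw [Step.rwhisk_one, f₁]) (by rw [Step.rwhisk_one, f₂])).1
  simp [ofEdge] at this

theorem IsMinimal.right_eq_nil (h : P.IsMinimal S₁ S₂) (hb : P.IsLocalBranching S₁ S₂)
    (hpos : ∀ A : P.G3, 0 < (P.src2 A).length)
    (hlt : S₁.lam.length < S₂.lam.length + (P.src2 S₂.gen).length)
    (hlt' : S₂.lam.length < S₁.lam.length + (P.src2 S₁.gen).length) :
    S₁.right.word = [] ∨ S₂.right.word = [] := by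
  by_contra! hne
  obtain ⟨t₁, a, e₁⟩ := (List.eq_nil_or_concat' _).resolve_left hne.1
  obtain ⟨t₂, b, e₂⟩ := (List.eq_nil_or_concat' _).resolve_left hne.2
  obtain ⟨w, -, v, -, -, -, hwv⟩ := hb.exists_overlap hpos hlt hlt'
  have e := congrArg word hwv
  simp only [word_comp, e₁, e₂, ← List.append_assoc] at e
  obtain rfl : a = b := by simpa using (List.append_inj' e rfl).2
  have s₁ : EndsWith a S₁.right := ⟨_, e₁⟩
  have s₂ : EndsWith a S₂.right := ⟨_, e₂⟩
  have H : ∀ w ∈ S₁.lam.steps ++ S₁.core.steps ++ S₁.rho.steps, EndsWith a w.right := by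
    intro w hw
    rcases mem_or_mem_of_cover hb.steps_eq (h.lam_eq_nil hb) (h.rho_eq_nil hb)
      (by rw [Step.length_steps_core]; exact hlt) (by rw [Step.length_steps_core]; exact hlt') hw
      with hw | hw
    · rw [Step.steps_core] at hw
      obtain ⟨w, -, rfl⟩ := List.mem_map.1 hw
      exact s₁.comp _
    · rw [Step.steps_core] at hw
      obtain ⟨w, -, rfl⟩ := List.mem_map.1 hw
      exact s₂.comp _
  obtain ⟨S₁', c₁, f₁, d₁⟩ := hb.1.exists_rwhisk s₁ (fun w hw => H w (by simp [hw]))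
    (fun w hw => H w (by simp [hw]))
  rw [hb.steps_eq] at H
  obtain ⟨S₂', c₂, f₂, d₂⟩ := hb.2.1.exists_rwhisk s₂ (fun w hw => H w (by simp [hw]))
    (fun w hw => H w (by simp [hw]))
  have hb' : P.IsLocalBranching S₁' S₂' := by
    refine ⟨c₁, c₂, Cell2.rwhisk_cancel (f := ofEdge a) ?_⟩
    rw [← Step.src_rwhisk, ← Step.src_rwhisk, ← f₁, ← f₂, hb.2.2]
  have e := hb'.dom_lam
  have := (h.horizontal hb' (isCell_one S₁'.src.dom.dom) (isCell_ofEdge a) rfl d₁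
    (by rw [Step.dom_src, c₁.one_lwhisk rfl, f₁])
    (by rw [Step.dom_src, c₂.one_lwhisk (by rw [e]), f₂])).2
  simp [ofEdge] at this

/-- The generator of `S₂` ends before that of `S₁` begins, and nothing lies outside the two; `χ` is
the segment between them. -/
theorem IsLocalBranching.isIndependent (hb : P.IsLocalBranching S₁ S₂)
    (hlam : S₂.lam.steps = []) (hrho : S₁.rho.steps = [])
    (hle : S₂.lam.length + (P.src2 S₂.gen).length ≤ S₁.lam.length) :
    P.IsIndependent S₂ S₁ := by
  have hs := hb.steps_eq
  rw [hlam, hrho, List.nil_append, List.append_nil] at hs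
  have hle' : S₂.core.steps.length ≤ S₁.lam.steps.length := by
    rw [Step.length_steps_core]; unfold Cell2.length at *; omega
  obtain ⟨χ, hχ, hχ'⟩ : ∃ χ, S₁.lam.steps = S₂.core.steps ++ χ ∧
      S₂.rho.steps = χ ++ S₁.core.steps := by
    rcases List.append_eq_append_iff.1 hs with ⟨t, h1, h2⟩ | ⟨t, h1, h2⟩
    · have : t = [] := by
        have := congrArg List.length h1
        simp only [List.length_append] at this
        exact List.eq_nil_of_length_eq_zero (by omega)
      subst this
      exact ⟨[], by simpa using h1.symm, by simpa using h2.symm⟩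
    · exact ⟨t, h1, h2⟩
  have hd : S₁.lam.dom = S₂.core.dom := by
    rw [hb.dom_lam, ← hb.2.1.cod_lam]
    simp [Cell2.cod, hlam, pathEnd]
  have hrc := hb.2.1.2.2.2.1
  have hcell : (⟨S₂.core.cod, χ⟩ : P.Cell2).IsCell := by
    refine ⟨hb.2.1.isCell_core.isCell_cod, fun w hw => hrc.2.1 w (by simp [hχ', hw]), ?_⟩
    have := hrc.2.2
    rw [hχ', isPath_append] at this
    rw [hb.2.1.dom_rho]
    exact this.1
  have hcod : (⟨S₂.core.cod, χ⟩ : P.Cell2).cod = S₁.core.dom := by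
    rw [← hb.1.cod_lam]
    unfold Cell2.cod
    rw [hχ, pathEnd_append, hd]
  refine ⟨S₂.gen, S₁.gen, S₂.left, S₂.right, S₁.left, S₁.right, ⟨S₂.core.cod, χ⟩,
    hb.2.1.2.1, hb.2.1.2.2.1, hb.1.2.1, hb.1.2.2.1, hcell, hb.2.1.cod_left, hb.2.1.dom_right,
    hb.1.cod_left, hb.1.dom_right, Step.cod_core _, hcod, ?_, ?_⟩
  · rw [Step.whisk_ofGen hb.2.1.dom_right]
    ext1
    · ext1
      · exact hb.dom_lam.symm.trans hd
      · exact hlam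
    · rfl
    · rfl
    · rfl
    · ext1
      · exact hb.2.1.dom_rho.symm.trans (Step.cod_core _)
      · exact hχ'
  · rw [Step.whisk_ofGen hb.1.dom_right]
    ext1
    · ext1
      · exact hd
      · exact hχ.trans (List.append_nil _).symm
    · rfl
    · rfl
    · rfl
    · ext1
      · exact hb.1.dom_rho.symm.trans (Step.cod_core _)
      · exact hrho

/-- If the generators were disjoint in this order, positive lengths would make `S₁.lam` and `S₂.rho`
nonempty. Minimality would then empty `S₂.lam` and `S₁.rho`, and the branching would be independent.
-/
theorem IsMinimal.lt (h : P.IsMinimal S₁ S₂) (hb : P.IsLocalBranching S₁ S₂)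
    (hpos : ∀ A : P.G3, 0 < (P.src2 A).length) (hi : ¬ P.IsIndependent S₂ S₁) :
    S₁.lam.length < S₂.lam.length + (P.src2 S₂.gen).length := by
  by_contra! hle
  refine hi (hb.isIndependent ?_ ?_ hle)
  · refine (h.lam_eq_nil hb).resolve_left fun h0 => ?_
    have := hpos S₂.gen
    simp only [Cell2.length, h0, List.length_nil] at hle this
    omega
  · refine (h.rho_eq_nil hb).resolve_right fun h0 => ?_
    have := hpos S₁.gen
    have hl := congrArg List.length hb.steps_eq
    simp only [List.length_append, Step.length_steps_core, h0, List.length_nil] at hl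
    simp only [Cell2.length] at hle this hl
    omega

theorem IsMinimal.symm (h : P.IsMinimal S₁ S₂) : P.IsMinimal S₂ S₁ := by
  intro S₁' S₂' l r lam rho hb hl hr hlam hrho h1 h2 h3 h4 e1 e2
  rw [hb.2.2] at h1 h2 h3 h4
  exact h S₂' S₁' l r lam rho hb.symm hl hr hlam hrho h1 h2 h3 h4 e2 e1

/-- In an independent branching the second generator starts no earlier than the first one ends,
against `lt`. -/
theorem IsTight.not_isIndependent (h : IsTight S₁ S₂) : ¬ P.IsIndependent S₂ S₁ := by
  rintro ⟨A₁, A₂, l₁, r₁, l₂, r₂, χ, -, -, -, -, -, -, -, -, -, -, -, rfl, rfl⟩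
  have := h.lt
  simp only [Cell2.length, Step.pre, Step.post, Step.lwhisk, Step.rwhisk, Step.ofGen,
    Cell2.steps_comp, Cell2.steps_lwhisk, Cell2.steps_rwhisk, Cell2.steps_one, List.length_append,
    List.length_map, List.map_nil, List.length_nil] at this
  omega

theorem IsTight.isMinimal (h : IsTight S₁ S₂) : P.IsMinimal S₁ S₂ := by
  rintro S₁' S₂' l r lam rho hb - - - - - - - - rfl rfl
  have h1 := h.lam
  have h2 := h.rho
  have h3 := h.left
  have h4 := h.right
  simp only [Step.pre, Step.post, Step.lwhisk, Step.rwhisk, Cell2.steps_comp, word_comp,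
    List.append_eq_nil_iff] at h1 h2 h3 h4
  tauto

/-- This trades quantification over all decompositions for conditions that can be read off the two
steps. -/
theorem isTight_iff (hpos : ∀ A : P.G3, 0 < (P.src2 A).length) :
    IsTight S₁ S₂ ↔ P.IsLocalBranching S₁ S₂ ∧ P.IsMinimal S₁ S₂ ∧
      ¬ P.IsIndependent S₁ S₂ ∧ ¬ P.IsIndependent S₂ S₁ := by
  constructor
  · exact fun h => ⟨h.branching, h.isMinimal, h.symm.not_isIndependent, h.not_isIndependent⟩
  · rintro ⟨hb, h, h₁, h₂⟩
    have lt := h.lt hb hpos h₂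
    have lt' := h.symm.lt hb.symm hpos h₁
    exact ⟨hb, h.lam_eq_nil hb, h.rho_eq_nil hb, h.left_eq_nil hb hpos lt lt',
      h.right_eq_nil hb hpos lt lt', lt, lt'⟩

end Prepoly3

end GrayRewriting

/-! ### Natural branchings in terms of positions and lengths -/

namespace GrayRewriting

/-- The value of `f` at the last member of a list. -/
def lastVal {α : Type*} (f : α → ℕ) (l : List α) : ℕ := l.foldl (fun _ w => f w) 0

/-- The value of `f` at the first member of a list. -/
def firstVal {α : Type*} (f : α → ℕ) (l : List α) : ℕ := l.foldr (fun w _ => f w) 0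

theorem lastVal_concat {α : Type*} (f : α → ℕ) (l : List α) (a : α) :
    lastVal f (l ++ [a]) = f a := by
  simp [lastVal]

theorem lastVal_of_getElem? {α : Type*} (f : α → ℕ) {l : List α} {a : α}
    (h : l[l.length - 1]? = some a) : lastVal f l = f a := by
  rcases List.eq_nil_or_concat' l with rfl | ⟨l, b, rfl⟩
  · simp at h
  · obtain rfl : b = a := by simpa using h
    exact lastVal_concat f l b

theorem firstVal_of_getElem? {α : Type*} (f : α → ℕ) {l : List α} {a : α}
    (h : l[0]? = some a) : firstVal f l = f a := by
  cases l with
  | nil => simp at h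
  | cons b l =>
    obtain rfl : b = a := by simpa using h
    rfl

theorem lastVal_map {α β : Type*} (f : β → ℕ) (g : α → β) (l : List α) :
    lastVal f (l.map g) = lastVal (fun a => f (g a)) l := by
  simp [lastVal, List.foldl_map]

theorem firstVal_map {α β : Type*} (f : β → ℕ) (g : α → β) (l : List α) :
    firstVal f (l.map g) = firstVal (fun a => f (g a)) l := by
  simp [firstVal, List.foldr_map]

namespace Prepoly2

open Prepoly1 (Cell1)
open Prepoly1.Cell1

variable {P : Prepoly2.{u}}

theorem interleave_replicate_l (n : ℕ) (f : P.Cell1) (as : List P.Whisker) (g : P.Cell1)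
    (bs : List P.Whisker) :
    interleave (List.replicate n .l) f as g bs = (as.take n).map (fun w => w.rwhisk g) := by
  induction n generalizing f as with
  | zero => simp [interleave]
  | succ n ih =>
    cases as with
    | nil => simp [interleave, List.replicate_succ]
    | cons a as => simp [interleave, List.replicate_succ, ih]

theorem interleave_replicate_r (n : ℕ) (f : P.Cell1) (as : List P.Whisker) (g : P.Cell1)
    (bs : List P.Whisker) :
    interleave (List.replicate n .r) f as g bs = (bs.take n).map (Whisker.lwhisk f) := by
  induction n generalizing g bs with
  | zero => simp [interleave]
  | succ n ih =>
    cases bs with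
    | nil => cases as <;> simp [interleave, List.replicate_succ]
    | cons b bs => simp [interleave, List.replicate_succ, ih]

namespace Cell2

/-- The number of letters to the right of the last whisker. -/
def lastRight (φ : P.Cell2) : ℕ := lastVal (fun w => w.right.word.length) φ.steps

/-- The number of letters to the left of the first whisker. -/
def firstLeft (φ : P.Cell2) : ℕ := firstVal (fun w => w.left.word.length) φ.steps

theorem boundary_zero (φ : P.Cell2) : φ.boundary 0 = φ.dom := by
  simp [boundary, pathEnd]

theorem boundary_of_le (φ : P.Cell2) {n : ℕ} (h : φ.steps.length ≤ n) : φ.boundary n = φ.cod := by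
  simp [boundary, cod, List.take_of_length_le h]

theorem cod_ofGen (α : P.G2) : (ofGen α).cod = P.tgt1 α := by
  simp [ofGen, cod, pathEnd, Whisker.tgt, Prepoly1.Cell1.one_comp (P.dom_tgt1 α)]

theorem isCell_ofGen (α : P.G2) : (ofGen α).IsCell := by
  refine ⟨P.isCell_src1 α, ?_, ?_, trivial⟩
  · simp only [ofGen, List.mem_singleton, forall_eq]
    exact ⟨trivial, trivial, rfl, rfl⟩
  · simp [ofGen, Whisker.src, Prepoly1.Cell1.one_comp (f := P.src1 α) rfl]

end Cell2

namespace InterchangeIndex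

theorem dom_source (x : P.InterchangeIndex) :
    x.source.dom = P.src1 x.fst ⬝₀ (x.mid ⬝₀ P.src1 x.snd) := rfl

theorem steps_source (x : P.InterchangeIndex) : x.source.steps =
    [⟨Cell1.one (P.src1 x.fst).dom, x.fst, x.mid ⬝₀ P.src1 x.snd⟩,
      ⟨P.tgt1 x.fst ⬝₀ x.mid, x.snd, Cell1.one (P.src1 x.snd).cod⟩] := by
  have h := x.fst_mid
  simp [source, Cell2.ofGen, Whisker.rwhisk, Whisker.lwhisk,
    Prepoly1.Cell1.one_comp (f := x.mid ⬝₀ P.src1 x.snd) h.symm]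

theorem cod_source (x : P.InterchangeIndex) :
    x.source.cod = P.tgt1 x.fst ⬝₀ x.mid ⬝₀ P.tgt1 x.snd := by
  simp [Cell2.cod, steps_source, pathEnd, Whisker.tgt]

theorem cod_dom_source (x : P.InterchangeIndex) : x.source.dom.cod = (P.src1 x.snd).cod := by
  rw [dom_source, cod_comp, cod_comp x.mid_snd]
  exact x.fst_mid

/-- The two whiskers of the source display both generators and the word of the middle path; the
start of that path is the end of `P.src1 x.fst`. Hence an interchange generator determines its
index. -/
theorem eq_of_source_eq {x y : P.InterchangeIndex} (h : x.source = y.source) : x = y := by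
  have h := congrArg Cell2.steps h
  rw [steps_source, steps_source] at h
  obtain ⟨a, m, b, h1, h2, h3⟩ := x
  obtain ⟨a', m', b', h1', h2', h3'⟩ := y
  simp only [List.cons.injEq, Whisker.mk.injEq, and_true] at h
  obtain ⟨⟨-, rfl, -⟩, hm, rfl, -⟩ := h
  obtain rfl : m = m' := comp_left_cancel (h2.symm.trans h2') hm
  rfl

end InterchangeIndex

end Prepoly2

namespace GrayPresentation

open Prepoly1 (Cell1)
open Prepoly2 (Cell2 Whisker)
open Prepoly1.Cell1
open Prepoly3

variable {Q : GrayPresentation.{u}} {S₁ S₂ : Q.Step}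

theorem X_injective : Function.Injective Q.X := fun x y h =>
  Prepoly2.InterchangeIndex.eq_of_source_eq (by rw [← Q.src2_X, ← Q.src2_X, h])

/-- `S₂` exchanges the last whisker of the generator of `S₁`, which lies entirely to the left of
the other generator. -/
def IsNaturalBelow (S₁ S₂ : Q.Step) : Prop :=
  S₂.lam.length + 1 = S₁.lam.length + (Q.src2 S₁.gen).length ∧
    ∃ x, Q.X x = S₂.gen ∧ (Q.src2 S₁.gen).lastRight ≤ x.mid.word.length

/-- `S₂` exchanges the first whisker of the generator of `S₁`, which lies entirely to the right of
the other generator. -/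
def IsNaturalAbove (S₁ S₂ : Q.Step) : Prop :=
  S₁.lam.length = S₂.lam.length + 1 ∧
    ∃ x, Q.X x = S₂.gen ∧ (Q.src2 S₁.gen).firstLeft ≤ x.mid.word.length

theorem IsNatural.below_or_above (h : Q.IsNatural S₁ S₂) (hpos : ∀ A, 0 < (Q.src2 A).length) :
    IsNaturalBelow S₁ S₂ ∨ IsNaturalAbove S₁ S₂ := by
  rcases h with ⟨A, g, ψ, -, -, hg, -, rfl, a, b, x, ha, hb, -, hm, -, rfl⟩ |
    ⟨φ, g, B, -, -, -, -, rfl, a, b, x, ha, hb, -, hm, -, rfl⟩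
  · left
    have hA := hpos A
    simp only [List.count_replicate_self] at ha
    refine ⟨?_, x, rfl, ?_⟩
    · simp only [Prepoly2.Cell2.interp, Cell2.length, Prepoly2.interleave_replicate_l, Step.post,
        Step.rwhisk, Step.ofGen, Cell2.steps_rwhisk, Cell2.steps_one, List.length_map,
        List.drop_zero, List.length_take, List.length_nil] at hA ⊢
      omega
    · rw [hm, Cell2.lastRight]
      erw [lastVal_of_getElem? _ ha]
      simp
  · right
    -- The whisker `a` lies in `φ`, so the truncated subtraction `φ.length - 1` is exact.
    have hφ : 0 < φ.length := by
      by_contra h0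
      simp only [Cell2.length, not_lt, Nat.le_zero, List.length_eq_zero_iff] at h0
      simp [Cell2.length, h0] at ha
    rw [List.count_replicate, if_neg (by decide)] at hb
    refine ⟨?_, x, rfl, ?_⟩
    · simp only [Prepoly2.Cell2.interp, Cell2.length, Prepoly2.interleave_replicate_l, Step.pre,
        Step.lwhisk, Step.ofGen, Cell2.steps_rwhisk, Cell2.steps_lwhisk, Cell2.steps_comp,
        Cell2.steps_one, List.length_map, List.map_nil, List.append_nil,
        List.drop_zero, List.length_take] at hφ ⊢
      omega
    · rw [hm, Cell2.firstLeft]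
      erw [firstVal_of_getElem? _ hb]
      simp

end GrayPresentation

end GrayRewriting

/-! ### From positions and lengths back to natural branchings -/

namespace GrayRewriting

namespace GrayPresentation

open Prepoly1 (Cell1)
open Prepoly2 (Cell2 Whisker)
open Prepoly1.Cell1
open Prepoly3

variable {Q : GrayPresentation.{u}} {S₁ S₂ : Q.Step}

/-- Tightness leaves no room: the length condition makes `mid` the path `w.right` followed by a gap
`g`, and the contexts `lam₁`, `l₁`, `r₂`, `rho₂` are empty. The `2`-cell `ψ` of the natural
branching is the single generator `β`. -/
theorem isNatural_of_below (h : IsTight S₁ S₂)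
    (hpos : ∀ A, 0 < (Q.src2 A).length) (hn : IsNaturalBelow S₁ S₂) : Q.IsNatural S₁ S₂ := by
  obtain ⟨lam₁, l₁, A, r₁, rho₁⟩ := S₁
  obtain ⟨lam₂, l₂, B, r₂, rho₂⟩ := S₂
  obtain ⟨hlen, x, hx, hle⟩ := hn
  obtain rfl : Q.X x = B := hx
  have hb := h.branching
  have hs := hb.steps_eq
  have hAc := Q.isCell_src2 A
  obtain ⟨as, w, hw⟩ : ∃ as w, (Q.src2 A).steps = as ++ [w] :=
    (List.eq_nil_or_concat' _).resolve_left (List.ne_nil_of_length_pos (hpos A))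
  have hlA : (Q.src2 A).length = as.length + 1 := by simp [Cell2.length, hw]
  have hlr : (Q.src2 A).lastRight = w.right.word.length := by
    rw [Cell2.lastRight, hw, lastVal_concat]
  have hwA : w ∈ (Q.src2 A).steps := by simp [hw]
  have hwc := hAc.2.1 w hwA
  simp only [hlr] at hle hlen
  have hlam₁ : lam₁.steps = [] := by
    refine h.lam.elim id fun h0 => ?_
    have h0' : lam₂.length = 0 := by simpa [Cell2.length] using h0
    have h1 : lam₁.length = 0 := by omega
    simpa [Cell2.length] using h1
  have hlam₁' : lam₁.length = 0 := by simp [Cell2.length, hlam₁]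
  have hlen' : lam₂.steps.length = as.length := by
    have : lam₂.length = as.length := by omega
    exact this
  have hXs := x.steps_source
  rw [← Q.src2_X] at hXs
  obtain ⟨e1, e2, e3⟩ := hb.whisker_eq (p := as.length) (q := 0) (by simp only; omega)
    (w := w) (v := ⟨Cell1.one (Q.src1 x.fst).dom, x.fst, x.mid ⬝₀ Q.src1 x.snd⟩)
    (by simp [hw]) (by simp [hXs])
  obtain ⟨α, mid, β, hmid, hfst, hsnd⟩ := x
  simp only at e1 e2 e3 hXs hle
  subst e2
  rw [comp_one] at e1
  have hl : l₁.word = [] := by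
    refine h.left.elim id fun h0 => ?_
    have e := congrArg word e1
    simp only [word_comp] at e h0
    rw [h0, List.append_eq_nil_iff] at e
    exact e.1
  have hl' : l₁ = Cell1.one (Q.src2 A).dom.dom := by
    rw [eq_one hl, hb.1.cod_left]
  subst hl'
  obtain rfl : w.left = l₂ := by
    rw [← e1, one_comp (hAc.dom_left hwA)]
  -- Two factorizations of the word to the right of the shared whisker are compared; by `hle` the
  -- prefix `w.right` is the shorter one, and `g'` is the gap between `A` and `β`.
  obtain ⟨g', hg1, hg2⟩ : ∃ g', mid.word = w.right.word ++ g' ∧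
      r₁.word = g' ++ ((Q.src1 β).word ++ r₂.word) := by
    have e := congrArg word e3
    simp only [word_comp, List.append_assoc] at e
    rcases List.append_eq_append_iff.1 e with ⟨t, ht1, ht2⟩ | ⟨t, ht1, ht2⟩
    · exact ⟨t, ht1, ht2⟩
    · have : t = [] := by
        have := congrArg List.length ht1
        simp only [List.length_append] at this
        exact List.eq_nil_of_length_eq_zero (by omega)
      subst this
      exact ⟨[], by simpa using ht1.symm, by simpa using ht2.symm⟩
  have hr2 : r₂.word = [] := by
    refine h.right.elim (fun h0 => ?_) id
    simp only at h0
    rw [h0] at hg2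
    have e := hg2.symm
    simp only [List.append_eq_nil_iff] at e
    exact e.2.2
  have hmd : mid.dom = w.right.dom := by
    have e := congrArg Prepoly1.Cell1.dom e3
    exact e.symm
  have hcr : w.right.cod = (Q.src2 A).dom.cod := hAc.cod_right hwA
  obtain rfl : mid = w.right ⬝₀ ⟨w.right.cod, g'⟩ := by
    ext1
    · exact hmd
    · exact hg1
  have hgc : (⟨w.right.cod, g'⟩ : Q.Cell1).cod = (Q.src1 β).dom := by
    rw [← hsnd, cod_comp rfl]
  have hr1 : r₁ = ⟨w.right.cod, g'⟩ ⬝₀ Q.src1 β := by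
    ext1
    · exact hb.1.dom_right.symm.trans hcr.symm
    · simpa [hr2] using hg2
  have hr2' : r₂ = Cell1.one (Q.src1 β).cod := by
    have h1 := hb.2.1.dom_right
    simp only at h1
    rw [Q.src2_X, Prepoly2.InterchangeIndex.cod_dom_source] at h1
    ext1
    · exact h1.symm
    · exact hr2
  subst hr1 hr2'
  have hgcell := ((isCell_comp (f := w.right) rfl).1 hmid).2
  generalize hg : (⟨w.right.cod, g'⟩ : Q.Cell1) = g at *
  have hgd : w.right.cod = g.dom := by rw [← hg]
  have hc1 := Step.steps_core (⟨lam₁, Cell1.one (Q.src2 A).dom.dom, A, g ⬝₀ Q.src1 β, rho₁⟩ : Q.Step)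
  have hc2 := Step.steps_core (⟨lam₂, w.left, Q.X ⟨w.gen, w.right ⬝₀ g, β, hmid, hfst, hsnd⟩,
    Cell1.one (Q.src1 β).cod, rho₂⟩ : Q.Step)
  simp only [hXs, hw, List.map_append, List.map_cons, List.map_nil] at hc1 hc2
  simp only [hc1, hc2, hlam₁, List.nil_append, List.append_assoc] at hs
  -- Cutting just before the last whisker of `A`: what precedes it is `lam₂`, and the second whisker
  -- of the interchange generator lies in `rho₁`, so that `rho₂` is the empty one.
  obtain ⟨hs1, hs2⟩ := List.append_inj hs (by simp [hlen'])
  have hrho : rho₂.steps = [] := by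
    refine h.rho.elim (fun h0 => ?_) id
    simp only at h0
    simp [h0] at hs2
  have has : as.map (fun v => (v.lwhisk (Cell1.one (Q.src2 A).dom.dom)).rwhisk (g ⬝₀ Q.src1 β)) =
      as.map (fun v => v.rwhisk (g ⬝₀ Q.src1 β)) := by
    refine List.map_congr_left fun v hv => ?_
    ext1
    · exact one_comp (hAc.dom_left (by simp [hw, hv]))
    · rfl
    · rfl
  rw [has] at hs1
  simp only [hrho, List.cons_append, List.nil_append, List.cons.injEq] at hs2
  have hcA : (Q.src2 A).cod = w.tgt := by
    rw [Cell2.cod, hw, pathEnd_append]; rfl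
  have hd1 : lam₁.dom = (Q.src2 A).dom ⬝₀ (g ⬝₀ Q.src1 β) := by
    have e := hb.1.cod_lam
    rw [Step.dom_core] at e
    simp only at e
    rw [one_comp (by rfl)] at e
    rw [← e]
    simp [Cell2.cod, hlam₁, pathEnd]
  left
  refine ⟨A, g, Cell2.ofGen β, hgcell, Cell2.isCell_ofGen β, by rw [← hcr, hgd], hgc, ?_, w,
    ⟨g ⬝₀ Cell1.one (Q.src1 β).dom, β, Cell1.one (Q.src1 β).cod⟩, ⟨w.gen, w.right ⬝₀ g, β, hmid, hfst, hsnd⟩, ?_, ?_, rfl, ?_,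
    rfl, ?_⟩
  · have hdr := hb.1.dom_right
    simp only at hdr
    rw [show (Cell2.ofGen β).dom = Q.src1 β from rfl, Step.rwhisk_ofGen hdr]
    ext1
    · ext1
      · exact hd1
      · exact hlam₁
    · rfl
    · rfl
    · rfl
    · ext1
      · have e := hb.1.dom_rho
        rw [Step.cod_core] at e
        simp only at e
        rw [one_comp hAc.dom_cod] at e
        exact e.symm
      · simp only [Step.post, Cell2.steps_comp, Cell2.steps_one, List.nil_append]
        rw [hs2.2, hcA]
        simp [Cell2.ofGen, Whisker.lwhisk, Whisker.rwhisk, Whisker.tgt, comp_assoc]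
  · simp [hlA, hw]
  · rw [List.count_replicate, if_neg (by decide)]
    rfl
  · simp
  · have hb1 : (g ◁₂ Cell2.ofGen β).boundary 1 = g ⬝₀ Q.tgt1 β := by
      rw [Cell2.boundary_of_le _ (by simp [Cell2.ofGen]), Cell2.cod_lwhisk, Cell2.cod_ofGen]
    rw [List.count_replicate_self, List.count_replicate, if_neg (by decide)]
    ext1
    · ext1
      · rw [← hb.dom_lam]
        simp only [Cell2.interp, Cell2.boundary_zero]
        exact hd1
      · simp only [Cell2.interp, Cell2.boundary_zero, Prepoly2.interleave_replicate_l,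
          List.drop_zero, hlA, hw, Nat.add_sub_cancel, List.take_left']
        exact hs1.symm
    · rfl
    · rfl
    · rfl
    · ext1
      · have e := hb.2.1.dom_rho
        rw [Step.cod_core] at e
        simp only [Q.src2_X, Prepoly2.InterchangeIndex.cod_source] at e
        simp only [Cell2.interp, Nat.zero_add]
        rw [hb1, Cell2.boundary_of_le _ (by rw [hw, hlA]; simp), ← e, hcA]
        simp [Whisker.tgt, comp_assoc]
      · rw [hrho]
        simp [Cell2.interp, Cell2.length, Cell2.ofGen, Prepoly2.interleave]

/-- The mirror case: `φ` is the single generator `α`, whose whisker is all of `lam₁`, and `mid` is a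
gap `g` followed by `w.left`, where `w` is the first whisker of `A`. Now `lam₂`, `l₂`, `r₁`, `rho₁`
are empty. -/
theorem isNatural_of_above (h : IsTight S₁ S₂)
    (hpos : ∀ A, 0 < (Q.src2 A).length) (hn : IsNaturalAbove S₁ S₂) : Q.IsNatural S₁ S₂ := by
  obtain ⟨lam₁, l₁, A, r₁, rho₁⟩ := S₁
  obtain ⟨lam₂, l₂, B, r₂, rho₂⟩ := S₂
  obtain ⟨hlen, x, hx, hle⟩ := hn
  obtain rfl : Q.X x = B := hx
  have hb := h.branching
  have hs := hb.steps_eq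
  have hAc := Q.isCell_src2 A
  obtain ⟨w, as, hw⟩ := List.exists_cons_of_ne_nil (List.ne_nil_of_length_pos (hpos A))
  have hlA : (Q.src2 A).length = as.length + 1 := by simp [Cell2.length, hw]
  have hlr : (Q.src2 A).firstLeft = w.left.word.length := by
    rw [Cell2.firstLeft, hw]; rfl
  have hwA : w ∈ (Q.src2 A).steps := by simp [hw]
  simp only [hlr] at hle hlen
  have hlam₂ : lam₂.steps = [] := by
    refine h.lam.elim (fun h0 => ?_) id
    simp only [Cell2.length] at hlen h0
    simp [h0] at hlen
  have hXs := x.steps_source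
  rw [← Q.src2_X] at hXs
  obtain ⟨e1, e2, e3⟩ := hb.whisker_eq (p := 0) (q := 1) hlen
    (w := w) (v := ⟨Q.tgt1 x.fst ⬝₀ x.mid, x.snd, Cell1.one (Q.src1 x.snd).cod⟩)
    (by simp [hw]) (by simp [hXs])
  obtain ⟨α, mid, β, hmid, hfst, hsnd⟩ := x
  simp only at e1 e2 e3 hXs hle
  subst e2
  have hr : r₁.word = [] := by
    refine h.right.elim id fun h0 => ?_
    have e := congrArg word e3
    simp only [word_comp] at e h0
    rw [h0] at e
    simp only [word_one, List.append_nil, List.append_eq_nil_iff] at e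
    exact e.2
  have hr' : r₁ = Cell1.one (Q.src2 A).dom.cod := by
    have h1 := hb.1.dom_right
    ext1
    · exact h1.symm
    · exact hr
  subst hr'
  have hr2d : r₂.dom = (Q.src1 w.gen).cod := by
    have h1 := hb.2.1.dom_right
    simp only at h1
    rw [Q.src2_X, Prepoly2.InterchangeIndex.cod_dom_source] at h1
    exact h1.symm
  obtain rfl : w.right = r₂ := by
    rw [comp_one, one_comp hr2d] at e3
    exact e3
  -- Here the words to the left of the shared whisker are compared, and `w.left` is the shorter
  -- suffix.
  obtain ⟨g', hg1, hg2⟩ : ∃ g', mid.word = g' ++ w.left.word ∧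
      l₁.word = l₂.word ++ ((Q.tgt1 α).word ++ g') := by
    have e := congrArg word e1
    simp only [word_comp, ← List.append_assoc] at e
    rcases List.append_eq_append_iff.1 e with ⟨t, ht1, ht2⟩ | ⟨t, ht1, ht2⟩
    · have : t = [] := by
        have := congrArg List.length ht2
        simp only [List.length_append] at this
        exact List.eq_nil_of_length_eq_zero (by omega)
      subst this
      exact ⟨[], by simpa using ht2.symm, by simpa using ht1.symm⟩
    · exact ⟨t, ht2, by rw [ht1, List.append_assoc]⟩
  have hl2 : l₂.word = [] := by
    refine h.left.elim (fun h0 => ?_) id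
    simp only at h0
    rw [h0] at hg2
    have e := hg2.symm
    simp only [List.append_eq_nil_iff] at e
    exact e.1
  have hl2' : l₂ = Cell1.one (Q.src1 α).dom := by
    rw [eq_one hl2, hb.2.1.cod_left]
    simp only [Q.src2_X]
    rfl
  subst hl2'
  have hld : l₁.dom = (Q.src1 α).dom := by
    have e := congrArg Prepoly1.Cell1.dom e1
    exact e
  have hl1 : l₁ = Q.tgt1 α ⬝₀ ⟨mid.dom, g'⟩ := by
    ext1
    · rw [hld, dom_comp, Q.dom_tgt1]
    · exact hg2
  subst hl1
  have hαm : (Q.tgt1 α).cod = mid.dom := by rw [Q.cod_tgt1, hfst]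
  have hgA : (⟨mid.dom, g'⟩ : Q.Cell1).cod = (Q.src2 A).dom.dom  :=
    (cod_comp (g := ⟨mid.dom, g'⟩) hαm).symm.trans hb.1.cod_left
  have hgl : (⟨mid.dom, g'⟩ : Q.Cell1).cod = w.left.dom := by
    rw [hgA, hAc.dom_left hwA]
  have hgcell : (⟨mid.dom, g'⟩ : Q.Cell1).IsCell :=
    ((isCell_comp (g := ⟨mid.dom, g'⟩) hαm).1 hb.1.2.1).2
  have hgm : mid = ⟨mid.dom, g'⟩ ⬝₀ w.left := by
    ext1
    · rfl
    · exact hg1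
  generalize hg : (⟨mid.dom, g'⟩ : Q.Cell1) = g at *
  have hgd : mid.dom = g.dom := by rw [← hg]
  clear hg hg1
  subst hgm
  have hc1 := Step.steps_core (⟨lam₁, Q.tgt1 α ⬝₀ g, A, Cell1.one (Q.src2 A).dom.cod, rho₁⟩ : Q.Step)
  have hc2 := Step.steps_core (⟨lam₂, Cell1.one (Q.src1 α).dom,
    Q.X ⟨α, g ⬝₀ w.left, w.gen, hmid, hfst, hsnd⟩, w.right, rho₂⟩ : Q.Step)
  simp only [hXs, hw, List.map_cons, List.map_nil] at hc1 hc2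
  obtain ⟨c, hc⟩ : ∃ c, lam₁.steps = [c] :=
    List.length_eq_one_iff.1 (by simpa [Cell2.length, hlam₂] using hlen)
  simp only [hc1, hc2, hlam₂, hc, List.nil_append, List.cons_append, List.cons.injEq] at hs
  obtain ⟨hs1, -, hs2⟩ := hs
  have hrho : rho₁.steps = [] := by
    refine h.rho.elim id (fun h0 => ?_)
    simp only at h0
    rw [h0] at hs2
    exact (List.append_eq_nil_iff.1 hs2).2
  rw [hrho, List.append_nil] at hs2
  have hdA : (Q.src2 A).dom = w.src := by
    have := hAc.2.2
    rw [hw] at this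
    exact this.1.symm
  have hd2 : lam₂.dom = Q.src1 α ⬝₀ (g ⬝₀ (Q.src2 A).dom) := by
    have e := hb.2.1.cod_lam
    rw [Step.dom_core] at e
    simp only [Q.src2_X, Prepoly2.InterchangeIndex.dom_source] at e
    rw [one_comp (by rfl)] at e
    rw [hdA]
    simp only [Whisker.src, ← comp_assoc] at e ⊢
    rw [← e]
    simp [Cell2.cod, hlam₂, pathEnd]
  right
  refine ⟨Cell2.ofGen α, g, A, Cell2.isCell_ofGen α, hgcell, hfst.trans hgd, hgA, ?_,
    ⟨Cell1.one (Q.src1 α).dom, α, Cell1.one (Q.src1 α).cod ⬝₀ g⟩, w, ⟨α, g ⬝₀ w.left, w.gen, hmid, hfst, hsnd⟩, ?_, ?_, rfl,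
    ?_, rfl, ?_⟩
  · rw [Cell2.cod_ofGen, Step.lwhisk_ofGen]
    ext1
    · ext1
      · rw [hb.dom_lam]
        exact hd2
      · rw [hc, hs1]
        simp [Step.pre, Cell2.ofGen, Whisker.lwhisk, Whisker.rwhisk]
        rw [hdA, one_comp]
        · simp [Whisker.src, comp_assoc]
        · exact (hfst.trans hgd).symm
    · rfl
    · rfl
    · rfl
    · ext1
      · have e := hb.1.dom_rho
        rw [Step.cod_core] at e
        simp only [comp_one] at e
        exact e.symm
      · exact hrho
  · rw [List.count_replicate_self]
    rfl
  · rw [List.count_replicate, if_neg (by decide), hw]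
    rfl
  · simp only
    rw [one_comp]
    exact (hfst.trans hgd).symm
  · have hb1 : (Cell2.ofGen α ▷₂ g).boundary 1 = Q.tgt1 α ⬝₀ g := by
      rw [Cell2.boundary_of_le _ (by simp [Cell2.ofGen]), Cell2.cod_rwhisk, Cell2.cod_ofGen]
    rw [List.count_replicate_self, List.count_replicate, if_neg (by decide)]
    ext1
    · ext1
      · simp only [Cell2.interp, Cell2.boundary_zero]
        rw [hd2]
        exact (comp_assoc _ _ _).symm
      · rw [hlam₂]
        simp [Cell2.interp, Cell2.length, Cell2.ofGen, Prepoly2.interleave]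
    · rfl
    · rfl
    · rfl
    · ext1
      · have e := hb.2.1.dom_rho
        rw [Step.cod_core] at e
        simp only [Q.src2_X, Prepoly2.InterchangeIndex.cod_source] at e
        simp only [Cell2.interp, Nat.zero_add]
        rw [show (Cell2.ofGen α).length - 1 + 1 = 1 from rfl, hb1, ← e]
        simp [Cell2.boundary, hw, pathEnd, Whisker.tgt, comp_assoc]
        exact one_comp (Q.dom_tgt1 α)
      · rw [← hs2]
        simp only [Cell2.interp, Prepoly2.interleave_replicate_r, hlA, hw, Nat.add_sub_cancel]
        rw [show (Cell2.ofGen α).length - 1 + 1 = 1 from rfl, hb1]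
        simp [Whisker.lwhisk, Whisker.rwhisk]

/-- Criticality in terms of positions and lengths. -/
theorem isCritical_iff (hpos : ∀ A, 0 < (Q.src2 A).length) :
    Q.IsCritical S₁ S₂ ↔ IsTight S₁ S₂ ∧ S₁ ≠ S₂ ∧ ¬ IsNaturalBelow S₁ S₂ ∧
      ¬ IsNaturalAbove S₁ S₂ ∧ ¬ IsNaturalBelow S₂ S₁ ∧ ¬ IsNaturalAbove S₂ S₁ := by
  constructor
  · rintro ⟨hb, hm, hne, hi, hi', hn, hn'⟩
    have ht := (isTight_iff hpos).2 ⟨hb, hm, hi, hi'⟩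
    exact ⟨ht, hne, fun h => hn (isNatural_of_below ht hpos h),
      fun h => hn (isNatural_of_above ht hpos h),
      fun h => hn' (isNatural_of_below ht.symm hpos h),
      fun h => hn' (isNatural_of_above ht.symm hpos h)⟩
  · rintro ⟨ht, hne, h1, h2, h3, h4⟩
    obtain ⟨hb, hm, hi, hi'⟩ := (isTight_iff hpos).1 ht
    exact ⟨hb, hm, hne, hi, hi', fun h => (h.below_or_above hpos).elim h1 h2,
      fun h => (h.below_or_above hpos).elim h3 h4⟩

theorem IsCritical.symm (h : Q.IsCritical S₁ S₂) : Q.IsCritical S₂ S₁ :=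
  ⟨h.1.symm, h.2.1.symm, h.2.2.1.symm, h.2.2.2.2.1, h.2.2.2.1, h.2.2.2.2.2.2, h.2.2.2.2.2.1⟩

end GrayPresentation

end GrayRewriting

namespace GrayRewriting

/-! ### Bounding the contexts of critical branchings -/

namespace Prepoly1.Cell1

variable {P : Prepoly1.{u}}

/-- `f.IsFactor g`: the path `f` is a segment of the path `g`. -/
def IsFactor (f g : P.Cell1) : Prop :=
  ∃ a b, g.word = a ++ f.word ++ b ∧ f.dom = pathEnd P.tgt0 g.dom a

theorem isFactor_left (f g : P.Cell1) : f.IsFactor (f ⬝₀ g) := ⟨[], g.word, by simp, rfl⟩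

theorem isFactor_right {f g : P.Cell1} (h : f.cod = g.dom) : g.IsFactor (f ⬝₀ g) :=
  ⟨f.word, [], by simp, h.symm⟩

theorem isFactor_refl (f : P.Cell1) : f.IsFactor f := ⟨[], [], by simp, rfl⟩

theorem isFactor_of_left_nil {f g : P.Cell1} (h : f.word = []) (hc : f.cod = g.dom) :
    f.IsFactor g := by
  rw [eq_one h, hc]
  exact ⟨[], g.word, by simp, rfl⟩

theorem isFactor_of_right_nil {f g : P.Cell1} (h : f.word = []) (hc : g.cod = f.dom) :
    f.IsFactor g :=
  ⟨g.word, [], by simp [h], hc.symm⟩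

/-- Cancelling an empty path on the left. -/
theorem eq_of_left_nil {l a b : P.Cell1} (hl : l.word = []) (hc : l.cod = a.dom)
    (h : l ⬝₀ a = b) : a = b := by
  rw [eq_one hl, hc, one_comp rfl] at h
  exact h

/-- Cancelling an empty path on the right. -/
theorem eq_of_right_nil {r a b : P.Cell1} (hr : r.word = []) (h : a ⬝₀ r = b) : a = b := by
  rw [← h]
  ext1 <;> simp [hr]

end Prepoly1.Cell1

namespace GrayPresentation

open Prepoly1 (Cell1)
open Prepoly2 (Cell2 Whisker)
open Prepoly1.Cell1
open Prepoly3

variable {Q : GrayPresentation.{u}} {S₁ S₂ : Q.Step}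

/-- The paths that occur in the sources and targets of the `2`-generators, or next to a
`2`-generator in the source of an operational `3`-generator. -/
def IsBase (f : Q.Cell1) : Prop :=
  (∃ α, f = Q.src1 α ∨ f = Q.tgt1 α) ∨
    ∃ A, Q.IsOperational A ∧ ∃ w ∈ (Q.src2 A).steps, f = w.left ∨ f = w.right

/-- Finitely many base paths have finitely many segments, so this is the finite stock of paths for
the search. -/
def IsKnown (f : Q.Cell1) : Prop := ∃ g : Q.Cell1, IsBase g ∧ f.IsFactor g

/-- A `3`-generator that is operational or whose middle path is known. -/
def IsKnownGen (A : Q.G3) : Prop := Q.IsOperational A ∨ ∃ x, Q.X x = A ∧ IsKnown x.mid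

/-- A rewriting step whose generator and horizontal context are known. -/
def IsKnownStep (S : Q.Step) : Prop := IsKnown S.left ∧ IsKnownGen S.gen ∧ IsKnown S.right

theorem IsBase.isKnown {f g : Q.Cell1} (hg : IsBase g) (h : f.IsFactor g) : IsKnown f :=
  ⟨g, hg, h⟩

/-- At a shared whisker the two left contexts are prefixes of the same path; once one of them is
empty, this path is the left part of a whisker of the corresponding generator. The right side is
symmetric. -/
theorem known_of_operational (h : IsTight S₁ S₂) (hpos : ∀ A, 0 < (Q.src2 A).length)
    (h₁ : Q.IsOperational S₁.gen) (h₂ : Q.IsOperational S₂.gen) :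
    IsKnownStep S₁ ∧ IsKnownStep S₂ := by
  obtain ⟨w, hw, v, hv, e1, -, e3⟩ := h.branching.exists_overlap hpos h.lt h.lt'
  have c1 := h.branching.1
  have c2 := h.branching.2.1
  have a1 := Q.isCell_src2 S₁.gen
  have a2 := Q.isCell_src2 S₂.gen
  have bl : IsBase w.left := .inr ⟨_, h₁, w, hw, .inl rfl⟩
  have br : IsBase w.right := .inr ⟨_, h₁, w, hw, .inr rfl⟩
  have bl' : IsBase v.left := .inr ⟨_, h₂, v, hv, .inl rfl⟩
  have br' : IsBase v.right := .inr ⟨_, h₂, v, hv, .inr rfl⟩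
  have hl : S₁.left.cod = w.left.dom := by rw [c1.cod_left, a1.dom_left hw]
  have hl' : S₂.left.cod = v.left.dom := by rw [c2.cod_left, a2.dom_left hv]
  have hr : w.right.cod = S₁.right.dom := by rw [← c1.dom_right, a1.cod_right hw]
  have hr' : v.right.cod = S₂.right.dom := by rw [← c2.dom_right, a2.cod_right hv]
  have L : IsKnown S₁.left ∧ IsKnown S₂.left := by
    rcases h.left with h0 | h0
    · refine ⟨bl.isKnown (isFactor_of_left_nil h0 hl), bl.isKnown ?_⟩
      rw [eq_of_left_nil h0 hl e1]
      exact isFactor_left _ _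
    · refine ⟨bl'.isKnown ?_, bl'.isKnown (isFactor_of_left_nil h0 hl')⟩
      rw [eq_of_left_nil h0 hl' e1.symm]
      exact isFactor_left _ _
  have R : IsKnown S₁.right ∧ IsKnown S₂.right := by
    rcases h.right with h0 | h0
    · refine ⟨br.isKnown (isFactor_of_right_nil h0 hr), br.isKnown ?_⟩
      rw [eq_of_right_nil h0 e3]
      exact isFactor_right hr'
    · refine ⟨br'.isKnown ?_, br'.isKnown (isFactor_of_right_nil h0 hr')⟩
      rw [eq_of_right_nil h0 e3.symm]
      exact isFactor_right hr
  exact ⟨⟨L.1, .inl h₁, R.1⟩, ⟨L.2, .inl h₂, R.2⟩⟩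

/-- The cases are which whiskers of the interchange generator meet the operational one: only the
second, only the first, or both. In the first two, failure of naturality bounds the middle path; in
the last, it is a suffix of the left part of a whisker of `S₁.gen`. -/
theorem known_of_interchange (h : IsTight S₁ S₂)
    (hpos : ∀ A, 0 < (Q.src2 A).length) (h₁ : Q.IsOperational S₁.gen)
    {x : Q.InterchangeIndex} (hx : Q.X x = S₂.gen) (hb : ¬ IsNaturalBelow S₁ S₂)
    (ha : ¬ IsNaturalAbove S₁ S₂) : IsKnownStep S₁ ∧ IsKnownStep S₂ := by
  have c1 := h.branching.1
  have c2 := h.branching.2.1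
  have a1 := Q.isCell_src2 S₁.gen
  have hXs := x.steps_source
  rw [← Q.src2_X, hx] at hXs
  have hX2 : (Q.src2 S₂.gen).length = 2 := by rw [Cell2.length, hXs]; rfl
  have hl2 : S₂.left.cod = (Q.src1 x.fst).dom := by
    rw [c2.cod_left, ← hx, Q.src2_X]; rfl
  have hr2 : (Q.src1 x.snd).cod = S₂.right.dom := by
    rw [← c2.dom_right, ← hx, Q.src2_X, x.cod_dom_source]
  have htf : (Q.tgt1 x.fst).cod = x.mid.dom := by rw [Q.cod_tgt1, x.fst_mid]
  have hl2' : S₂.left.cod = (Q.tgt1 x.fst).dom := by rw [hl2, Q.dom_tgt1]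
  have bl : ∀ w ∈ (Q.src2 S₁.gen).steps, IsBase w.left :=
    fun w hw => .inr ⟨_, h₁, w, hw, .inl rfl⟩
  have br : ∀ w ∈ (Q.src2 S₁.gen).steps, IsBase w.right :=
    fun w hw => .inr ⟨_, h₁, w, hw, .inr rfl⟩
  have hl : ∀ w ∈ (Q.src2 S₁.gen).steps, S₁.left.cod = w.left.dom :=
    fun w hw => by rw [c1.cod_left, a1.dom_left hw]
  have hr : ∀ w ∈ (Q.src2 S₁.gen).steps, w.right.cod = S₁.right.dom :=
    fun w hw => by rw [← c1.dom_right, a1.cod_right hw]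
  suffices H : (IsKnown S₁.left ∧ IsKnown S₂.left) ∧ (IsKnown S₁.right ∧ IsKnown S₂.right) ∧
      IsKnown x.mid from
    ⟨⟨H.1.1, .inl h₁, H.2.1.1⟩, ⟨H.1.2, .inr ⟨x, hx, H.2.2⟩, H.2.1.2⟩⟩
  -- the upper whisker of the interchange generator determines the right contexts
  have upper : ∀ p w, (Q.src2 S₁.gen).steps[p]? = some w → S₁.lam.length + p = S₂.lam.length + 1 →
      (IsKnown S₁.right ∧ IsKnown S₂.right) ∧
        S₁.left ⬝₀ w.left = S₂.left ⬝₀ (Q.tgt1 x.fst ⬝₀ x.mid) := by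
    intro p w hw hp
    obtain ⟨e1, -, e3⟩ := h.branching.whisker_eq hp hw (by rw [hXs]; rfl)
    have hw' := List.mem_of_getElem? hw
    simp only at e1 e3
    rw [one_comp hr2.symm] at e3
    have h0 : S₁.right.word = [] := by
      refine h.right.elim id fun h0 => ?_
      have e := congrArg word e3
      rw [h0, word_comp, List.append_eq_nil_iff] at e
      exact e.2
    refine ⟨⟨(br w hw').isKnown (isFactor_of_right_nil h0 (hr w hw')), (br w hw').isKnown ?_⟩, e1⟩
    rw [eq_of_right_nil h0 e3]
    exact isFactor_refl _
  have lt := h.lt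
  have lt' := h.lt'
  rw [hX2] at lt
  by_cases hc : S₁.lam.length = S₂.lam.length + 1
  · obtain ⟨w, hw⟩ : ∃ w, (Q.src2 S₁.gen).steps[0]? = some w :=
      ⟨_, List.getElem?_eq_getElem (hpos S₁.gen)⟩
    have hw' := List.mem_of_getElem? hw
    obtain ⟨R, e1⟩ := upper 0 w hw hc
    -- Otherwise the operational generator would lie entirely to the right of `x.fst`, a natural
    -- branching.
    have hlt : x.mid.word.length < w.left.word.length := by
      by_contra! hle
      exact ha ⟨hc, x, hx, by rw [Cell2.firstLeft, firstVal_of_getElem? _ hw]; exact hle⟩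
    obtain ⟨k, hk, hk'⟩ : ∃ k, w.left.word = k ++ x.mid.word ∧
        S₁.left.word ++ k = S₂.left.word ++ (Q.tgt1 x.fst).word := by
      have e := congrArg word e1
      simp only [word_comp, ← List.append_assoc] at e
      rcases List.append_eq_append_iff.1 e with ⟨t, ht1, ht2⟩ | ⟨t, ht1, ht2⟩
      · exact ⟨t, ht2, ht1.symm⟩
      · have := congrArg List.length ht2
        simp only [List.length_append] at this
        omega
    have ek : S₁.left ⬝₀ ⟨w.left.dom, k⟩ = S₂.left ⬝₀ Q.tgt1 x.fst := by
      ext1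
      · have e := congrArg Prepoly1.Cell1.dom e1
        exact e
      · exact hk'
    have hlk : S₁.left.cod = (⟨w.left.dom, k⟩ : Q.Cell1).dom := hl w hw'
    have hkc : (⟨w.left.dom, k⟩ : Q.Cell1).cod = x.mid.dom := by
      rw [← htf, ← cod_comp hl2', ← ek, cod_comp hlk]
    have hwl : w.left = ⟨w.left.dom, k⟩ ⬝₀ x.mid := by
      ext1
      · rfl
      · exact hk
    refine ⟨?_, R, (bl w hw').isKnown ?_⟩
    -- If `S₂.left` is empty, `S₁.left` is a prefix of `Q.tgt1 x.fst`; this is why targets of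
    -- `2`-generators are base paths.
    · rcases h.left with h0 | h0
      · refine ⟨(bl w hw').isKnown (isFactor_of_left_nil h0 (hl w hw')), (bl w hw').isKnown ?_⟩
        rw [hwl, eq_of_left_nil h0 hlk ek, Prepoly1.Cell1.comp_assoc]
        exact isFactor_left _ _
      · have hbase : IsBase (Q.tgt1 x.fst) := .inl ⟨_, .inr rfl⟩
        refine ⟨hbase.isKnown ?_, hbase.isKnown (isFactor_of_left_nil h0 hl2')⟩
        rw [eq_of_left_nil h0 hl2' ek.symm]
        exact isFactor_left _ _
    · rw [hwl]
      exact isFactor_right hkc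
  -- The first whisker of the interchange generator is the whisker number `p` of the operational
  -- one. Its left part within the interchange source is an identity, which forces `S₁.left` to be
  -- empty.
  · obtain ⟨p, hp⟩ : ∃ p, S₁.lam.length + p = S₂.lam.length :=
      ⟨S₂.lam.length - S₁.lam.length, by omega⟩
    have hpA : p < (Q.src2 S₁.gen).steps.length := by unfold Cell2.length at *; omega
    obtain ⟨w, hw⟩ : ∃ w, (Q.src2 S₁.gen).steps[p]? = some w :=
      ⟨_, List.getElem?_eq_getElem hpA⟩
    have hw' := List.mem_of_getElem? hw
    obtain ⟨e1, -, e3⟩ := h.branching.whisker_eq (q := 0) (by omega) hw (by rw [hXs]; rfl)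
    simp only at e1 e3
    rw [comp_one] at e1
    have h0 : S₁.left.word = [] := by
      refine h.left.elim id fun h0 => ?_
      have e := congrArg word e1
      rw [h0, word_comp, List.append_eq_nil_iff] at e
      exact e.1
    have e1' := eq_of_left_nil h0 (hl w hw') e1
    refine ⟨⟨(bl w hw').isKnown (isFactor_of_left_nil h0 (hl w hw')), (bl w hw').isKnown ?_⟩, ?_⟩
    · rw [e1']
      exact isFactor_refl _
    -- The question is whether the second whisker of the interchange generator is shared as well; it
    -- is not exactly when `p` is the last position.
    by_cases hpl : p + 1 = (Q.src2 S₁.gen).steps.length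
    · have hlt : x.mid.word.length < w.right.word.length := by
        by_contra! hle
        refine hb ⟨by unfold Cell2.length at *; omega, x, hx, ?_⟩
        rw [Cell2.lastRight, lastVal_of_getElem? _ (a := w)]
        · exact hle
        · rw [← hw]; congr 1; omega
      obtain ⟨k, hk, hk'⟩ : ∃ k, w.right.word = x.mid.word ++ k ∧
          k ++ S₁.right.word = (Q.src1 x.snd).word ++ S₂.right.word := by
        have e := congrArg word e3
        simp only [word_comp, List.append_assoc] at e
        rcases List.append_eq_append_iff.1 e with ⟨t, ht1, ht2⟩ | ⟨t, ht1, ht2⟩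
        · have := congrArg List.length ht1
          simp only [List.length_append] at this
          omega
        · exact ⟨t, ht1, ht2.symm⟩
      have hd : w.right.dom = x.mid.dom := by
        have e := congrArg Prepoly1.Cell1.dom e3
        exact e
      have ek : (⟨x.mid.cod, k⟩ : Q.Cell1) ⬝₀ S₁.right = Q.src1 x.snd ⬝₀ S₂.right := by
        ext1
        · exact x.mid_snd
        · exact hk'
      have hwr : w.right = x.mid ⬝₀ ⟨x.mid.cod, k⟩ := by
        ext1
        · exact hd
        · exact hk
      have hkc : (⟨x.mid.cod, k⟩ : Q.Cell1).cod = S₁.right.dom := by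
        rw [← hr w hw', hwr, cod_comp rfl]
      refine ⟨?_, (br w hw').isKnown ?_⟩
      · rcases h.right with h0 | h0
        · refine ⟨(br w hw').isKnown (isFactor_of_right_nil h0 (hr w hw')),
            (br w hw').isKnown ?_⟩
          rw [hwr, eq_of_right_nil h0 ek, ← Prepoly1.Cell1.comp_assoc]
          exact isFactor_right (by rw [cod_comp x.mid_snd, hr2])
        -- Mirror to the use of targets above: `S₁.right` may extend only into the source of
        -- `x.snd`.
        · have hbase : IsBase (Q.src1 x.snd) := .inl ⟨_, .inl rfl⟩
          refine ⟨hbase.isKnown ?_, hbase.isKnown (isFactor_of_right_nil h0 hr2)⟩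
          rw [eq_of_right_nil h0 ek.symm]
          exact isFactor_right hkc
      · rw [hwr]
        exact isFactor_left _ _
    · obtain ⟨w₂, hw₂⟩ : ∃ w, (Q.src2 S₁.gen).steps[p + 1]? = some w :=
        ⟨_, List.getElem?_eq_getElem (by omega)⟩
      have hw₂' := List.mem_of_getElem? hw₂
      -- With both whiskers shared and `S₁.left` empty, `w₂.left` is `S₂.left ⬝₀ Q.tgt1 x.fst ⬝₀
      -- x.mid`, so the middle path is a suffix of it.
      obtain ⟨R, e⟩ := upper (p + 1) w₂ hw₂ (by omega)
      refine ⟨R, (bl w₂ hw₂').isKnown ?_⟩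
      rw [eq_of_left_nil h0 (hl w₂ hw₂') e, ← Prepoly1.Cell1.comp_assoc]
      exact isFactor_right (by rw [cod_comp hl2', htf])

/-- A shift by one position is natural, because the first whisker of an interchange source has empty
left part. Without a shift the two whiskers agree pairwise, which recovers the index and both
contexts, so the steps coincide. -/
theorem not_both_interchange (h : IsTight S₁ S₂) (hne : S₁ ≠ S₂)
    {x y : Q.InterchangeIndex} (hx : Q.X x = S₁.gen) (hy : Q.X y = S₂.gen)
    (ha : ¬ IsNaturalAbove S₁ S₂) (ha' : ¬ IsNaturalAbove S₂ S₁) : False := by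
  have c1 := h.branching.1
  have c2 := h.branching.2.1
  have hXs := x.steps_source
  have hYs := y.steps_source
  rw [← Q.src2_X, hx] at hXs
  rw [← Q.src2_X, hy] at hYs
  have lt := h.lt
  have lt' := h.lt'
  have f1 : (Q.src2 S₁.gen).firstLeft = 0 := by rw [Cell2.firstLeft, hXs]; rfl
  have f2 : (Q.src2 S₂.gen).firstLeft = 0 := by rw [Cell2.firstLeft, hYs]; rfl
  rw [show (Q.src2 S₁.gen).length = 2 from congrArg List.length hXs] at lt'
  rw [show (Q.src2 S₂.gen).length = 2 from congrArg List.length hYs] at lt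
  have h1 : S₁.lam.length ≠ S₂.lam.length + 1 := fun e => ha ⟨e, y, hy, by omega⟩
  have h2 : S₂.lam.length ≠ S₁.lam.length + 1 := fun e => ha' ⟨e, x, hx, by omega⟩
  have hlen : S₁.lam.length = S₂.lam.length := by omega
  obtain ⟨e1, e2, e3⟩ := h.branching.whisker_eq (p := 0) (q := 0) (by omega)
    (by rw [hXs]; rfl) (by rw [hYs]; rfl)
  obtain ⟨-, e2', e3'⟩ := h.branching.whisker_eq (p := 1) (q := 1) (by omega)
    (by rw [hXs]; rfl) (by rw [hYs]; rfl)
  have d1 := c1.dom_right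
  have d2 := c2.dom_right
  rw [← hx, Q.src2_X, x.cod_dom_source] at d1
  rw [← hy, Q.src2_X, y.cod_dom_source] at d2
  simp only [comp_one] at e1 e2 e3 e2' e3'
  rw [one_comp d1.symm, one_comp d2.symm] at e3'
  rw [← e3', ← e2'] at e3
  have em := comp_right_cancel (comp_right_cancel e3)
  have exy : x = y := by
    obtain ⟨a, m, b, _, _, _⟩ := x
    obtain ⟨a', m', b', _, _, _⟩ := y
    simp only at e2 e2' em
    subst e2 e2' em
    rfl
  obtain ⟨lam₁, l₁, A, r₁, rho₁⟩ := S₁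
  obtain ⟨lam₂, l₂, B, r₂, rho₂⟩ := S₂
  simp only at e1 e3' hx hy
  subst exy hx hy e1 e3'
  refine hne ?_
  have hs := h.branching.steps_eq
  simp only [List.append_assoc] at hs
  obtain ⟨hs1, hs2⟩ := List.append_inj hs hlen
  have hs3 := List.append_cancel_left hs2
  obtain rfl : lam₁ = lam₂ := by
    ext1
    · exact h.branching.dom_lam
    · exact hs1
  obtain rfl : rho₁ = rho₂ := by
    ext1
    · exact c1.dom_rho.symm.trans c2.dom_rho
    · exact hs3
  rfl

theorem IsCritical.isKnownStep (h : Q.IsCritical S₁ S₂) (hpos : ∀ A, 0 < (Q.src2 A).length) :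
    IsKnownStep S₁ ∧ IsKnownStep S₂ := by
  obtain ⟨ht, hne, h1, h2, h3, h4⟩ := (isCritical_iff hpos).1 h
  by_cases hA : Q.IsOperational S₁.gen <;> by_cases hB : Q.IsOperational S₂.gen
  · exact known_of_operational ht hpos hA hB
  · obtain ⟨x, hx⟩ := not_not.1 hB
    exact known_of_interchange ht hpos hA hx h1 h2
  · obtain ⟨x, hx⟩ := not_not.1 hA
    exact (known_of_interchange ht.symm hpos hB hx h3 h4).symm
  · obtain ⟨x, hx⟩ := not_not.1 hA
    obtain ⟨y, hy⟩ := not_not.1 hB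
    exact (not_both_interchange ht hne hx hy h2 h4).elim

end GrayPresentation

end GrayRewriting

namespace GrayRewriting

/-! ### Local branchings from overlapping factorizations -/

namespace Prepoly3

open Prepoly1 (Cell1)
open Prepoly2 (Cell2 Whisker)

variable {P : Prepoly3.{u}}

/-- An equality of lists of whiskers suffices, because all boundaries match automatically: the
whiskers of each remainder already form a path inside the other source, and a nonempty path fixes
its own endpoints. -/
theorem isLocalBranching_of_overlap {A₁ A₂ : P.G3} {l₁ r₁ l₂ r₂ : P.Cell1}
    {a t b₁ b₂ : List P.Whisker} (hl₁ : l₁.IsCell) (hr₁ : r₁.IsCell) (hl₂ : l₂.IsCell)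
    (hr₂ : r₂.IsCell) (hc₁ : l₁.cod = (P.src2 A₁).dom.dom) (hd₁ : (P.src2 A₁).dom.cod = r₁.dom)
    (hc₂ : l₂.cod = (P.src2 A₂).dom.dom) (hd₂ : (P.src2 A₂).dom.cod = r₂.dom)
    (ha : (l₁ ◁₂ P.src2 A₁ ▷₂ r₁).steps = a ++ t) (ht : t ≠ [])
    (hn : (l₂ ◁₂ P.src2 A₂ ▷₂ r₂).steps ≠ [])
    (hb : t ++ b₁ = (l₂ ◁₂ P.src2 A₂ ▷₂ r₂).steps ++ b₂) (h : b₁ = [] ∨ b₂ = []) :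
    P.IsLocalBranching
      ⟨⟨(l₁ ◁₂ P.src2 A₁ ▷₂ r₁).dom, []⟩, l₁, A₁, r₁, ⟨(l₁ ◁₂ P.src2 A₁ ▷₂ r₁).cod, b₁⟩⟩
      ⟨⟨(l₁ ◁₂ P.src2 A₁ ▷₂ r₁).dom, a⟩, l₂, A₂, r₂, ⟨(l₂ ◁₂ P.src2 A₂ ▷₂ r₂).cod, b₂⟩⟩ := by
  have cell₁ : (l₁ ◁₂ P.src2 A₁ ▷₂ r₁).IsCell := Step.isCell_core
    (S := ⟨Cell2.one l₁, l₁, A₁, r₁, Cell2.one l₁⟩) hl₁ hr₁ hc₁ hd₁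
  have cell₂ : (l₂ ◁₂ P.src2 A₂ ▷₂ r₂).IsCell := Step.isCell_core
    (S := ⟨Cell2.one l₂, l₂, A₂, r₂, Cell2.one l₂⟩) hl₂ hr₂ hc₂ hd₂
  have cod₁ : l₁ ⬝₀ (P.src2 A₁).cod ⬝₀ r₁ = (l₁ ◁₂ P.src2 A₁ ▷₂ r₁).cod := by
    rw [Cell2.cod_rwhisk, Cell2.cod_lwhisk]
  have cod₂ : l₂ ⬝₀ (P.src2 A₂).cod ⬝₀ r₂ = (l₂ ◁₂ P.src2 A₂ ▷₂ r₂).cod := by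
    rw [Cell2.cod_rwhisk, Cell2.cod_lwhisk]
  have dom₂ : l₂ ⬝₀ (P.src2 A₂).dom ⬝₀ r₂ = (l₂ ◁₂ P.src2 A₂ ▷₂ r₂).dom := rfl
  have dom₁ : l₁ ⬝₀ (P.src2 A₁).dom ⬝₀ r₁ = (l₁ ◁₂ P.src2 A₁ ▷₂ r₁).dom := rfl
  generalize hφ₁ : l₁ ◁₂ P.src2 A₁ ▷₂ r₁ = φ₁ at *
  generalize hφ₂ : l₂ ◁₂ P.src2 A₂ ▷₂ r₂ = φ₂ at *
  have p₁ := cell₁.2.2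
  have p₂ := cell₂.2.2
  have m₁ := cell₁.2.1
  have m₂ := cell₂.2.1
  rw [ha, isPath_append] at p₁
  have rho₁ : (⟨φ₁.cod, b₁⟩ : P.Cell2).IsCell := by
    rcases h with rfl | rfl
    · exact Cell2.isCell_one cell₁.isCell_cod
    · rw [List.append_nil] at hb
      refine ⟨cell₁.isCell_cod, fun w hw => m₂ w (by simp [← hb, hw]), ?_⟩
      rw [← hb, isPath_append] at p₂
      rw [Cell2.cod, ha, pathEnd_append, pathEnd_eq_of_ne_nil ht _ φ₂.dom]
      exact p₂.2
  have rho₂ : (⟨φ₂.cod, b₂⟩ : P.Cell2).IsCell := by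
    rcases h with rfl | rfl
    · rw [List.append_nil] at hb
      refine ⟨cell₂.isCell_cod, fun w hw => m₁ w (by simp [ha, hb, hw]), ?_⟩
      have := p₁.2
      rw [hb, isPath_append] at this
      rw [Cell2.cod, pathEnd_eq_of_ne_nil hn _ (pathEnd Whisker.tgt φ₁.dom a)]
      exact this.2
    · exact Cell2.isCell_one cell₂.isCell_cod
  have lam₂ : (⟨φ₁.dom, a⟩ : P.Cell2).IsCell :=
    ⟨cell₁.1, fun w hw => m₁ w (by simp [ha, hw]), p₁.1⟩
  -- Both sides are the source of the common first whisker of `t` and of `φ₂`.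
  have hcod : (⟨φ₁.dom, a⟩ : P.Cell2).cod = φ₂.dom := by
    obtain ⟨w, t, rfl⟩ := List.exists_cons_of_ne_nil ht
    obtain ⟨v, s, hs⟩ := List.exists_cons_of_ne_nil hn
    rw [hs] at hb p₂
    obtain rfl : w = v := by
      rw [List.cons_append, List.cons_append, List.cons.injEq] at hb
      exact hb.1
    exact p₁.2.1.symm.trans p₂.1
  refine ⟨⟨Cell2.isCell_one cell₁.1, hl₁, hr₁, rho₁, hc₁, hd₁, ?_, cod₁⟩,
    ⟨lam₂, hl₂, hr₂, rho₂, hc₂, hd₂, hcod.trans dom₂.symm, cod₂⟩, ?_⟩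
  · exact dom₁.symm
  · ext1
    · rfl
    · change [] ++ (l₁ ◁₂ P.src2 A₁ ▷₂ r₁).steps ++ b₁ =
        a ++ (l₂ ◁₂ P.src2 A₂ ▷₂ r₂).steps ++ b₂
      rw [hφ₁, hφ₂, ha, List.nil_append, List.append_assoc, hb, List.append_assoc]

end Prepoly3

/-! ### Codes with labels in arbitrary types -/

namespace Code

variable (V E T U : Type*)

abbrev Path := V × List (V × E × V)

abbrev Wh := Path V E × T × Path V E

abbrev Cell := Path V E × List (Wh V E T)

abbrev Gen := U ⊕ (T × Path V E × T)

abbrev RwStep := Cell V E T × Path V E × Gen V E T U × Path V E × Cell V E T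

abbrev Presentation := List (T × Path V E × Path V E) × List (U × Cell V E T × Cell V E T)

/-- A `3`-generator with its source and the target of its source. -/
abbrev Entry := Gen V E T U × Cell V E T × Path V E

/-- A `3`-generator in a horizontal context. -/
abbrev Placed := Path V E × Entry V E T U × Path V E

/-- Two `3`-generators in context, a factorization of the first source, and the two remaining
factors. -/
abbrev Candidate := (Placed V E T U × Placed V E T U) × (List (Wh V E T) × List (Wh V E T)) ×
  List (Wh V E T) × List (Wh V E T)

variable {V E T U}

def comp (f g : Path V E) : Path V E := (f.1, f.2 ++ g.2)

def cod (f : Path V E) : V := f.2.foldl (fun _ a => a.2.2) f.1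

def whisk (l r : Path V E) (w : Wh V E T) : Wh V E T := (comp l w.1, w.2.1, comp w.2.2 r)

/-- All factorizations of a list into two lists. -/
def splits {α : Type*} (l : List α) : List (List α × List α) :=
  (List.range (l.length + 1)).map fun i => (l.take i, l.drop i)

theorem mem_splits {α : Type*} {l : List α} {p : List α × List α} :
    p ∈ splits l ↔ l = p.1 ++ p.2 := by
  simp only [splits, List.mem_map, List.mem_range]
  constructor
  · rintro ⟨i, -, rfl⟩
    simp
  · intro h
    refine ⟨p.1.length, by simp [h], ?_⟩
    rw [h, List.take_left, List.drop_left]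

/-- A segment starts where the discarded prefix ends, hence `cod (f.1, p.1)`; empty segments are
included at every vertex of the path. -/
def factors (f : Path V E) : List (Path V E) :=
  (splits f.2).flatMap fun p => (splits p.2).map fun q => (cod (f.1, p.1), q.1)

def basePaths (c : Presentation V E T U) : List (Path V E) :=
  (c.1.flatMap fun x => [x.2.1, x.2.2]) ++
    c.2.flatMap fun x => x.2.1.2.flatMap fun w => [w.1, w.2.2]

def paths (c : Presentation V E T U) : List (Path V E) := (basePaths c).flatMap factors

/-- A list of at most one element, so that an empty source contributes nothing under `flatMap`. -/
def lastList {α : Type*} (l : List α) : List α := l.reverse.head?.toList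

-- The end of a source is not part of its code. It is the target of the last whisker, found by
-- looking up the generator of that whisker among the `2`-generators.
open Classical in
noncomputable def opEntries (c : Presentation V E T U) : List (Entry V E T U) :=
  c.2.flatMap fun x => (lastList x.2.1.2).flatMap fun w => c.1.flatMap fun α =>
    if w.2.1 = α.1 then [(.inl x.1, x.2.1, comp (comp w.1 α.2.2) w.2.2)] else []

/-- The entry of an interchange generator. -/
def interEntry (α β : T × Path V E × Path V E) (g : Path V E) : Entry V E T U :=
  (.inr (α.1, g, β.1),
    (comp α.2.1 (comp g β.2.1),
      [((α.2.1.1, []), α.1, comp g β.2.1), (comp α.2.2 g, β.1, (cod β.2.1, []))]),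
    comp (comp α.2.2 g) β.2.2)

-- The two tests are the composability conditions of an interchange index.
open Classical in
noncomputable def interEntries (c : Presentation V E T U) : List (Entry V E T U) :=
  c.1.flatMap fun α => c.1.flatMap fun β => (paths c).flatMap fun g =>
    if cod α.2.1 = g.1 ∧ cod g = β.2.1.1 then [interEntry α β g] else []

noncomputable def entries (c : Presentation V E T U) : List (Entry V E T U) :=
  opEntries c ++ interEntries c

open Classical in
noncomputable def placed (c : Presentation V E T U) : List (Placed V E T U) :=
  (paths c).flatMap fun l => (entries c).flatMap fun y => (paths c).flatMap fun r =>
    if cod l = y.2.1.1.1 ∧ cod y.2.1.1 = r.1 then [(l, y, r)] else []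

namespace Placed

def dom (p : Placed V E T U) : Path V E := comp (comp p.1 p.2.1.2.1.1) p.2.2

def cod (p : Placed V E T U) : Path V E := comp (comp p.1 p.2.1.2.2) p.2.2

def steps (p : Placed V E T U) : List (Wh V E T) := p.2.1.2.1.2.map (whisk p.1 p.2.2)

end Placed

/-- The first step starts at the top and the second after the prefix `a.1`. Of the two remainders
one is empty and the other is a tail of the opposite generator's source, so splittings reach all
cases. -/
def candidates (L : List (Placed V E T U)) : List (Candidate V E T U) :=
  L.flatMap fun p => L.flatMap fun q => (splits (Placed.steps p)).flatMap fun a =>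
    (splits (Placed.steps q)).flatMap fun b₁ => (splits a.2).map fun b₂ =>
      ((p, q), a, b₁.2, b₂.2)

/-- One more than the length of the middle path of an interchange generator. -/
def midBound (A : Gen V E T U) : ℕ := Sum.elim (fun _ => 0) (fun x => x.2.1.2.length + 1) A

/-- The numerical form of `IsNaturalBelow` for steps at positions `i` and `j`; the strict bound also
tests that `z` is an interchange generator. -/
def Below (i j : ℕ) (y z : Entry V E T U) : Prop :=
  j + 1 = i + y.2.1.2.length ∧ lastVal (fun w => w.2.2.2.length) y.2.1.2 < midBound z.1

def Above (i j : ℕ) (y z : Entry V E T U) : Prop :=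
  i = j + 1 ∧ firstVal (fun w => w.1.2.length) y.2.1.2 < midBound z.1

namespace Candidate

variable (z : Candidate V E T U)

def fst : Placed V E T U := z.1.1
def snd : Placed V E T U := z.1.2
def pre : List (Wh V E T) := z.2.1.1
def overlap : List (Wh V E T) := z.2.1.2
def rest₁ : List (Wh V E T) := z.2.2.1
def rest₂ : List (Wh V E T) := z.2.2.2

def branching : RwStep V E T U × RwStep V E T U :=
  ((((fst z).dom, []), (fst z).1, (fst z).2.1.1, (fst z).2.2, ((fst z).cod, rest₁ z)),
    (((fst z).dom, pre z), (snd z).1, (snd z).2.1.1, (snd z).2.2, ((snd z).cod, rest₂ z)))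

/-- Tightness with empty first `lam`, then distinctness and non-naturality. A nonempty overlap is
one of the two position inequalities; the other holds because sources have positive length. -/
def Valid : Prop :=
  overlap z ≠ [] ∧ overlap z ++ rest₁ z = (snd z).steps ++ rest₂ z ∧
    (rest₁ z = [] ∨ rest₂ z = []) ∧ ((fst z).1.2 = [] ∨ (snd z).1.2 = []) ∧
    ((fst z).2.2.2 = [] ∨ (snd z).2.2.2 = []) ∧
    (branching z).1 ≠ (branching z).2 ∧
    ¬ Below 0 (pre z).length (fst z).2.1 (snd z).2.1 ∧
    ¬ Above 0 (pre z).length (fst z).2.1 (snd z).2.1 ∧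
    ¬ Below (pre z).length 0 (snd z).2.1 (fst z).2.1 ∧
    ¬ Above (pre z).length 0 (snd z).2.1 (fst z).2.1

end Candidate

-- Only branchings whose first step has empty `lam`; the others arise by exchanging the two steps.
open Classical in
noncomputable def halfList (c : Presentation V E T U) :
    List (RwStep V E T U × RwStep V E T U) :=
  ((candidates (placed c)).filter fun z => Candidate.Valid z).map Candidate.branching

/-- The list of the codes of the critical branchings. -/
noncomputable def criticalList (c : Presentation V E T U) :
    List (RwStep V E T U × RwStep V E T U) :=
  halfList c ++ (halfList c).map Prod.swap

end Code

/-- Labels in arbitrary types of the generators of a Gray presentation. -/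
structure Labels (Q : GrayPresentation.{u}) (V E T U : Type*) where
  n0 : Q.G0 → V
  n1 : Q.G1 → E
  n2 : Q.G2 → T
  n3 : Q.G3 → U
  inj0 : Function.Injective n0
  inj1 : Function.Injective n1
  inj2 : Function.Injective n2
  inj3 : Set.InjOn n3 {A | Q.IsOperational A}

namespace Labels

open Prepoly1 (Cell1)
open Prepoly2 (Cell2 Whisker)
open Prepoly3 GrayPresentation

variable {Q : GrayPresentation.{u}} {V E T U : Type*} (e : Labels Q V E T U)

def edge (a : Q.G1) : V × E × V := (e.n0 (Q.src0 a), e.n1 a, e.n0 (Q.tgt0 a))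

def path (f : Q.Cell1) : Code.Path V E := (e.n0 f.dom, f.word.map e.edge)

def wh (w : Q.Whisker) : Code.Wh V E T := (e.path w.left, e.n2 w.gen, e.path w.right)

def cell (φ : Q.Cell2) : Code.Cell V E T := (e.path φ.dom, φ.steps.map e.wh)

def CodesGen (A : Q.G3) (c : Code.Gen V E T U) : Prop :=
  (Q.IsOperational A ∧ c = .inl (e.n3 A)) ∨
    ∃ x, Q.X x = A ∧ c = .inr (e.n2 x.fst, e.path x.mid, e.n2 x.snd)

def CodesStep (S : Q.Step) (c : Code.RwStep V E T U) : Prop :=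
  ∃ d, e.CodesGen S.gen d ∧
    c = (e.cell S.lam, e.path S.left, d, e.path S.right, e.cell S.rho)

def Describes (c : Code.Presentation V E T U) : Prop :=
  (∀ x, x ∈ c.1 ↔ ∃ α, x = (e.n2 α, e.path (Q.src1 α), e.path (Q.tgt1 α))) ∧
  (∀ x, x ∈ c.2 ↔
    ∃ A, Q.IsOperational A ∧ x = (e.n3 A, e.cell (Q.src2 A), e.cell (Q.tgt2 A)))

def CodesEntry (A : Q.G3) (y : Code.Entry V E T U) : Prop :=
  e.CodesGen A y.1 ∧ y.2.1 = e.cell (Q.src2 A) ∧ y.2.2 = e.path (Q.src2 A).cod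

theorem edge_injective : Function.Injective e.edge := fun _ _ h =>
  e.inj1 (congrArg (fun x => x.2.1) h)

theorem path_injective : Function.Injective e.path := by
  intro f g h
  ext1
  · exact e.inj0 (congrArg Prod.fst h)
  · exact List.map_injective_iff.2 e.edge_injective (congrArg Prod.snd h)

theorem wh_injective : Function.Injective e.wh := by
  intro f g h
  ext1
  · exact e.path_injective (congrArg Prod.fst h)
  · exact e.inj2 (congrArg (fun x => x.2.1) h)
  · exact e.path_injective (congrArg (fun x => x.2.2) h)

theorem cell_injective : Function.Injective e.cell := by
  intro f g h
  ext1
  · exact e.path_injective (congrArg Prod.fst h)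
  · exact List.map_injective_iff.2 e.wh_injective (congrArg Prod.snd h)

theorem codesGen_injective {A B : Q.G3} {c : Code.Gen V E T U} (hA : e.CodesGen A c)
    (hB : e.CodesGen B c) : A = B := by
  rcases hA with ⟨hA, rfl⟩ | ⟨x, rfl, rfl⟩ <;> rcases hB with ⟨hB, h⟩ | ⟨y, rfl, h⟩
  · exact e.inj3 hA hB (by simpa using h)
  · simp at h
  · simp at h
  · obtain ⟨a, m, b, _, _, _⟩ := x
    obtain ⟨a', m', b', _, _, _⟩ := y
    simp only [Sum.inr.injEq, Prod.mk.injEq] at h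
    obtain rfl := e.inj2 h.1
    obtain rfl := e.path_injective h.2.1
    obtain rfl := e.inj2 h.2.2
    rfl

theorem exists_codesGen (A : Q.G3) : ∃ c, e.CodesGen A c := by
  by_cases h : Q.IsOperational A
  · exact ⟨_, .inl ⟨h, rfl⟩⟩
  · obtain ⟨x, hx⟩ := not_not.1 h
    exact ⟨_, .inr ⟨x, hx, rfl⟩⟩

theorem codesGen_unique {A : Q.G3} {c d : Code.Gen V E T U} (hc : e.CodesGen A c)
    (hd : e.CodesGen A d) : c = d := by
  rcases hc with ⟨hA, rfl⟩ | ⟨x, rfl, rfl⟩ <;> rcases hd with ⟨hB, rfl⟩ | ⟨y, h, rfl⟩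
  · rfl
  · exact (hA ⟨y, h⟩).elim
  · exact (hB ⟨x, rfl⟩).elim
  · rw [X_injective h]

theorem codesStep_injective {S S' : Q.Step} {c : Code.RwStep V E T U} (h : e.CodesStep S c)
    (h' : e.CodesStep S' c) : S = S' := by
  obtain ⟨d, hd, rfl⟩ := h
  obtain ⟨d', hd', h⟩ := h'
  simp only [Prod.mk.injEq] at h
  obtain ⟨h1, h2, rfl, h4, h5⟩ := h
  ext1
  · exact e.cell_injective h1
  · exact e.path_injective h2
  · exact e.codesGen_injective hd hd'
  · exact e.path_injective h4
  · exact e.cell_injective h5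

/-- Since the bound is `0` on operational generators and one more than the length otherwise, a
single strict inequality expresses both requirements. -/
theorem lt_midBound {A : Q.G3} {c : Code.Gen V E T U} (h : e.CodesGen A c) (n : ℕ) :
    n < Code.midBound c ↔ ∃ x, Q.X x = A ∧ n ≤ x.mid.word.length := by
  rcases h with ⟨hA, rfl⟩ | ⟨x, rfl, rfl⟩
  · refine ⟨fun h => absurd h (Nat.not_lt_zero n), ?_⟩
    rintro ⟨x, hx, -⟩
    exact (hA ⟨x, hx⟩).elim
  · simp only [Code.midBound, Sum.elim_inr, path, List.length_map, Nat.lt_succ_iff]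
    refine ⟨fun h => ⟨x, rfl, h⟩, ?_⟩
    rintro ⟨y, hy, h⟩
    rwa [← X_injective hy]

theorem path_comp (f g : Q.Cell1) : e.path (f ⬝₀ g) = Code.comp (e.path f) (e.path g) := by
  simp [path, Code.comp]

theorem cod_path (f : Q.Cell1) : Code.cod (e.path f) = e.n0 f.cod := by
  unfold Code.cod path Prepoly1.Cell1.cod
  generalize f.dom = x
  generalize f.word = l
  induction l generalizing x with
  | nil => rfl
  | cons a l ih => exact ih _

theorem path_one (x : Q.G0) : e.path (Cell1.one x) = (e.n0 x, []) := rfl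

theorem wh_whisk (l r : Q.Cell1) (w : Q.Whisker) :
    e.wh ((w.lwhisk l).rwhisk r) = Code.whisk (e.path l) (e.path r) (e.wh w) := by
  simp [wh, Code.whisk, path_comp]

theorem lastRight_cell (φ : Q.Cell2) :
    lastVal (fun w : Code.Wh V E T => w.2.2.2.length) (e.cell φ).2 = φ.lastRight := by
  simp [cell, lastVal_map, Cell2.lastRight, wh, path]

theorem firstLeft_cell (φ : Q.Cell2) :
    firstVal (fun w : Code.Wh V E T => w.1.2.length) (e.cell φ).2 = φ.firstLeft := by
  simp [cell, firstVal_map, Cell2.firstLeft, wh, path]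

theorem length_cell (φ : Q.Cell2) : (e.cell φ).2.length = φ.length := by
  simp [cell, Cell2.length]

end Labels

end GrayRewriting

/-! ### Correctness of the enumeration, and finiteness -/

namespace GrayRewriting

namespace Prepoly1.Cell1

variable {P : Prepoly1.{u}}

theorem IsFactor.isCell {f g : P.Cell1} (h : f.IsFactor g) (hg : g.IsCell) : f.IsCell := by
  obtain ⟨a, b, h1, h2⟩ := h
  unfold IsCell at *
  rw [h1, isPath_append, isPath_append] at hg
  rw [h2]
  exact hg.1.2

end Prepoly1.Cell1

namespace GrayPresentation

variable {Q : GrayPresentation.{u}}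

theorem IsKnown.isCell {f : Q.Cell1} (h : IsKnown f) : f.IsCell := by
  obtain ⟨g, hg, hf⟩ := h
  refine hf.isCell ?_
  rcases hg with ⟨α, rfl | rfl⟩ | ⟨A, -, w, hw, rfl | rfl⟩
  · exact Q.isCell_src1 α
  · exact Q.isCell_tgt1 α
  · exact ((Q.isCell_src2 A).2.1 w hw).1
  · exact ((Q.isCell_src2 A).2.1 w hw).2.1

end GrayPresentation

namespace Labels

open Prepoly1 (Cell1)
open Prepoly2 (Cell2 Whisker)
open Prepoly3 GrayPresentation

variable {Q : GrayPresentation.{u}} {V E T U : Type*} (e : Labels Q V E T U)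

theorem codesStep_unique {S : Q.Step} {c d : Code.RwStep V E T U} (hc : e.CodesStep S c)
    (hd : e.CodesStep S d) : c = d := by
  obtain ⟨x, hx, rfl⟩ := hc
  obtain ⟨y, hy, rfl⟩ := hd
  rw [e.codesGen_unique hx hy]

theorem exists_codesStep (S : Q.Step) : ∃ c, e.CodesStep S c := by
  obtain ⟨d, hd⟩ := e.exists_codesGen S.gen
  exact ⟨_, d, hd, rfl⟩

theorem mem_factors {g : Q.Cell1} {x : Code.Path V E} :
    x ∈ Code.factors (e.path g) ↔ ∃ f : Q.Cell1, f.IsFactor g ∧ x = e.path f := by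
  simp only [Code.factors, List.mem_flatMap, List.mem_map, Code.mem_splits]
  constructor
  · rintro ⟨⟨a', k⟩, h1, ⟨b', c'⟩, h2, rfl⟩
    simp only at h1 h2
    subst h2
    obtain ⟨a, s, h, rfl, hs⟩ := List.map_eq_append_iff.1 h1
    obtain ⟨b, c, rfl, rfl, rfl⟩ := List.map_eq_append_iff.1 hs
    refine ⟨⟨pathEnd Q.tgt0 g.dom a, b⟩, ⟨a, c, by simpa using h, rfl⟩, ?_⟩
    exact Prod.ext (e.cod_path ⟨g.dom, a⟩) rfl
  · rintro ⟨f, ⟨a, b, h1, h2⟩, rfl⟩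
    refine ⟨(a.map e.edge, (f.word ++ b).map e.edge), by simp [path, h1],
      (f.word.map e.edge, b.map e.edge), by simp, ?_⟩
    refine Prod.ext ((e.cod_path ⟨g.dom, a⟩).trans ?_) rfl
    exact congrArg e.n0 h2.symm

variable {e} {c : Code.Presentation V E T U}

theorem mem_basePaths (h : e.Describes c) {x : Code.Path V E} :
    x ∈ Code.basePaths c ↔ ∃ g : Q.Cell1, IsBase g ∧ x = e.path g := by
  simp only [Code.basePaths, List.mem_append, List.mem_flatMap, h.1, h.2]
  constructor
  · rintro (⟨_, ⟨α, rfl⟩, hx⟩ | ⟨_, ⟨A, hA, rfl⟩, _, hw, hx⟩)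
    · rcases List.mem_pair.1 hx with rfl | rfl
      · exact ⟨_, .inl ⟨α, .inl rfl⟩, rfl⟩
      · exact ⟨_, .inl ⟨α, .inr rfl⟩, rfl⟩
    · obtain ⟨w, hw', rfl⟩ := List.mem_map.1 hw
      rcases List.mem_pair.1 hx with rfl | rfl
      · exact ⟨_, .inr ⟨A, hA, w, hw', .inl rfl⟩, rfl⟩
      · exact ⟨_, .inr ⟨A, hA, w, hw', .inr rfl⟩, rfl⟩
  · rintro ⟨g, ⟨α, rfl | rfl⟩ | ⟨A, hA, w, hw, rfl | rfl⟩, rfl⟩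
    · exact .inl ⟨_, ⟨α, rfl⟩, by simp⟩
    · exact .inl ⟨_, ⟨α, rfl⟩, by simp⟩
    · exact .inr ⟨_, ⟨A, hA, rfl⟩, _, List.mem_map_of_mem hw, by simp [wh]⟩
    · exact .inr ⟨_, ⟨A, hA, rfl⟩, _, List.mem_map_of_mem hw, by simp [wh]⟩

theorem mem_paths (h : e.Describes c) {x : Code.Path V E} :
    x ∈ Code.paths c ↔ ∃ f : Q.Cell1, IsKnown f ∧ x = e.path f := by
  simp only [Code.paths, List.mem_flatMap, mem_basePaths h]
  constructor
  · rintro ⟨_, ⟨g, hg, rfl⟩, hx⟩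
    obtain ⟨f, hf, rfl⟩ := e.mem_factors.1 hx
    exact ⟨f, ⟨g, hg, hf⟩, rfl⟩
  · rintro ⟨f, ⟨g, hg, hf⟩, rfl⟩
    exact ⟨_, ⟨g, hg, rfl⟩, e.mem_factors.2 ⟨f, hf, rfl⟩⟩

theorem mem_opEntries (h : e.Describes c) (hpos : ∀ A, 0 < (Q.src2 A).length)
    {y : Code.Entry V E T U} :
    y ∈ Code.opEntries c ↔ ∃ A, Q.IsOperational A ∧ e.CodesEntry A y := by
  -- Positive length provides a last whisker, whose target is the codomain of the source.
  have key : ∀ A : Q.G3, ∃ w, Code.lastList (e.cell (Q.src2 A)).2 = [e.wh w] ∧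
      (Q.src2 A).cod = w.tgt := by
    intro A
    obtain ⟨as, w, hw⟩ := (List.eq_nil_or_concat' _).resolve_left
      (List.ne_nil_of_length_pos (hpos A))
    refine ⟨w, by simp [Code.lastList, cell, hw], ?_⟩
    rw [Cell2.cod, hw, pathEnd_append]
    rfl
  have hcod : ∀ w : Q.Whisker, Code.comp (Code.comp (e.path w.left) (e.path (Q.tgt1 w.gen)))
      (e.path w.right) = e.path w.tgt := by
    intro w
    rw [← path_comp, ← path_comp]
    rfl
  simp only [Code.opEntries, List.mem_flatMap, h.1, h.2]
  constructor
  · rintro ⟨_, ⟨A, hA, rfl⟩, w', hw', _, ⟨α, rfl⟩, hy⟩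
    obtain ⟨w, hw, hc⟩ := key A
    simp only [hw, List.mem_singleton] at hw'
    subst hw'
    split_ifs at hy with hg
    · obtain rfl : w.gen = α := e.inj2 hg
      rw [List.mem_singleton] at hy
      subst hy
      refine ⟨A, hA, .inl ⟨hA, rfl⟩, rfl, ?_⟩
      rw [hc]
      exact hcod w
    · simp at hy
  · rintro ⟨A, hA, h1, h2, h3⟩
    obtain ⟨w, hw, hc⟩ := key A
    refine ⟨_, ⟨A, hA, rfl⟩, e.wh w, by simp [hw], _, ⟨w.gen, rfl⟩, ?_⟩
    rw [if_pos (by rfl), List.mem_singleton]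
    refine Prod.ext (e.codesGen_unique h1 (.inl ⟨hA, rfl⟩)) (Prod.ext h2 ?_)
    rw [h3, hc]
    exact (hcod w).symm

theorem codesEntry_interEntry (x : Q.InterchangeIndex) :
    e.CodesEntry (Q.X x) (Code.interEntry
      (e.n2 x.fst, e.path (Q.src1 x.fst), e.path (Q.tgt1 x.fst))
      (e.n2 x.snd, e.path (Q.src1 x.snd), e.path (Q.tgt1 x.snd)) (e.path x.mid)) := by
  refine ⟨.inr ⟨x, rfl, rfl⟩, ?_, ?_⟩
  · rw [Q.src2_X]
    refine Prod.ext ?_ ?_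
    · simp [Code.interEntry, cell, Prepoly2.InterchangeIndex.dom_source, path_comp]
    · have hp : ∀ f : Q.Cell1, (e.path f).1 = e.n0 f.dom := fun _ => rfl
      simp [Code.interEntry, cell, Prepoly2.InterchangeIndex.steps_source, path_comp, wh, cod_path,
        path_one, hp]
  · rw [Q.src2_X]
    simp [Code.interEntry, Prepoly2.InterchangeIndex.cod_source, path_comp]

theorem codesEntry_unique {A : Q.G3} {y z : Code.Entry V E T U} (hy : e.CodesEntry A y)
    (hz : e.CodesEntry A z) : y = z :=
  Prod.ext (e.codesGen_unique hy.1 hz.1)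
    (Prod.ext (hy.2.1.trans hz.2.1.symm) (hy.2.2.trans hz.2.2.symm))

theorem exists_codesEntry (e : Labels Q V E T U) (A : Q.G3) : ∃ y, e.CodesEntry A y := by
  obtain ⟨d, hd⟩ := e.exists_codesGen A
  exact ⟨(d, _, _), hd, rfl, rfl⟩

theorem mem_interEntries (h : e.Describes c) {y : Code.Entry V E T U} :
    y ∈ Code.interEntries c ↔
      ∃ x : Q.InterchangeIndex, IsKnown x.mid ∧ e.CodesEntry (Q.X x) y := by
  simp only [Code.interEntries, List.mem_flatMap, h.1, mem_paths h]
  constructor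
  · rintro ⟨_, ⟨α, rfl⟩, _, ⟨β, rfl⟩, _, ⟨g, hg, rfl⟩, hy⟩
    split_ifs at hy with hc
    · rw [List.mem_singleton] at hy
      subst hy
      rw [cod_path, cod_path] at hc
      exact ⟨⟨α, g, β, hg.isCell, e.inj0 hc.1, e.inj0 hc.2⟩, hg, codesEntry_interEntry _⟩
    · simp at hy
  · rintro ⟨x, hx, hy⟩
    refine ⟨_, ⟨x.fst, rfl⟩, _, ⟨x.snd, rfl⟩, _, ⟨x.mid, hx, rfl⟩, ?_⟩
    rw [if_pos, List.mem_singleton]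
    · exact codesEntry_unique hy (codesEntry_interEntry x)
    · rw [cod_path, cod_path]
      exact ⟨congrArg e.n0 x.fst_mid, congrArg e.n0 x.mid_snd⟩

theorem mem_entries (h : e.Describes c) (hpos : ∀ A, 0 < (Q.src2 A).length)
    {y : Code.Entry V E T U} :
    y ∈ Code.entries c ↔ ∃ A, IsKnownGen A ∧ e.CodesEntry A y := by
  rw [Code.entries, List.mem_append, mem_opEntries h hpos, mem_interEntries h]
  constructor
  · rintro (⟨A, hA, hy⟩ | ⟨x, hx, hy⟩)
    · exact ⟨A, .inl hA, hy⟩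
    · exact ⟨_, .inr ⟨x, rfl, hx⟩, hy⟩
  · rintro ⟨A, hA | ⟨x, rfl, hx⟩, hy⟩
    · exact .inl ⟨A, hA, hy⟩
    · exact .inr ⟨x, hx, hy⟩

/-- The generator `A` in the context `l`, `r` is coded by `p`. -/
structure CodesPlaced (e : Labels Q V E T U) (l : Q.Cell1) (A : Q.G3) (r : Q.Cell1)
    (p : Code.Placed V E T U) : Prop where
  left : p.1 = e.path l
  entry : e.CodesEntry A p.2.1
  right : p.2.2 = e.path r

theorem mem_placed (h : e.Describes c) (hpos : ∀ A, 0 < (Q.src2 A).length)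
    {p : Code.Placed V E T U} :
    p ∈ Code.placed c ↔ ∃ l A r, (IsKnown l ∧ IsKnownGen A ∧ IsKnown r) ∧
      (l.cod = (Q.src2 A).dom.dom ∧ (Q.src2 A).dom.cod = r.dom) ∧ e.CodesPlaced l A r p := by
  simp only [Code.placed, List.mem_flatMap, mem_entries h hpos, mem_paths h]
  constructor
  · rintro ⟨_, ⟨l, hl, rfl⟩, y, ⟨A, hA, hy⟩, _, ⟨r, hr, rfl⟩, hp⟩
    split_ifs at hp with hc
    · rw [List.mem_singleton] at hp
      subst hp
      rw [hy.2.1, cod_path] at hc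
      refine ⟨l, A, r, ⟨hl, hA, hr⟩, ⟨e.inj0 hc.1, e.inj0 ?_⟩, rfl, hy, rfl⟩
      rw [← cod_path]
      exact hc.2
    · simp at hp
  · rintro ⟨l, A, r, ⟨hl, hA, hr⟩, ⟨h1, h2⟩, hp⟩
    refine ⟨_, ⟨l, hl, rfl⟩, p.2.1, ⟨A, hA, hp.entry⟩, _, ⟨r, hr, rfl⟩, ?_⟩
    rw [if_pos, List.mem_singleton, ← hp.left, ← hp.right]
    rw [hp.entry.2.1, cod_path, h1]
    refine ⟨rfl, ?_⟩
    change Code.cod (e.path _) = _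
    rw [cod_path, h2]
    rfl

namespace CodesPlaced

variable {l r : Q.Cell1} {A : Q.G3} {p : Code.Placed V E T U}

theorem steps (h : e.CodesPlaced l A r p) :
    Code.Placed.steps p = (l ◁₂ Q.src2 A ▷₂ r).steps.map e.wh := by
  rw [Code.Placed.steps, h.left, h.right, h.entry.2.1]
  simp [cell, Function.comp_def, wh_whisk]

theorem dom (h : e.CodesPlaced l A r p) :
    Code.Placed.dom p = e.path (l ◁₂ Q.src2 A ▷₂ r).dom := by
  rw [Code.Placed.dom, h.left, h.right, h.entry.2.1]
  simp [cell, path_comp]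

theorem cod (h : e.CodesPlaced l A r p) :
    Code.Placed.cod p = e.path (l ◁₂ Q.src2 A ▷₂ r).cod := by
  rw [Code.Placed.cod, h.left, h.right, h.entry.2.2]
  simp [path_comp, Cell2.cod_lwhisk, Cell2.cod_rwhisk]

end CodesPlaced

theorem below_iff {S₁ S₂ : Q.Step} {y z : Code.Entry V E T U} (hy : e.CodesEntry S₁.gen y)
    (hz : e.CodesEntry S₂.gen z) :
    Code.Below S₁.lam.length S₂.lam.length y z ↔ IsNaturalBelow S₁ S₂ := by
  rw [Code.Below, hy.2.1, length_cell, lastRight_cell, e.lt_midBound hz.1]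
  rfl

theorem above_iff {S₁ S₂ : Q.Step} {y z : Code.Entry V E T U} (hy : e.CodesEntry S₁.gen y)
    (hz : e.CodesEntry S₂.gen z) :
    Code.Above S₁.lam.length S₂.lam.length y z ↔ IsNaturalAbove S₁ S₂ := by
  rw [Code.Above, hy.2.1, firstLeft_cell, e.lt_midBound hz.1]
  rfl

theorem mem_candidates {L : List (Code.Placed V E T U)} {z : Code.Candidate V E T U} :
    z ∈ Code.candidates L ↔ z.1.1 ∈ L ∧ z.1.2 ∈ L ∧
      Code.Placed.steps z.1.1 = z.2.1.1 ++ z.2.1.2 ∧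
      (∃ s, Code.Placed.steps z.1.2 = s ++ z.2.2.1) ∧ ∃ s, z.2.1.2 = s ++ z.2.2.2 := by
  simp only [Code.candidates, List.mem_flatMap, List.mem_map, Code.mem_splits]
  constructor
  · rintro ⟨p, hp, q, hq, a, ha, b₁, hb₁, b₂, hb₂, rfl⟩
    exact ⟨hp, hq, ha, ⟨_, hb₁⟩, ⟨_, hb₂⟩⟩
  · rintro ⟨hp, hq, ha, ⟨s, hs⟩, ⟨s', hs'⟩⟩
    exact ⟨_, hp, _, hq, _, ha, (s, _), hs, (s', _), hs', rfl⟩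

/-- A candidate decodes to a local branching by `isLocalBranching_of_overlap`, and validity
translates into `isCritical_iff`. Conversely `IsCritical.isKnownStep` puts both generators and their
contexts into the search space. -/
theorem mem_halfList (h : e.Describes c) (hpos : ∀ A, 0 < (Q.src2 A).length)
    {b : Code.RwStep V E T U × Code.RwStep V E T U} :
    b ∈ Code.halfList c ↔ ∃ S₁ S₂ : Q.Step, Q.IsCritical S₁ S₂ ∧ S₁.lam.steps = [] ∧
      e.CodesStep S₁ b.1 ∧ e.CodesStep S₂ b.2 := by
  simp only [Code.halfList, List.mem_map, List.mem_filter, mem_candidates, decide_eq_true_eq,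
    mem_placed h hpos]
  constructor
  · rintro ⟨⟨⟨p, q⟩, ⟨a', t'⟩, b₁', b₂'⟩, ⟨⟨⟨l₁, A₁, r₁, ⟨kl₁, -, kr₁⟩, ⟨hc₁, hd₁⟩, hp⟩,
      ⟨l₂, A₂, r₂, ⟨kl₂, -, kr₂⟩, ⟨hc₂, hd₂⟩, hq⟩, ha, ⟨s, hs⟩, ⟨s', hs'⟩⟩, hv⟩, rfl⟩
    simp only at hp hq ha hs hs'
    rw [hp.steps] at ha
    obtain ⟨a, t, ha', rfl, rfl⟩ := List.map_eq_append_iff.1 ha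
    rw [hq.steps] at hs
    obtain ⟨-, b₁, -, -, rfl⟩ := List.map_eq_append_iff.1 hs
    obtain ⟨-, b₂, -, -, rfl⟩ := List.map_eq_append_iff.1 hs'
    obtain ⟨v1, v2, v3, v4, v5, v6, v7, v8, v9, v10⟩ := hv
    simp only [Code.Candidate.overlap, Code.Candidate.rest₁, Code.Candidate.rest₂,
      Code.Candidate.fst, Code.Candidate.snd, Code.Candidate.pre,
      hp.left, hq.left, hp.right, hq.right, hq.steps, path,
      ← List.map_append, ne_eq, List.map_eq_nil_iff, List.length_map] at v1 v2 v3 v4 v5 v7 v8 v9 v10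
    have hn : (l₂ ◁₂ Q.src2 A₂ ▷₂ r₂).steps ≠ [] := by
      simpa using List.ne_nil_of_length_pos (hpos A₂)
    have hb := isLocalBranching_of_overlap kl₁.isCell kr₁.isCell kl₂.isCell kr₂.isCell hc₁ hd₁ hc₂
      hd₂ ha' v1 hn (List.map_injective_iff.2 e.wh_injective v2) v3
    have k₁ : e.CodesStep ⟨⟨(l₁ ◁₂ Q.src2 A₁ ▷₂ r₁).dom, []⟩, l₁, A₁, r₁,
        ⟨(l₁ ◁₂ Q.src2 A₁ ▷₂ r₁).cod, b₁⟩⟩ (Code.Candidate.branching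
        ((p, q), (a.map e.wh, t.map e.wh), b₁.map e.wh, b₂.map e.wh)).1 := by
      refine ⟨p.2.1.1, hp.entry.1, ?_⟩
      simp only [Code.Candidate.branching, Code.Candidate.fst, Code.Candidate.rest₁, hp.dom, hp.cod,
        hp.left, hp.right]
      rfl
    have k₂ : e.CodesStep ⟨⟨(l₁ ◁₂ Q.src2 A₁ ▷₂ r₁).dom, a⟩, l₂, A₂, r₂,
        ⟨(l₂ ◁₂ Q.src2 A₂ ▷₂ r₂).cod, b₂⟩⟩ (Code.Candidate.branching
        ((p, q), (a.map e.wh, t.map e.wh), b₁.map e.wh, b₂.map e.wh)).2 := by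
      refine ⟨q.2.1.1, hq.entry.1, ?_⟩
      simp only [Code.Candidate.branching, Code.Candidate.fst, Code.Candidate.snd,
        Code.Candidate.pre, Code.Candidate.rest₂, hp.dom, hq.cod, hq.left, hq.right]
      rfl
    refine ⟨_, _, (isCritical_iff hpos).2 ⟨⟨hb, .inl rfl, v3, v4, v5, ?_, ?_⟩, ?_, ?_, ?_, ?_, ?_⟩,
      rfl, k₁, k₂⟩
    · have := hpos A₂
      simp only [Cell2.length, List.length_nil] at this ⊢
      omega
    · have := congrArg List.length ha'
      simp only [Cell2.steps_rwhisk, Cell2.steps_lwhisk, List.length_map, List.length_append] at this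
      have h0 := List.length_pos_iff.2 v1
      simp only [Cell2.length, List.length_nil]
      omega
    · intro heq
      rw [heq] at k₁
      exact v6 (e.codesStep_unique k₁ k₂)
    · exact fun hB => v7 ((below_iff (S₁ := ⟨_, _, _, _, _⟩) (S₂ := ⟨_, _, _, _, _⟩)
        hp.entry hq.entry).2 hB)
    · exact fun hB => v8 ((above_iff (S₁ := ⟨_, _, _, _, _⟩) (S₂ := ⟨_, _, _, _, _⟩)
        hp.entry hq.entry).2 hB)
    · exact fun hB => v9 ((below_iff (S₁ := ⟨_, _, _, _, _⟩) (S₂ := ⟨_, _, _, _, _⟩)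
        hq.entry hp.entry).2 hB)
    · exact fun hB => v10 ((above_iff (S₁ := ⟨_, _, _, _, _⟩) (S₂ := ⟨_, _, _, _, _⟩)
        hq.entry hp.entry).2 hB)
  · rintro ⟨S₁, S₂, hcrit, hlam, k₁, k₂⟩
    obtain ⟨kn₁, kn₂⟩ := hcrit.isKnownStep hpos
    obtain ⟨ht, hne, h1, h2, h3, h4⟩ := (isCritical_iff hpos).1 hcrit
    have c₁ := ht.branching.1
    have c₂ := ht.branching.2.1
    obtain ⟨y₁, hy₁⟩ := e.exists_codesEntry S₁.gen
    obtain ⟨y₂, hy₂⟩ := e.exists_codesEntry S₂.gen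
    have hp : e.CodesPlaced S₁.left S₁.gen S₁.right (e.path S₁.left, y₁, e.path S₁.right) :=
      ⟨rfl, hy₁, rfl⟩
    have hq : e.CodesPlaced S₂.left S₂.gen S₂.right (e.path S₂.left, y₂, e.path S₂.right) :=
      ⟨rfl, hy₂, rfl⟩
    have hs := ht.branching.steps_eq
    rw [hlam, List.nil_append, List.append_assoc] at hs
    have hlt : S₂.lam.steps.length < S₁.core.steps.length := by
      have := ht.lt'
      rw [Step.length_steps_core]
      simpa [Cell2.length, hlam] using this
    obtain ⟨t, ht1, ht2⟩ : ∃ t, S₁.core.steps = S₂.lam.steps ++ t ∧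
        t ++ S₁.rho.steps = S₂.core.steps ++ S₂.rho.steps := by
      rcases List.append_eq_append_iff.1 hs with ⟨t, ht1, ht2⟩ | ⟨t, ht1, ht2⟩
      · have := congrArg List.length ht1
        simp only [List.length_append] at this
        omega
      · exact ⟨t, ht1, ht2.symm⟩
    have ht0 : t ≠ [] := by
      rintro rfl
      rw [ht1, List.append_nil] at hlt
      exact lt_irrefl _ hlt
    have hd : S₁.lam.dom = S₁.core.dom := by
      rw [← c₁.cod_lam]
      simp [Cell2.cod, hlam, pathEnd]
    -- The empty remainder is trivially a tail, and the equation `ht2` exhibits the other one as a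
    -- tail.
    have hsuf : (∃ s, S₂.core.steps = s ++ S₁.rho.steps) ∧ ∃ s, t = s ++ S₂.rho.steps := by
      rcases ht.rho with h0 | h0
      · rw [h0, List.append_nil] at ht2
        exact ⟨⟨S₂.core.steps, by simp [h0]⟩, ⟨_, ht2⟩⟩
      · rw [h0, List.append_nil] at ht2
        exact ⟨⟨_, ht2.symm⟩, ⟨t, by simp [h0]⟩⟩
    obtain ⟨⟨s, hs⟩, ⟨s', hs'⟩⟩ := hsuf
    have hbr : Code.Candidate.branching (((e.path S₁.left, y₁, e.path S₁.right),
        (e.path S₂.left, y₂, e.path S₂.right)), (S₂.lam.steps.map e.wh, t.map e.wh),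
        S₁.rho.steps.map e.wh, S₂.rho.steps.map e.wh) = b := by
      refine Prod.ext (e.codesStep_unique ⟨y₁.1, hy₁.1, ?_⟩ k₁)
        (e.codesStep_unique ⟨y₂.1, hy₂.1, ?_⟩ k₂)
      · simp only [Code.Candidate.branching, Code.Candidate.fst, Code.Candidate.rest₁, hp.dom,
          hp.cod, cell, hlam, List.map_nil, hd, ← c₁.dom_rho]
        rfl
      · simp only [Code.Candidate.branching, Code.Candidate.fst, Code.Candidate.snd,
          Code.Candidate.pre, Code.Candidate.rest₂, hp.dom, hq.cod, cell, ← ht.branching.dom_lam, hd,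
          ← c₂.dom_rho]
        rfl
    have hl0 : S₁.lam.length = 0 := by simp [Cell2.length, hlam]
    refine ⟨_, ⟨⟨⟨_, _, _, kn₁, ⟨c₁.cod_left, c₁.dom_right⟩, hp⟩,
      ⟨_, _, _, kn₂, ⟨c₂.cod_left, c₂.dom_right⟩, hq⟩, ?_, ⟨s.map e.wh, ?_⟩, ⟨s'.map e.wh, ?_⟩⟩, ?_⟩,
      hbr⟩
    · simp only [hp.steps]
      rw [← List.map_append, ← ht1]
      rfl
    · simp only [hq.steps]
      rw [← List.map_append, ← hs]
      rfl
    · rw [← List.map_append, ← hs']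
    · have hlm : (S₂.lam.steps.map e.wh).length = S₂.lam.length := by simp [Cell2.length]
      refine ⟨?_, ?_, ?_, ?_, ?_, ?_, ?_, ?_, ?_, ?_⟩
      · simpa [Code.Candidate.overlap] using ht0
      · simp only [Code.Candidate.overlap, Code.Candidate.rest₁, Code.Candidate.rest₂,
          Code.Candidate.snd, hq.steps]
        rw [← List.map_append, ht2, List.map_append]
        rfl
      · simpa [Code.Candidate.rest₁, Code.Candidate.rest₂] using ht.rho
      · simpa [Code.Candidate.fst, Code.Candidate.snd, path] using ht.left
      · simpa [Code.Candidate.fst, Code.Candidate.snd, path] using ht.right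
      · rw [hbr]
        intro heq
        rw [← heq] at k₂
        exact hne (e.codesStep_injective k₁ k₂)
      · rw [← below_iff hy₁ hy₂, hl0, ← hlm] at h1
        exact h1
      · rw [← above_iff hy₁ hy₂, hl0, ← hlm] at h2
        exact h2
      · rw [← below_iff hy₂ hy₁, hl0, ← hlm] at h3
        exact h3
      · rw [← above_iff hy₂ hy₁, hl0, ← hlm] at h4
        exact h4

theorem mem_criticalList (h : e.Describes c) (hpos : ∀ A, 0 < (Q.src2 A).length)
    {b : Code.RwStep V E T U × Code.RwStep V E T U} :
    b ∈ Code.criticalList c ↔ ∃ S₁ S₂ : Q.Step, Q.IsCritical S₁ S₂ ∧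
      e.CodesStep S₁ b.1 ∧ e.CodesStep S₂ b.2 := by
  simp only [Code.criticalList, List.mem_append, List.mem_map, mem_halfList h hpos]
  constructor
  · rintro (⟨S₁, S₂, hc, -, h1, h2⟩ | ⟨b, ⟨S₁, S₂, hc, -, h1, h2⟩, rfl⟩)
    · exact ⟨S₁, S₂, hc, h1, h2⟩
    · exact ⟨S₂, S₁, hc.symm, h2, h1⟩
  · rintro ⟨S₁, S₂, hc, h1, h2⟩
    rcases ((isCritical_iff hpos).1 hc).1.lam with h0 | h0
    · exact .inl ⟨S₁, S₂, hc, h0, h1, h2⟩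
    · exact .inr ⟨b.swap, ⟨S₂, S₁, hc.symm, h0, h2, h1⟩, Prod.swap_swap b⟩

end Labels

/-- A Gray presentation with finitely many `2`-generators and operational `3`-generators and
sources of positive length has finitely many critical branchings. -/
theorem GrayPresentation.finite_isCritical (Q : GrayPresentation.{u}) [Finite Q.G2]
    (hop : {A : Q.G3 | Q.IsOperational A}.Finite) (hpos : ∀ A : Q.G3, 0 < (Q.src2 A).length) :
    {S : Q.Step × Q.Step | Q.IsCritical S.1 S.2}.Finite := by
  -- Each generator is its own label, so no countability is needed.
  let e : Labels Q Q.G0 Q.G1 Q.G2 Q.G3 :=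
    ⟨id, id, id, id, fun _ _ h => h, fun _ _ h => h, fun _ _ h => h, fun _ _ _ _ h => h⟩
  obtain ⟨c₁, hc₁⟩ := (Set.finite_range
    fun α => (e.n2 α, e.path (Q.src1 α), e.path (Q.tgt1 α))).exists_finset_coe
  obtain ⟨c₂, hc₂⟩ := (hop.image
    fun A => (e.n3 A, e.cell (Q.src2 A), e.cell (Q.tgt2 A))).exists_finset_coe
  have hdesc : e.Describes (c₁.toList, c₂.toList) := by
    constructor
    · intro x
      rw [Finset.mem_toList, ← Finset.mem_coe, hc₁]
      exact exists_congr fun _ => eq_comm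
    · intro x
      rw [Finset.mem_toList, ← Finset.mem_coe, hc₂]
      exact exists_congr fun _ => and_congr_right fun _ => eq_comm
  choose k hk using e.exists_codesStep
  -- Coding steps is injective, and the codes of critical branchings lie in a list.
  refine Set.Finite.of_finite_image (f := fun S => (k S.1, k S.2)) ?_ ?_
  · refine (List.finite_toSet (Code.criticalList (c₁.toList, c₂.toList))).subset ?_
    rintro _ ⟨S, hS, rfl⟩
    exact (Labels.mem_criticalList hdesc hpos).2 ⟨S.1, S.2, hS, hk _, hk _⟩
  · intro S _ S' _ h
    simp only [Prod.mk.injEq] at h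
    refine Prod.ext ?_ ?_
    · exact e.codesStep_injective (hk S.1) (h.1 ▸ hk S'.1)
    · exact e.codesStep_injective (hk S.2) (h.2 ▸ hk S'.2)

end GrayRewriting

namespace GrayRewriting

namespace Code

/-! ### Computability of the list of critical branchings -/

open Primrec

local instance : Primcodable (Path ℕ ℕ) := Primcodable.prod
local instance : Primcodable (Wh ℕ ℕ ℕ) := Primcodable.prod
local instance : Primcodable (Cell ℕ ℕ ℕ) := Primcodable.prod
local instance : Primcodable (Gen ℕ ℕ ℕ ℕ) := Primcodable.sum
local instance : Primcodable (RwStep ℕ ℕ ℕ ℕ) := Primcodable.prod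
local instance : Primcodable (Presentation ℕ ℕ ℕ ℕ) := Primcodable.prod
local instance : Primcodable (Entry ℕ ℕ ℕ ℕ) := Primcodable.prod
local instance : Primcodable (Placed ℕ ℕ ℕ ℕ) := Primcodable.prod
local instance : Primcodable (Candidate ℕ ℕ ℕ ℕ) := Primcodable.prod

section Lists

variable {α β : Type*} [Primcodable α] [Primcodable β]

theorem primrec_singleton {f : α → β} (hf : Primrec f) : Primrec fun a => [f a] :=
  list_cons.comp hf (const [])

/-- The decision procedure is arbitrary: the lists use the classical one, and only the truth of the
condition affects the value. -/
theorem primrec_ite {c : α → Prop} {d : DecidablePred c} {f g : α → β} (hc : PrimrecPred c)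
    (hf : Primrec f) (hg : Primrec g) : Primrec fun a => if c a then f a else g a :=
  Primrec.ite hc hf hg

theorem primrec_filter {p : α → Prop} {d : DecidablePred p} (hp : PrimrecPred p) :
    Primrec fun l : List α => l.filter fun a => p a :=
  Primrec.listFilter hp

theorem primrec_splits : Primrec (splits : List α → _) :=
  list_map (list_range.comp (succ.comp list_length))
    ((list_take.comp .snd .fst).pair (list_drop.comp .snd .fst))

theorem primrec_lastList : Primrec (lastList : List α → _) :=
  optionToList.comp (list_head?.comp list_reverse)

theorem primrec_lastVal {f : α → ℕ} (hf : Primrec f) : Primrec (lastVal f) :=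
  list_foldl .id (const 0) (hf.comp (snd.comp snd)).to₂

theorem primrec_firstVal {f : α → ℕ} (hf : Primrec f) : Primrec (firstVal f) :=
  list_foldr .id (const 0) (hf.comp (fst.comp snd)).to₂

end Lists

section Paths

variable {α : Type*} [Primcodable α]

theorem primrec_comp {f g : α → Path ℕ ℕ} (hf : Primrec f) (hg : Primrec g) :
    Primrec fun a => comp (f a) (g a) :=
  (fst.comp hf).pair (list_append.comp (snd.comp hf) (snd.comp hg))

theorem primrec_cod {f : α → Path ℕ ℕ} (hf : Primrec f) : Primrec fun a => cod (f a) :=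
  list_foldl (snd.comp hf) (fst.comp hf) (snd.comp (snd.comp (snd.comp snd))).to₂

theorem primrec_whisk {f g : α → Path ℕ ℕ} {k : α → Wh ℕ ℕ ℕ} (hf : Primrec f) (hg : Primrec g)
    (hk : Primrec k) : Primrec fun a => whisk (f a) (g a) (k a) :=
  (primrec_comp hf (fst.comp hk)).pair
    ((fst.comp (snd.comp hk)).pair (primrec_comp (snd.comp (snd.comp hk)) hg))

end Paths

theorem primrec_factors : Primrec (factors : Path ℕ ℕ → _) := by
  refine list_flatMap (primrec_splits.comp snd) (list_map (primrec_splits.comp (snd.comp snd)) ?_)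
  refine Primrec.pair (primrec_cod (Primrec.pair ?_ ?_)) (fst.comp snd)
  · exact fst.comp (fst.comp fst)
  · exact fst.comp (snd.comp fst)

/-- The presentations with generators named by natural numbers. -/
abbrev NatPresentation := Presentation ℕ ℕ ℕ ℕ

theorem primrec_paths : Primrec (paths : NatPresentation → _) := by
  refine list_flatMap ?_ (primrec_factors.comp snd).to₂
  refine list_append.comp (list_flatMap fst ?_) (list_flatMap snd (list_flatMap ?_ ?_))
  · exact list_cons.comp (fst.comp (snd.comp snd))
      (primrec_singleton (snd.comp (snd.comp snd)))
  · exact snd.comp (fst.comp (snd.comp snd))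
  · exact list_cons.comp (fst.comp snd) (primrec_singleton (snd.comp (snd.comp snd)))

theorem primrec_opEntries : Primrec (opEntries : NatPresentation → _) := by
  refine list_flatMap snd (list_flatMap (primrec_lastList.comp
    (snd.comp (fst.comp (snd.comp snd)))) (list_flatMap (fst.comp (fst.comp fst)) ?_))
  have hx : Primrec fun p : ((NatPresentation × (ℕ × Cell ℕ ℕ ℕ × Cell ℕ ℕ ℕ)) × Wh ℕ ℕ ℕ) ×
    (ℕ × Path ℕ ℕ × Path ℕ ℕ) => p.1.1.2 := snd.comp (fst.comp fst)
  have hw : Primrec fun p : ((NatPresentation × (ℕ × Cell ℕ ℕ ℕ × Cell ℕ ℕ ℕ)) × Wh ℕ ℕ ℕ) ×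
    (ℕ × Path ℕ ℕ × Path ℕ ℕ) => p.1.2 := snd.comp fst
  refine primrec_ite (Primrec.eq.comp (fst.comp (snd.comp hw)) (fst.comp snd))
    (primrec_singleton (Primrec.pair (sumInl.comp (fst.comp hx)) (Primrec.pair
      (fst.comp (snd.comp hx)) (primrec_comp (primrec_comp (fst.comp hw)
        (snd.comp (snd.comp snd))) (snd.comp (snd.comp hw)))))) (const [])

theorem primrec_interEntry {α : Type*} [Primcodable α] {f g : α → ℕ × Path ℕ ℕ × Path ℕ ℕ}
    {k : α → Path ℕ ℕ} (hf : Primrec f) (hg : Primrec g) (hk : Primrec k) :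
    Primrec fun a => (interEntry (f a) (g a) (k a) : Entry ℕ ℕ ℕ ℕ) := by
  have f1 := fst.comp (snd.comp hf)
  have f2 := snd.comp (snd.comp hf)
  have g1 := fst.comp (snd.comp hg)
  have g2 := snd.comp (snd.comp hg)
  refine Primrec.pair (sumInr.comp ((fst.comp hf).pair (hk.pair (fst.comp hg))))
    (Primrec.pair (Primrec.pair (primrec_comp f1 (primrec_comp hk g1)) (list_cons.comp
      (Primrec.pair ((fst.comp f1).pair (const [])) ((fst.comp hf).pair (primrec_comp hk g1)))
      (primrec_singleton (Primrec.pair (primrec_comp f2 hk) ((fst.comp hg).pair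
        ((primrec_cod g1).pair (const [])))))))
      (primrec_comp (primrec_comp f2 hk) g2))

theorem primrec_interEntries : Primrec (interEntries : NatPresentation → _) := by
  refine list_flatMap fst (list_flatMap (fst.comp fst)
    (list_flatMap (primrec_paths.comp (fst.comp fst)) ?_))
  have ha : Primrec fun p : ((NatPresentation × (ℕ × Path ℕ ℕ × Path ℕ ℕ)) ×
    (ℕ × Path ℕ ℕ × Path ℕ ℕ)) × Path ℕ ℕ => p.1.1.2 := snd.comp (fst.comp fst)
  have hb : Primrec fun p : ((NatPresentation × (ℕ × Path ℕ ℕ × Path ℕ ℕ)) ×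
    (ℕ × Path ℕ ℕ × Path ℕ ℕ)) × Path ℕ ℕ => p.1.2 := snd.comp fst
  exact primrec_ite (PrimrecPred.and
    (Primrec.eq.comp (primrec_cod (fst.comp (snd.comp ha))) (fst.comp snd))
    (Primrec.eq.comp (primrec_cod snd) (fst.comp (fst.comp (snd.comp hb)))))
    (primrec_singleton (primrec_interEntry ha hb snd)) (const [])

theorem primrec_entries : Primrec (entries : NatPresentation → _) :=
  list_append.comp primrec_opEntries primrec_interEntries

theorem primrec_placed : Primrec (placed : NatPresentation → _) := by
  refine list_flatMap primrec_paths (list_flatMap (primrec_entries.comp fst)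
    (list_flatMap (primrec_paths.comp (fst.comp fst)) ?_))
  have hl : Primrec fun p : ((NatPresentation × Path ℕ ℕ) × Entry ℕ ℕ ℕ ℕ) × Path ℕ ℕ => p.1.1.2 :=
    snd.comp (fst.comp fst)
  have hy : Primrec fun p : ((NatPresentation × Path ℕ ℕ) × Entry ℕ ℕ ℕ ℕ) × Path ℕ ℕ => p.1.2 :=
    snd.comp fst
  have hd := fst.comp (fst.comp (snd.comp hy))
  exact primrec_ite (PrimrecPred.and
    (Primrec.eq.comp (primrec_cod hl) (fst.comp hd))
    (Primrec.eq.comp (primrec_cod hd) (fst.comp snd)))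
    (primrec_singleton (hl.pair (hy.pair snd))) (const [])

section Placed

variable {α : Type*} [Primcodable α] {p : α → Placed ℕ ℕ ℕ ℕ}

theorem primrec_dom (hp : Primrec p) : Primrec fun a => (p a).dom :=
  primrec_comp (primrec_comp (fst.comp hp)
    (fst.comp (fst.comp (snd.comp (fst.comp (snd.comp hp)))))) (snd.comp (snd.comp hp))

theorem primrec_cod_placed (hp : Primrec p) : Primrec fun a => (p a).cod :=
  primrec_comp (primrec_comp (fst.comp hp)
    (snd.comp (snd.comp (fst.comp (snd.comp hp))))) (snd.comp (snd.comp hp))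

theorem primrec_steps (hp : Primrec p) : Primrec fun a => (p a).steps :=
  list_map (snd.comp (fst.comp (snd.comp (fst.comp (snd.comp hp)))))
    (primrec_whisk (fst.comp (hp.comp fst)) (snd.comp (snd.comp (hp.comp fst))) snd).to₂

end Placed

theorem primrec_candidates :
    Primrec (candidates : List (Placed ℕ ℕ ℕ ℕ) → List (Candidate ℕ ℕ ℕ ℕ)) := by
  refine list_flatMap .id (list_flatMap fst (list_flatMap
    (primrec_splits.comp (primrec_steps (snd.comp fst))) (list_flatMap
    (primrec_splits.comp (primrec_steps (snd.comp fst))) (list_map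
    (primrec_splits.comp (snd.comp (snd.comp fst))) ?_))))
  refine Primrec.pair (Primrec.pair ?_ ?_) (Primrec.pair ?_ (Primrec.pair ?_ (snd.comp snd)))
  · exact snd.comp (fst.comp (fst.comp (fst.comp fst)))
  · exact snd.comp (fst.comp (fst.comp fst))
  · exact snd.comp (fst.comp fst)
  · exact snd.comp (snd.comp fst)

section Predicates

variable {α : Type*} [Primcodable α]

theorem primrec_midBound {A : α → Gen ℕ ℕ ℕ ℕ} (hA : Primrec A) :
    Primrec fun a => midBound (A a) :=
  (sumCasesOn hA (const 0).to₂
    (succ.comp (list_length.comp (snd.comp (fst.comp (snd.comp snd))))).to₂).of_eq fun a => by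
      rcases A a with _ | _ <;> rfl

variable {i j : α → ℕ} {y z : α → Entry ℕ ℕ ℕ ℕ}

theorem primrecPred_below (hi : Primrec i) (hj : Primrec j) (hy : Primrec y) (hz : Primrec z) :
    PrimrecPred fun a => Below (i a) (j a) (y a) (z a) := by
  have hs := snd.comp (fst.comp (snd.comp hy))
  refine PrimrecPred.and (Primrec.eq.comp (succ.comp hj)
    (nat_add.comp hi (list_length.comp hs))) (nat_lt.comp ?_ (primrec_midBound (fst.comp hz)))
  exact (primrec_lastVal (list_length.comp (snd.comp (snd.comp snd)))).comp hs

theorem primrecPred_above (hi : Primrec i) (hj : Primrec j) (hy : Primrec y) (hz : Primrec z) :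
    PrimrecPred fun a => Above (i a) (j a) (y a) (z a) := by
  have hs := snd.comp (fst.comp (snd.comp hy))
  refine PrimrecPred.and (Primrec.eq.comp hi (succ.comp hj))
    (nat_lt.comp ?_ (primrec_midBound (fst.comp hz)))
  exact (primrec_firstVal (list_length.comp (snd.comp fst))).comp hs

end Predicates

namespace Candidate

/-- The candidates with generators named by natural numbers. -/
abbrev NatCandidate := Candidate ℕ ℕ ℕ ℕ

theorem primrec_fst : Primrec (fst : NatCandidate → _) := Primrec.fst.comp Primrec.fst
theorem primrec_snd : Primrec (snd : NatCandidate → _) := Primrec.snd.comp Primrec.fst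
theorem primrec_pre : Primrec (pre : NatCandidate → _) :=
  Primrec.fst.comp (Primrec.fst.comp Primrec.snd)
theorem primrec_overlap : Primrec (overlap : NatCandidate → _) :=
  Primrec.snd.comp (Primrec.fst.comp Primrec.snd)
theorem primrec_rest₁ : Primrec (rest₁ : NatCandidate → _) :=
  Primrec.fst.comp (Primrec.snd.comp Primrec.snd)
theorem primrec_rest₂ : Primrec (rest₂ : NatCandidate → _) :=
  Primrec.snd.comp (Primrec.snd.comp Primrec.snd)

theorem primrec_branching : Primrec (branching : NatCandidate → _) := by
  have hd := primrec_dom primrec_fst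
  refine Primrec.pair (Primrec.pair (hd.pair (const [])) (Primrec.pair ?_ (Primrec.pair ?_
    (Primrec.pair ?_ ((primrec_cod_placed primrec_fst).pair primrec_rest₁)))))
    (Primrec.pair (hd.pair primrec_pre) (Primrec.pair ?_ (Primrec.pair ?_
    (Primrec.pair ?_ ((primrec_cod_placed primrec_snd).pair primrec_rest₂)))))
  · exact Primrec.fst.comp primrec_fst
  · exact Primrec.fst.comp (Primrec.fst.comp (Primrec.snd.comp primrec_fst))
  · exact Primrec.snd.comp (Primrec.snd.comp primrec_fst)
  · exact Primrec.fst.comp primrec_snd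
  · exact Primrec.fst.comp (Primrec.fst.comp (Primrec.snd.comp primrec_snd))
  · exact Primrec.snd.comp (Primrec.snd.comp primrec_snd)

theorem primrecPred_valid : PrimrecPred (Valid : NatCandidate → Prop) := by
  have hl := list_length.comp primrec_pre
  have h0 : Primrec fun _ : NatCandidate => 0 := const 0
  have hy := Primrec.fst.comp (Primrec.snd.comp primrec_fst)
  have hz := Primrec.fst.comp (Primrec.snd.comp primrec_snd)
  refine PrimrecPred.and (Primrec.eq.comp primrec_overlap (const [])).not ?_
  refine PrimrecPred.and (Primrec.eq.comp (list_append.comp primrec_overlap primrec_rest₁)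
    (list_append.comp (primrec_steps primrec_snd) primrec_rest₂)) ?_
  refine PrimrecPred.and (PrimrecPred.or (Primrec.eq.comp primrec_rest₁ (const []))
    (Primrec.eq.comp primrec_rest₂ (const []))) ?_
  refine PrimrecPred.and (PrimrecPred.or
    (Primrec.eq.comp (Primrec.snd.comp (Primrec.fst.comp primrec_fst)) (const []))
    (Primrec.eq.comp (Primrec.snd.comp (Primrec.fst.comp primrec_snd)) (const []))) ?_
  refine PrimrecPred.and (PrimrecPred.or
    (Primrec.eq.comp (Primrec.snd.comp (Primrec.snd.comp (Primrec.snd.comp primrec_fst)))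
      (const []))
    (Primrec.eq.comp (Primrec.snd.comp (Primrec.snd.comp (Primrec.snd.comp primrec_snd)))
      (const []))) ?_
  refine PrimrecPred.and (Primrec.eq.comp (Primrec.fst.comp primrec_branching)
    (Primrec.snd.comp primrec_branching)).not ?_
  exact PrimrecPred.and (primrecPred_below h0 hl hy hz).not (PrimrecPred.and
    (primrecPred_above h0 hl hy hz).not (PrimrecPred.and
    (primrecPred_below hl h0 hz hy).not (primrecPred_above hl h0 hz hy).not))

end Candidate

theorem primrec_halfList : Primrec (halfList : NatPresentation → _) :=
  list_map ((primrec_filter Candidate.primrecPred_valid).comp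
    (primrec_candidates.comp primrec_placed)) (Candidate.primrec_branching.comp snd).to₂

theorem primrec_criticalList : Primrec (criticalList : NatPresentation → _) :=
  list_append.comp primrec_halfList
    (list_map primrec_halfList ((snd.comp snd).pair (fst.comp snd)).to₂)

end Code

/-- A naming by natural numbers as a labelling. -/
def Naming.toLabels {Q : GrayPresentation.{u}} (e : Naming Q) : Labels Q ℕ ℕ ℕ ℕ :=
  ⟨e.n0, e.n1, e.n2, e.n3, e.inj0, e.inj1, e.inj2, e.inj3⟩

end GrayRewriting

theorem mainTheorem3 :
    (∀ Q : GrayRewriting.GrayPresentation.{u},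
      Finite Q.G2 → {A : Q.G3 | Q.IsOperational A}.Finite → (∀ A : Q.G3, 0 < (Q.src2 A).length) →
      {S : Q.Step × Q.Step | Q.IsCritical S.1 S.2}.Finite) ∧
    (∃ F : GrayRewriting.CodePresentation →.
        List (GrayRewriting.CodeStep × GrayRewriting.CodeStep),
      Partrec F ∧
      ∀ (Q : GrayRewriting.GrayPresentation.{u}) (e : GrayRewriting.Naming Q)
        (c : GrayRewriting.CodePresentation),
        e.Describes c → (∀ A : Q.G3, 0 < (Q.src2 A).length) →
        ∃ L ∈ F c, ∀ b, b ∈ L ↔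
          ∃ S₁ S₂ : Q.Step, Q.IsCritical S₁ S₂ ∧ e.CodesStep S₁ b.1 ∧ e.CodesStep S₂ b.2) := by
  refine ⟨fun Q _ hop hpos => Q.finite_isCritical hop hpos,
    (GrayRewriting.Code.criticalList : GrayRewriting.Code.NatPresentation → _),
    GrayRewriting.Code.primrec_criticalList.to_comp.partrec, ?_⟩
  intro Q e c hc hpos
  -- Codes and descriptions formed with `e.toLabels` are by definition those formed with `e`.
  exact ⟨GrayRewriting.Code.criticalList c, Part.mem_some _, fun b =>
    GrayRewriting.Labels.mem_criticalList (e := e.toLabels) hc hpos⟩
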